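/- **Setting.** A *reference curve* is a smooth unit-speed curve $\gamma_0:\mathbb R\to\mathbb R^3$ for which there are a point $p$, a unit vector $e$ and reals $a,b$ with $\gamma_0(s)-(p+(s+a)e)\to0$ as $s\to+\infty$ and $\gamma_0(s)-(p+(s+b)e)\to0$ as $s\to-\infty$ (for instance a straight line). Fix one. A function $f:\mathbb R\to\mathbb R$ is *asymptotically polynomial-like* if $f/P\to0$ as $s\to\pm\infty$ for some nonzero polynomial $P$, and *rapidly decreasing* if $fP\to0$ as $s\to\pm\infty$ for every polynomial $P$. Let $BAL$ be the set of smooth unit-speed curves $\gamma:\mathbb R\to\mathbb R^3$ with nowhere vanishing curvature $\kappa$ and torsion $\tau$ such that $\kappa$ is rapidly decreasing, $\kappa^{-1}\partial_s^n\kappa$ and $\partial_s^n\tau$ are asymptotically polynomial-like for all $n\ge0$, and there is a number $\ell_+=\ell_-$ with $\gamma(s\pm\ell_\pm)-\gamma_0(s)\to0$ as $s\to\pm\infty$; put $\ell(\gamma)=\ell_++\ell_-$. Let $T,N,B$ be the Frenet frame ($B=T\times N$). A scalar field is a function $BAL\times\mathbb R\to\mathbb R$; a tangent field is a function $BAL\times\mathbb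 R\to\mathbb R^3$. On scalar fields let $\partial_s$ be the $s$-derivative, $\int f=\int_{-\infty}^\infty f\,ds$ and $\partial_s^{-1}f(s)=\frac12\bigl(\int_{-\infty}^s f-\int_s^\infty f\bigr)$; on tangent fields let $\nabla_s$ be the $s$-derivative. Let $\mathfrak A_n$ ($n\in\mathbb Z$) be the smallest family of real vector spaces of scalar fields with $\kappa\in\mathfrak A_1$, $\kappa^{-1}\in\mathfrak A_{-1}$, $\tau,s,\ell,1\in\mathfrak A_0$, $\mathfrak A_n\subset\mathfrak A_{n-1}$, $\mathfrak A_i\mathfrak A_j\subset\mathfrak A_{i+j}$, $\partial_s\mathfrak A_n\subset\mathfrak A_n$, and $\partial_s^{-1}\mathfrak A_2,\int\mathfrak A_2\subset\mathfrak A_0$. Let $\mathcal F$ be the real algebra generated by $1$, $\ell$ and $\int\mathfrak A_2$. The space of vector fields is $\mathcal X=\{g\mathbf N+h\mathbf B: g,h\in\mathfrak A_1\}$, where $\mathbf N=\varphi(N)$, $\mathbf B=\varphi(B)$ and $\varphi(fT+gN+hB)=g\mathbf N+h\mathbf B$. Put $\wp(g\mathbf N+h\mathbf B)=\partial_s^{-1}(\kappa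 g)T+gN+hB$ and $J(g\mathbf N+h\mathbf B)=h\mathbf N-g\mathbf B$. For $\gamma\in BAL$ and a vector field $V$ along $\gamma$, a *variation* of $\gamma$ along $V$ is a family $\Gamma_\varepsilon\in BAL$ ($\varepsilon\in\mathbb R$) with $\Gamma_0=\gamma$ such that: (i) $\frac{d}{d\varepsilon}\big|_{0}\partial_s^n\Gamma_\varepsilon(s)=\partial_s^nV(s)$ for all $n\ge0$, $s\in\mathbb R$; (ii) for every $n\ge0$ there are $C,m$ such that for all sufficiently small $\varepsilon$ and all $s$, $|\partial_s^{n}(T_{\Gamma_\varepsilon}-T_\gamma)(s)|\le|\varepsilon|\,C(1+|s|)^m\kappa_\gamma(s)$; (iii) there are $C,m$ such that for all sufficiently small $\varepsilon$ and all $s$, $\kappa_\gamma(s)\le C(1+|s|)^m\kappa_{\Gamma_\varepsilon}(s)$. For a tangent field $X$ and a scalar or tangent field $f$, the *variational differential* of $f$ along $X$ is the field $f'$ such that $\frac{d}{d\varepsilon}\big|_0f(\Gamma_\varepsilon,s)=f'(\gamma,s)$ for all $\gamma\in BAL$, $s\in\mathbb R$ and all variations $\Gamma$ of $\gamma$ along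 $X(\gamma)$, provided that exactly one such field exists; for a tangent field $f$ it is written $\nabla_Xf$. **Theorem.** For all $X,Y\in\mathcal X$ the tangent field $\wp(Y)$ has a (unique) variational differential $\nabla_{\wp(X)}\wp(Y)$, and with $\widetilde\nabla_X:=\varphi\circ\nabla_{\wp(X)}\circ\wp$ the commutator $[X,Y]:=\widetilde\nabla_XY-\widetilde\nabla_YX$ belongs to $\mathcal X$. The recursion operator $$R=KJ^{-1}=J\circ\varphi\circ\nabla_s\circ\wp,\qquad K=J\circ\varphi\circ\nabla_s\circ\wp\circ J,$$ is an $\mathcal F$-linear map $\mathcal X\to\mathcal X$, and it is hereditary, i.e. its Nijenhuis torsion vanishes: $$N_R(X,Y)=[RX,RY]-R[RX,Y]-R[X,RY]+R^2[X,Y]=0\qquad\text{for all }X,Y\in\mathcal X.$$ -/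

import Mathlib

open scoped ContDiff Topology

noncomputable section

namespace VortexFilament

/-- Euclidean three-space. -/
abbrev E3 : Type := EuclideanSpace ℝ (Fin 3)

/-- The vector product of `E3`. -/
def cross (u v : E3) : E3 := WithLp.toLp 2 (crossProduct u.ofLp v.ofLp)

/-! ### Frenet frame, curvature and torsion of an arclength-parametrized curve -/

/-- Unit tangent. -/
def frameT (c : ℝ → E3) (s : ℝ) : E3 := deriv c s

/-- Curvature. -/
def curvature (c : ℝ → E3) (s : ℝ) : ℝ := ‖deriv (frameT c) s‖

/-- Principal normal, so that `T' = κ N`. -/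
def frameN (c : ℝ → E3) (s : ℝ) : E3 := (curvature c s)⁻¹ • deriv (frameT c) s

/-- Binormal. -/
def frameB (c : ℝ → E3) (s : ℝ) : E3 := cross (frameT c s) (frameN c s)

/-- Torsion, the `B`-component of `N'`. -/
def torsion (c : ℝ → E3) (s : ℝ) : ℝ := inner ℝ (deriv (frameN c) s) (frameB c s)

/-! ### Asymptotic conditions -/

/-- `f / P → 0` as `s → ±∞` for some nonzero real polynomial `P`. -/
def AsympPolyLike (f : ℝ → ℝ) : Prop :=
  ∃ P : Polynomial ℝ, P ≠ 0 ∧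
    Filter.Tendsto (fun s => f s / P.eval s) (Filter.atBot ⊔ Filter.atTop) (𝓝 0)

/-- `f * P → 0` as `s → ±∞` for every real polynomial `P`. -/
def RapidlyDecreasing (f : ℝ → ℝ) : Prop :=
  ∀ P : Polynomial ℝ,
    Filter.Tendsto (fun s => f s * P.eval s) (Filter.atBot ⊔ Filter.atTop) (𝓝 0)

/-- Smooth curves `ℝ → E3` of unit speed. -/
structure IsArclengthCurve (c : ℝ → E3) : Prop where
  smooth : ContDiff ℝ ∞ c
  unit_speed : ∀ s, ‖deriv c s‖ = 1

/-- Reference curves: smooth unit speed curves that are asymptotic, at both ends, to one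
oriented straight line (for example that line itself). -/
structure IsReferenceCurve (γ₀ : ℝ → E3) : Prop extends IsArclengthCurve γ₀ where
  asymptotic : ∃ (p e : E3) (a b : ℝ), ‖e‖ = 1 ∧
    Filter.Tendsto (fun s => γ₀ s - (p + (s + a) • e)) Filter.atTop (𝓝 0) ∧
    Filter.Tendsto (fun s => γ₀ s - (p + (s + b) • e)) Filter.atBot (𝓝 0)

/-- Balanced asymptotically linear curves, relative to the reference curve `γ₀`. -/
structure IsBAL (γ₀ c : ℝ → E3) : Prop extends IsArclengthCurve c where
  curvature_ne_zero : ∀ s, curvature c s ≠ 0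
  curvature_rapid : RapidlyDecreasing (curvature c)
  curvature_poly : ∀ n : ℕ,
    AsympPolyLike (fun s => (curvature c s)⁻¹ * iteratedDeriv n (curvature c) s)
  torsion_poly : ∀ n : ℕ, AsympPolyLike (iteratedDeriv n (torsion c))
  balanced : ∃ L : ℝ,
    Filter.Tendsto (fun s => c (s + L) - γ₀ s) Filter.atTop (𝓝 0) ∧
    Filter.Tendsto (fun s => c (s - L) - γ₀ s) Filter.atBot (𝓝 0)

/-- The space of balanced asymptotically linear curves. -/
def BAL (γ₀ : ℝ → E3) : Type := {c : ℝ → E3 // IsBAL γ₀ c}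

variable {γ₀ : ℝ → E3}

/-- The renormalized length `ℓ = ℓ₊ + ℓ₋ = 2 ℓ₊` of a curve. -/
def renormalizedLength (γ : BAL γ₀) : ℝ := 2 * Classical.choose γ.2.balanced

/-! ### Scalar fields and tangent fields -/

/-- Scalar fields on `BAL`. -/
abbrev ScalarField (γ₀ : ℝ → E3) : Type := BAL γ₀ → ℝ → ℝ

/-- Tangent fields; every tangent space of `E3` is identified with `E3`. -/
abbrev TangentField (γ₀ : ℝ → E3) : Type := BAL γ₀ → ℝ → E3

/-- The scalar field `κ`. -/
def kappa : ScalarField γ₀ := fun γ s => curvature γ.1 s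

/-- The scalar field `κ⁻¹`. -/
def kappaInv : ScalarField γ₀ := fun γ s => (curvature γ.1 s)⁻¹

/-- The scalar field `τ`. -/
def tau : ScalarField γ₀ := fun γ s => torsion γ.1 s

/-- The scalar field `s`. -/
def arc : ScalarField γ₀ := fun _ s => s

/-- The functional `ℓ`. -/
def ell : ScalarField γ₀ := fun γ _ => renormalizedLength γ

/-- The tangent field `T`. -/
def fieldT : TangentField γ₀ := fun γ s => frameT γ.1 s

/-- The tangent field `N`. -/
def fieldN : TangentField γ₀ := fun γ s => frameN γ.1 s

/-- The tangent field `B`. -/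
def fieldB : TangentField γ₀ := fun γ s => frameB γ.1 s

/-- `∂ₛ` on scalar fields. -/
def dS (f : ScalarField γ₀) : ScalarField γ₀ := fun γ s => deriv (f γ) s

/-- `∇ₛ` on tangent fields. -/
def nablaS (V : TangentField γ₀) : TangentField γ₀ := fun γ s => deriv (V γ) s

/-- The balanced anti-differentiation `∂ₛ⁻¹`. -/
def antiS (f : ScalarField γ₀) : ScalarField γ₀ := fun γ s =>
  (1 / 2) * ((∫ x in Set.Iic s, f γ x) - ∫ x in Set.Ioi s, f γ x)

/-- The definite integration `∫`. -/
def integ (f : ScalarField γ₀) : ScalarField γ₀ := fun γ _ => ∫ x, f γ x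

/-- `Alg n f`: the scalar field `f` has an expression in `κ, κ⁻¹, τ, s, ℓ, 1` whose
membership in the `n`-th space follows from the grading rules. -/
inductive Alg : ℤ → ScalarField γ₀ → Prop
  | add {n : ℤ} {f g : ScalarField γ₀} : Alg n f → Alg n g → Alg n (f + g)
  | smul {n : ℤ} {f : ScalarField γ₀} (r : ℝ) : Alg n f → Alg n (r • f)
  | lower {n : ℤ} {f : ScalarField γ₀} : Alg n f → Alg (n - 1) f
  | mul {i j : ℤ} {f g : ScalarField γ₀} : Alg i f → Alg j g → Alg (i + j) (f * g)
  | dS {n : ℤ} {f : ScalarField γ₀} : Alg n f → Alg n (dS f)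
  | antiS {f : ScalarField γ₀} : Alg 2 f → Alg 0 (antiS f)
  | integ {f : ScalarField γ₀} : Alg 2 f → Alg 0 (integ f)
  | kappa : Alg 1 kappa
  | kappaInv : Alg (-1) kappaInv
  | tau : Alg 0 tau
  | arc : Alg 0 arc
  | ell : Alg 0 ell
  | one : Alg 0 1

/-- The algebra of functionals, generated by `1`, `ℓ` and the integrals. -/
def functionals (γ₀ : ℝ → E3) : Subalgebra ℝ (ScalarField γ₀) :=
  Algebra.adjoin ℝ ({1, ell} ∪ {F | ∃ f : ScalarField γ₀, Alg 2 f ∧ F = integ f})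

/-! ### Vector fields -/

/-- Pairs `(g, h)` of scalar fields, standing for `g N + h B` modulo multiples of `T`. -/
abbrev NormalField (γ₀ : ℝ → E3) : Type := ScalarField γ₀ × ScalarField γ₀

/-- The space `𝒳` of vector fields on `BAL`. -/
def vectorFields (γ₀ : ℝ → E3) : Set (NormalField γ₀) := {X | Alg 1 X.1 ∧ Alg 1 X.2}

/-- The projection `φ (f T + g N + h B) = g N + h B`. -/
def phi (V : TangentField γ₀) : NormalField γ₀ :=
  (fun γ s => inner ℝ (fieldN γ s) (V γ s), fun γ s => inner ℝ (fieldB γ s) (V γ s))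

/-- The injection `℘ (g N + h B) = ∂ₛ⁻¹(κ g) T + g N + h B`. -/
def wp (X : NormalField γ₀) : TangentField γ₀ := fun γ s =>
  antiS (kappa * X.1) γ s • fieldT γ s + X.1 γ s • fieldN γ s + X.2 γ s • fieldB γ s

/-! ### Variational calculus -/

/-- `Γ` is a variation of `γ` inside `BAL` with variational vector field `V` along `γ`.
All `s`-derivatives are differentiable at `ε = 0`, and the variation is controlled along the
whole curve: up to polynomial factors in `s`, the `s`-derivatives of the tangent differ by at
most `|ε| κ`, and the curvature is not less than that of `γ`. -/
structure IsVariation (γ : BAL γ₀) (V : ℝ → E3) (Γ : ℝ → BAL γ₀) : Prop where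
  base : Γ 0 = γ
  velocity : ∀ (n : ℕ) (s : ℝ),
    HasDerivAt (fun ε => iteratedDeriv n (Γ ε).1 s) (iteratedDeriv n V s) 0
  bound : ∀ n : ℕ, ∃ (C : ℝ) (m : ℕ), ∀ᶠ ε in 𝓝 (0 : ℝ), ∀ s : ℝ,
    ‖iteratedDeriv n (frameT (Γ ε).1) s - iteratedDeriv n (frameT γ.1) s‖
      ≤ |ε| * (C * (1 + |s|) ^ m * curvature γ.1 s)
  nondegenerate : ∃ (C : ℝ) (m : ℕ), ∀ᶠ ε in 𝓝 (0 : ℝ), ∀ s : ℝ,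
    curvature γ.1 s ≤ C * (1 + |s|) ^ m * curvature (Γ ε).1 s

/-- `f'` is the variational differential of the (scalar or tangent) field `f` along the tangent
field `X`: at every curve it is the derivative of `f` along every variation with variational
vector field `X`. -/
def HasVariation {W : Type} [NormedAddCommGroup W] [NormedSpace ℝ W]
    (X : TangentField γ₀) (f f' : BAL γ₀ → ℝ → W) : Prop :=
  ∀ (γ : BAL γ₀) (Γ : ℝ → BAL γ₀), IsVariation γ (X γ) Γ →
    ∀ s : ℝ, HasDerivAt (fun ε => f (Γ ε) s) (f' γ s) 0

open Classical in
/-- The variational differential operator associated with `X`; it is zero by convention on the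
fields that do not have a unique variational differential. -/
def variation {W : Type} [NormedAddCommGroup W] [NormedSpace ℝ W]
    (X : TangentField γ₀) (f : BAL γ₀ → ℝ → W) : BAL γ₀ → ℝ → W :=
  if h : ∃! f' : BAL γ₀ → ℝ → W, HasVariation X f f' then h.choose else 0

/-- The induced operator `φ ∘ ∇_{℘ X} ∘ ℘` on vector fields. -/
def nablaX (X Y : NormalField γ₀) : NormalField γ₀ := phi (variation (wp X) (wp Y))

/-- The commutator of vector fields. -/
def bracket (X Y : NormalField γ₀) : NormalField γ₀ := nablaX X Y - nablaX Y X

/-! ### The operators `J`, `K`, `R` and the Nijenhuis torsion -/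

/-- `J (g N + h B) = h N - g B`. -/
def opJ (X : NormalField γ₀) : NormalField γ₀ := (X.2, -X.1)

/-- The inverse of `J`. -/
def opJinv (X : NormalField γ₀) : NormalField γ₀ := (-X.2, X.1)

/-- `K = J φ ∇ₛ ℘ J`. -/
def opK (X : NormalField γ₀) : NormalField γ₀ := opJ (phi (nablaS (wp (opJ X))))

/-- The recursion operator `R = K J⁻¹`. -/
def recursionOperator (X : NormalField γ₀) : NormalField γ₀ := opK (opJinv X)

theorem opJ_opJinv (X : NormalField γ₀) : opJ (opJinv X) = X := by
  simp [opJ, opJinv]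

theorem opJinv_opJ (X : NormalField γ₀) : opJinv (opJ X) = X := by
  simp [opJ, opJinv]

theorem recursionOperator_eq (X : NormalField γ₀) :
    recursionOperator X = opJ (phi (nablaS (wp X))) := by
  simp [recursionOperator, opK, opJ_opJinv]

/-- The Nijenhuis torsion. -/
def nijenhuis (R : NormalField γ₀ → NormalField γ₀) (X Y : NormalField γ₀) : NormalField γ₀ :=
  bracket (R X) (R Y) - R (bracket (R X) Y) - R (bracket X (R Y)) + R (R (bracket X Y))

/-- `R` restricts to a map from vector fields to vector fields that is linear over the algebra of
functionals. -/
structure IsFunctionalLinear (R : NormalField γ₀ → NormalField γ₀) : Prop where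
  mapsTo : ∀ X ∈ vectorFields γ₀, R X ∈ vectorFields γ₀
  map_add : ∀ X ∈ vectorFields γ₀, ∀ Y ∈ vectorFields γ₀, R (X + Y) = R X + R Y
  map_mul : ∀ F ∈ functionals γ₀, ∀ X ∈ vectorFields γ₀,
    R (F * X.1, F * X.2) = (F * (R X).1, F * (R X).2)

/-- Hereditary operators on the space of vector fields. -/
structure IsHereditary (R : NormalField γ₀ → NormalField γ₀) : Prop
    extends IsFunctionalLinear R where
  torsion_eq_zero : ∀ X ∈ vectorFields γ₀, ∀ Y ∈ vectorFields γ₀, nijenhuis R X Y = 0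

end VortexFilament

end

/-!
# The recursion operator of the vortex filament hierarchy is hereditary

Write `Xᵢ = ℘ (Rⁱ X)` and `D_X` for the variational differential along `X₀`. Two facts drive the
proof. First, the recursion operator is characterized by `∂ₛ X₀ = T × X₁`
(`nablaS_wp_eq_cross`), and the variation of `T` along `X₀` is `∂ₛ X₀`. Secondly, a field whose
components lie in the algebra, with balanced tangential part, equals `℘ (φ P)` as soon as `∂ₛ P` is
normal to the curve (`BalancedField.eq_wp`). Since `D_X` commutes with `∂ₛ`, the Jacobi identity of
the vector product gives

* `∂ₛ (D_X Y₀ - D_Y X₀) = T × Q` with `Q = X₁ × Y₁ + D_X Y₁ - D_Y X₁`, and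
* `∂ₛ Q = T × S` with `S = X₂ × Y₁ + X₁ × Y₂ + D_X Y₂ - D_Y X₂`.

Hence `D_X Y₀ - D_Y X₀ = ℘ [X, Y]`, `R [X, Y] = φ Q` and `R² [X, Y] = φ S`. Applying the formula for
`R [X, Y]` to the pairs `(R X, Y)` and `(X, R Y)` too, all terms of the Nijenhuis torsion cancel.

The analytic work consists in making sense of `D_X`.

*Existence of differentials.* A variational differential is only a pointwise derivative, which does
not survive `∂ₛ` and integrals over the line. So a stronger relation `VarDiff` is used, which also
asks that the increments of the field along a variation be of order `ε κ ^ n`, with all their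
`s`-derivatives and up to polynomial factors (`Tame`). It is stable under all operations that
generate the algebra, and the generators `κ`, `κ⁻¹`, `τ`, `ℓ` have it by the Frenet equations
(`Alg.exists_varDiff`). The derivative of `ℓ` comes from the displacement of the ends of the curve.

*Uniqueness of differentials.* This requires a variation of every curve along every `℘ X`
(`exists_isVariation`). The tangent is moved in the direction `χ (r s) ∂ₛ (℘ X)`, where the cut-off
`χ` leaves the curve unchanged far out, and then normalized. The cut-off and the normalization spoil
the condition that the ends move along the asymptotic direction `e` only; the defect, which is
`o(ε)`, is compensated by a change of the tangent in a fixed region in which it is close to `e`. With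
`r` a suitable small power of `|ε|` the cut-off does not affect the derivatives at `ε = 0`, while the
curvature changes at most by half.
-/

namespace VortexFilament

open Filter MeasureTheory

/-! ### Functions bounded up to polynomial factors -/

section TameFamilies

variable {ι ι' : Type*} {l : Filter ι} {l' : Filter ι'}
  {W W₁ W₂ W₃ : Type*} [NormedAddCommGroup W] [NormedSpace ℝ W]
  [NormedAddCommGroup W₁] [NormedSpace ℝ W₁] [NormedAddCommGroup W₂] [NormedSpace ℝ W₂]
  [NormedAddCommGroup W₃] [NormedSpace ℝ W₃]

/-- `PolyBdd l w F`: eventually along `l`, the functions `F i` are bounded by the weight `w i` up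
to a polynomial factor in `s` that does not depend on `i`. The weight enters through its absolute
value, so that `ε` itself may serve as a weight. -/
def PolyBdd (l : Filter ι) (w : ι → ℝ → ℝ) (F : ι → ℝ → W) : Prop :=
  ∃ (C : ℝ) (m : ℕ), 0 ≤ C ∧ ∀ᶠ i in l, ∀ s, ‖F i s‖ ≤ C * (1 + |s|) ^ m * |w i s|

/-- A family of smooth functions all of whose derivatives are bounded by the weight `w`, in the
sense of `PolyBdd`. -/
structure Tame (l : Filter ι) (w : ι → ℝ → ℝ) (F : ι → ℝ → W) : Prop where
  smooth : ∀ᶠ i in l, ContDiff ℝ ∞ (F i)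
  bdd : ∀ k, PolyBdd l w (fun i => iteratedDeriv k (F i))

variable {w w' w₁ w₂ : ι → ℝ → ℝ} {F G : ι → ℝ → W}

set_option linter.unusedSectionVars false

theorem one_add_abs_pow_mono {m n : ℕ} (h : m ≤ n) (s : ℝ) : (1 + |s|) ^ m ≤ (1 + |s|) ^ n :=
  pow_le_pow_right₀ (by linarith [abs_nonneg s]) h

theorem PolyBdd.of_le (C : ℝ) (m : ℕ)
    (h : ∀ᶠ i in l, ∀ s, ‖F i s‖ ≤ C * (1 + |s|) ^ m * |w i s|) : PolyBdd l w F := by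
  refine ⟨max C 0, m, le_max_right _ _, h.mono fun i hi s => (hi s).trans ?_⟩
  gcongr
  exact le_max_left _ _

theorem PolyBdd.of_norm_le (h : ∀ᶠ i in l, ∀ s, ‖F i s‖ ≤ |w i s|) : PolyBdd l w F :=
  PolyBdd.of_le 1 0 (by simpa using h)

theorem PolyBdd.congr (hF : PolyBdd l w F) (h : ∀ᶠ i in l, ∀ s, G i s = F i s) :
    PolyBdd l w G := by
  obtain ⟨C, m, hC, hF⟩ := hF
  refine ⟨C, m, hC, ?_⟩
  filter_upwards [hF, h] with i hi hj s
  rw [hj]; exact hi s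

theorem PolyBdd.congr_weight (hF : PolyBdd l w F) (h : ∀ᶠ i in l, ∀ s, |w i s| = |w' i s|) :
    PolyBdd l w' F := by
  obtain ⟨C, m, hC, hF⟩ := hF
  refine ⟨C, m, hC, ?_⟩
  filter_upwards [hF, h] with i hi hj s
  rw [← hj]; exact hi s

theorem PolyBdd.add (hF : PolyBdd l w F) (hG : PolyBdd l w G) :
    PolyBdd l w (fun i s => F i s + G i s) := by
  obtain ⟨C, m, hC, hF⟩ := hF
  obtain ⟨D, n, hD, hG⟩ := hG
  refine ⟨C + D, max m n, add_nonneg hC hD, ?_⟩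
  filter_upwards [hF, hG] with i hi hj s
  calc ‖F i s + G i s‖ ≤ ‖F i s‖ + ‖G i s‖ := norm_add_le _ _
    _ ≤ C * (1 + |s|) ^ m * |w i s| + D * (1 + |s|) ^ n * |w i s| := add_le_add (hi s) (hj s)
    _ ≤ C * (1 + |s|) ^ (max m n) * |w i s| + D * (1 + |s|) ^ (max m n) * |w i s| := by
        gcongr <;> simp
    _ = _ := by ring

theorem PolyBdd.bilin (L : W₁ →L[ℝ] W₂ →L[ℝ] W₃) {F : ι → ℝ → W₁} {G : ι → ℝ → W₂}
    (hF : PolyBdd l w₁ F) (hG : PolyBdd l w₂ G) :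
    PolyBdd l (fun i s => w₁ i s * w₂ i s) (fun i s => L (F i s) (G i s)) := by
  obtain ⟨C, m, hC, hF⟩ := hF
  obtain ⟨D, n, hD, hG⟩ := hG
  refine ⟨‖L‖ * C * D, m + n, by positivity, ?_⟩
  filter_upwards [hF, hG] with i hi hj s
  calc ‖L (F i s) (G i s)‖ ≤ ‖L‖ * ‖F i s‖ * ‖G i s‖ := L.le_opNorm₂ _ _
    _ ≤ ‖L‖ * (C * (1 + |s|) ^ m * |w₁ i s|) * (D * (1 + |s|) ^ n * |w₂ i s|) := by
        gcongr
        · exact hi s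
        · exact hj s
    _ = _ := by rw [abs_mul]; ring

theorem PolyBdd.trans (hF : PolyBdd l w F) (hw : PolyBdd l w' w) : PolyBdd l w' F := by
  obtain ⟨C, m, hC, hF⟩ := hF
  obtain ⟨D, n, hD, hw⟩ := hw
  refine ⟨C * D, m + n, by positivity, ?_⟩
  filter_upwards [hF, hw] with i hi hj s
  calc ‖F i s‖ ≤ C * (1 + |s|) ^ m * |w i s| := hi s
    _ ≤ C * (1 + |s|) ^ m * (D * (1 + |s|) ^ n * |w' i s|) := by
        gcongr
        exact hj s
    _ = _ := by ring

theorem PolyBdd.comp (hF : PolyBdd l w F) {φ : ι' → ι} (hφ : Tendsto φ l' l) :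
    PolyBdd l' (fun i => w (φ i)) (fun i => F (φ i)) := by
  obtain ⟨C, m, hC, hF⟩ := hF
  exact ⟨C, m, hC, hφ.eventually hF⟩

theorem PolyBdd.clm (L : W₁ →L[ℝ] W₂) {F : ι → ℝ → W₁} (hF : PolyBdd l w F) :
    PolyBdd l w (fun i s => L (F i s)) := by
  obtain ⟨C, m, hC, hF⟩ := hF
  refine ⟨‖L‖ * C, m, by positivity, ?_⟩
  filter_upwards [hF] with i hi s
  calc ‖L (F i s)‖ ≤ ‖L‖ * ‖F i s‖ := L.le_opNorm _
    _ ≤ ‖L‖ * (C * (1 + |s|) ^ m * |w i s|) := by gcongr; exact hi s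
    _ = _ := by ring

theorem contDiff_infty_deriv {f : ℝ → W} (hf : ContDiff ℝ ∞ f) : ContDiff ℝ ∞ (deriv f) :=
  (contDiff_infty_iff_deriv.1 hf).2

theorem contDiff_infty_differentiable {f : ℝ → W} (hf : ContDiff ℝ ∞ f) : Differentiable ℝ f :=
  (contDiff_infty_iff_deriv.1 hf).1

theorem iteratedDeriv_add_apply' {f g : ℝ → W} (hf : ContDiff ℝ ∞ f) (hg : ContDiff ℝ ∞ g)
    (k : ℕ) (s : ℝ) : iteratedDeriv k (fun t => f t + g t) s =
      iteratedDeriv k f s + iteratedDeriv k g s :=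
  iteratedDeriv_fun_add (hf.contDiffAt.of_le (by exact_mod_cast le_top))
    (hg.contDiffAt.of_le (by exact_mod_cast le_top))

theorem contDiff_bilin (L : W₁ →L[ℝ] W₂ →L[ℝ] W₃) {f : ℝ → W₁} {g : ℝ → W₂}
    (hf : ContDiff ℝ ∞ f) (hg : ContDiff ℝ ∞ g) : ContDiff ℝ ∞ (fun s => L (f s) (g s)) :=
  (L.contDiff.comp hf).clm_apply hg

theorem deriv_bilin (L : W₁ →L[ℝ] W₂ →L[ℝ] W₃) {f : ℝ → W₁} {g : ℝ → W₂}
    (hf : ContDiff ℝ ∞ f) (hg : ContDiff ℝ ∞ g) :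
    deriv (fun s => L (f s) (g s)) = fun s => L (f s) (deriv g s) + L (deriv f s) (g s) := by
  funext s
  rw [add_comm]
  exact ((L.hasFDerivAt.comp_hasDerivAt s
    (contDiff_infty_differentiable hf s).hasDerivAt).clm_apply
    (contDiff_infty_differentiable hg s).hasDerivAt).deriv

/-- The Leibniz rule with only finitely many derivatives under control, as needed in inductions
on the order of the derivative. -/
theorem PolyBdd.iteratedDeriv_bilin (L : W₁ →L[ℝ] W₂ →L[ℝ] W₃) (k : ℕ)
    {F : ι → ℝ → W₁} {G : ι → ℝ → W₂}
    (hFs : ∀ᶠ i in l, ContDiff ℝ ∞ (F i)) (hGs : ∀ᶠ i in l, ContDiff ℝ ∞ (G i))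
    (hF : ∀ j ≤ k, PolyBdd l w₁ (fun i => iteratedDeriv j (F i)))
    (hG : ∀ j ≤ k, PolyBdd l w₂ (fun i => iteratedDeriv j (G i))) :
    PolyBdd l (fun i s => w₁ i s * w₂ i s)
      (fun i => iteratedDeriv k (fun s => L (F i s) (G i s))) := by
  induction k generalizing F G with
  | zero =>
    simpa [iteratedDeriv_zero] using
      PolyBdd.bilin L (by simpa using hF 0 le_rfl) (by simpa using hG 0 le_rfl)
  | succ k ih =>
    have h1 := ih hFs (hGs.mono fun i h => contDiff_infty_deriv h)
      (fun j hj => hF j (by omega)) (fun j hj => by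
        simpa [iteratedDeriv_succ'] using hG (j + 1) (by omega))
    have h2 := ih (hFs.mono fun i h => contDiff_infty_deriv h) hGs
      (fun j hj => by simpa [iteratedDeriv_succ'] using hF (j + 1) (by omega))
      (fun j hj => hG j (by omega))
    refine (h1.add h2).congr ?_
    filter_upwards [hFs, hGs] with i hf hg s
    rw [iteratedDeriv_succ', deriv_bilin L hf hg]
    exact iteratedDeriv_add_apply' (contDiff_bilin L hf (contDiff_infty_deriv hg))
      (contDiff_bilin L (contDiff_infty_deriv hf) hg) k s

theorem Tame.polyBdd (hF : Tame l w F) : PolyBdd l w F := by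
  simpa using hF.bdd 0

theorem Tame.deriv (hF : Tame l w F) : Tame l w (fun i => deriv (F i)) where
  smooth := hF.smooth.mono fun _ h => contDiff_infty_deriv h
  bdd k := by simpa [iteratedDeriv_succ'] using hF.bdd (k + 1)

/-- Tameness, once the function itself is bounded, only concerns the derivative. -/
theorem Tame.of_deriv (hs : ∀ᶠ i in l, ContDiff ℝ ∞ (F i)) (hF : PolyBdd l w F)
    (hF' : Tame l w (fun i => _root_.deriv (F i))) : Tame l w F where
  smooth := hs
  bdd k := by
    cases k with
    | zero => simpa using hF
    | succ k => simpa [iteratedDeriv_succ'] using hF'.bdd k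

theorem Tame.bilin (L : W₁ →L[ℝ] W₂ →L[ℝ] W₃) {F : ι → ℝ → W₁} {G : ι → ℝ → W₂}
    (hF : Tame l w₁ F) (hG : Tame l w₂ G) :
    Tame l (fun i s => w₁ i s * w₂ i s) (fun i s => L (F i s) (G i s)) where
  smooth := by
    filter_upwards [hF.smooth, hG.smooth] with i hf hg using contDiff_bilin L hf hg
  bdd k := PolyBdd.iteratedDeriv_bilin L k hF.smooth hG.smooth (fun j _ => hF.bdd j)
    (fun j _ => hG.bdd j)

theorem Tame.mul {F G : ι → ℝ → ℝ} (hF : Tame l w₁ F) (hG : Tame l w₂ G) :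
    Tame l (fun i s => w₁ i s * w₂ i s) (fun i s => F i s * G i s) :=
  Tame.bilin (ContinuousLinearMap.mul ℝ ℝ) hF hG

theorem Tame.smul {F : ι → ℝ → ℝ} {G : ι → ℝ → W} (hF : Tame l w₁ F) (hG : Tame l w₂ G) :
    Tame l (fun i s => w₁ i s * w₂ i s) (fun i s => F i s • G i s) :=
  Tame.bilin (ContinuousLinearMap.lsmul ℝ ℝ) hF hG

theorem Tame.congr (hF : Tame l w F) (h : ∀ᶠ i in l, ∀ s, G i s = F i s) : Tame l w G where
  smooth := by
    filter_upwards [hF.smooth, h] with i hi hj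
    rwa [show G i = F i from funext hj]
  bdd k := (hF.bdd k).congr (h.mono fun i hi s => by rw [show G i = F i from funext hi])

theorem Tame.add (hF : Tame l w F) (hG : Tame l w G) : Tame l w (fun i s => F i s + G i s) where
  smooth := by filter_upwards [hF.smooth, hG.smooth] with i hf hg using hf.add hg
  bdd k := ((hF.bdd k).add (hG.bdd k)).congr (by
    filter_upwards [hF.smooth, hG.smooth] with i hf hg s using iteratedDeriv_add_apply' hf hg k s)

theorem iteratedDeriv_clm_apply (L : W₁ →L[ℝ] W₂) {f : ℝ → W₁} (hf : ContDiff ℝ ∞ f) (k : ℕ)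
    (s : ℝ) : iteratedDeriv k (fun t => L (f t)) s = L (iteratedDeriv k f s) := by
  induction k generalizing f with
  | zero => simp
  | succ k ih =>
    rw [iteratedDeriv_succ', iteratedDeriv_succ', ← ih (contDiff_infty_deriv hf)]
    congr 1
    funext t
    exact (L.hasFDerivAt.comp_hasDerivAt t (contDiff_infty_differentiable hf t).hasDerivAt).deriv

theorem Tame.clm (L : W₁ →L[ℝ] W₂) {F : ι → ℝ → W₁} (hF : Tame l w F) :
    Tame l w (fun i s => L (F i s)) where
  smooth := hF.smooth.mono fun _ h => L.contDiff.comp h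
  bdd k := ((hF.bdd k).clm L).congr (hF.smooth.mono fun _ h s => iteratedDeriv_clm_apply L h k s)

theorem Tame.const_smul (c : ℝ) (hF : Tame l w F) : Tame l w (fun i s => c • F i s) :=
  Tame.clm (c • ContinuousLinearMap.id ℝ W) hF

theorem Tame.neg (hF : Tame l w F) : Tame l w (fun i s => -F i s) := by
  simpa using Tame.const_smul (-1) hF

theorem Tame.sub (hF : Tame l w F) (hG : Tame l w G) : Tame l w (fun i s => F i s - G i s) := by
  simpa [sub_eq_add_neg] using hF.add hG.neg

theorem Tame.trans (hF : Tame l w F) (hw : PolyBdd l w' w) : Tame l w' F :=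
  ⟨hF.smooth, fun k => (hF.bdd k).trans hw⟩

theorem Tame.congr_weight (hF : Tame l w F) (h : ∀ᶠ i in l, ∀ s, |w i s| = |w' i s|) :
    Tame l w' F :=
  ⟨hF.smooth, fun k => (hF.bdd k).congr_weight h⟩

theorem Tame.comp (hF : Tame l w F) {φ : ι' → ι} (hφ : Tendsto φ l' l) :
    Tame l' (fun i => w (φ i)) (fun i => F (φ i)) :=
  ⟨hφ.eventually hF.smooth, fun k => (hF.bdd k).comp hφ⟩

/-- For a single function the filter is irrelevant. -/
theorem Tame.const_filter [l.NeBot] {w f} (hF : Tame l (fun _ => w) (fun _ => (f : ℝ → W))) :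
    Tame l' (fun _ => w) (fun _ => f) where
  smooth := Eventually.of_forall fun _ => eventually_const.1 hF.smooth
  bdd k := by
    obtain ⟨C, m, hC, h⟩ := hF.bdd k
    exact ⟨C, m, hC, Eventually.of_forall fun _ => eventually_const.1 h⟩

theorem Tame.fun_const (c : ι → W) (h : ∀ᶠ i in l, ∀ s, ‖c i‖ ≤ |w i s|) :
    Tame l w (fun i _ => c i) :=
  Tame.of_deriv (Eventually.of_forall fun _ => contDiff_const) (PolyBdd.of_norm_le h) <| by
    refine ⟨Eventually.of_forall fun _ => by simpa using contDiff_const, fun k => ?_⟩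
    refine PolyBdd.of_norm_le (Eventually.of_forall fun i s => ?_)
    simp [← Pi.zero_def]

theorem Tame.const (c : W) : Tame l (fun _ _ => 1) (fun _ _ => c) := by
  refine (Tame.fun_const (w := fun _ _ => ‖c‖) (fun _ => c) (by simp)).trans ?_
  exact PolyBdd.of_le ‖c‖ 0 (by simp)

/-- The logarithmic derivative determines the size of all derivatives. -/
theorem Tame.of_deriv_eq_mul {φ A : ι → ℝ → ℝ} (hs : ∀ᶠ i in l, ContDiff ℝ ∞ (φ i))
    (hφ : PolyBdd l w φ) (hA : Tame l (fun _ _ => 1) A)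
    (h : ∀ᶠ i in l, ∀ s, _root_.deriv (φ i) s = A i s * φ i s) : Tame l w φ := by
  refine ⟨hs, fun k => ?_⟩
  induction k using Nat.strong_induction_on with
  | _ k ih =>
    cases k with
    | zero => simpa using hφ
    | succ k =>
      have := PolyBdd.iteratedDeriv_bilin (ContinuousLinearMap.mul ℝ ℝ) k hA.smooth hs
        (fun j _ => hA.bdd j) (fun j hj => ih j (by omega))
      refine (this.congr ?_).congr_weight (w' := w) (by simp)
      filter_upwards [h] with i hi s
      rw [iteratedDeriv_succ', funext hi]
      rfl

/-- A reciprocal is tame for the reciprocal weight as soon as it is bounded by it. -/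
theorem Tame.inv {q : ι → ℝ → ℝ} (hq : Tame l w q) (h0 : ∀ᶠ i in l, ∀ s, q i s ≠ 0)
    (hb : PolyBdd l w' (fun i s => (q i s)⁻¹)) (hw : ∀ᶠ i in l, ∀ s, |w i s * w' i s| ≤ 1) :
    Tame l w' (fun i s => (q i s)⁻¹) := by
  have hs : ∀ᶠ i in l, ContDiff ℝ ∞ (fun s => (q i s)⁻¹) := by
    filter_upwards [hq.smooth, h0] with i hi hj using hi.inv hj
  refine ⟨hs, fun k => ?_⟩
  induction k using Nat.strong_induction_on with
  | _ k ih =>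
    cases k with
    | zero => simpa using hb
    | succ k =>
      -- `(1 / q)' = (-q' * (1 / q)) * (1 / q)`, with fewer derivatives of `1 / q` on the right
      have h1 : ∀ j ≤ k, PolyBdd l (fun i s => w i s * w' i s) (fun i => iteratedDeriv j
          (fun s => -_root_.deriv (q i) s * (q i s)⁻¹)) := fun j hj =>
        PolyBdd.iteratedDeriv_bilin (ContinuousLinearMap.mul ℝ ℝ) j hq.deriv.neg.smooth hs
          (fun j' _ => hq.deriv.neg.bdd j') (fun j' hj' => ih j' (by omega))
      have h2 := PolyBdd.iteratedDeriv_bilin (ContinuousLinearMap.mul ℝ ℝ) k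
        (by filter_upwards [hq.deriv.neg.smooth, hs] with i hi hj using hi.mul hj) hs h1
          (fun j hj => ih j (by omega))
      refine (h2.congr ?_).trans (w' := w') ?_
      · filter_upwards [hq.smooth, h0] with i hi hj s
        rw [iteratedDeriv_succ']
        congr 1
        funext t
        rw [((contDiff_infty_differentiable hi t).hasDerivAt.fun_inv (hj t)).deriv]
        simp only [ContinuousLinearMap.mul_apply']
        field_simp
      · refine PolyBdd.of_norm_le (hw.mono fun i hi s => ?_)
        rw [Real.norm_eq_abs, abs_mul]
        exact mul_le_of_le_one_left (abs_nonneg _) (hi s)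

/-- A square root is tame as soon as it is bounded, since its logarithmic derivative is
`q' / (2 * q)`. -/
theorem Tame.sqrt {q : ι → ℝ → ℝ} (hq : Tame l w₁ q) (h0 : ∀ᶠ i in l, ∀ s, 0 < q i s)
    (hi : PolyBdd l w₂ (fun i s => (q i s)⁻¹)) (hw : ∀ᶠ i in l, ∀ s, |w₁ i s * w₂ i s| ≤ 1)
    (hb : PolyBdd l w (fun i s => Real.sqrt (q i s))) :
    Tame l w (fun i s => Real.sqrt (q i s)) := by
  have hinv := hq.inv (h0.mono fun i h s => (h s).ne') hi hw
  refine Tame.of_deriv_eq_mul (A := fun i s => (1 / 2 : ℝ) • (_root_.deriv (q i) s * (q i s)⁻¹))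
    ?_ hb ?_ ?_
  · filter_upwards [hq.smooth, h0] with i hi hj using hi.sqrt fun s => (hj s).ne'
  · refine ((hq.deriv.mul hinv).const_smul _).trans (PolyBdd.of_norm_le ?_)
    simpa using hw
  · filter_upwards [hq.smooth, h0] with i hi hj s
    rw [((contDiff_infty_differentiable hi s).hasDerivAt.sqrt (hj s).ne').deriv]
    have := Real.mul_self_sqrt (hj s).le
    have h2 : Real.sqrt (q i s) ≠ 0 := (Real.sqrt_pos.2 (hj s)).ne'
    have h3 := (hj s).ne'
    rw [smul_eq_mul]
    field_simp
    rw [sq, this]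

end TameFamilies

/-! ### Balanced antiderivatives and differentiation under the integral -/

section Integration

variable {W : Type*} [NormedAddCommGroup W] [NormedSpace ℝ W]

/-- The anti-derivative of an integrable function whose limits at `±∞` are opposite; for scalar
fields it is `∂ₛ⁻¹`. -/
noncomputable def balAnti (f : ℝ → W) (s : ℝ) : W :=
  (1 / 2 : ℝ) • ((∫ x in Set.Iic s, f x) - ∫ x in Set.Ioi s, f x)

variable {f : ℝ → W}

theorem balAnti_eq (hf : Integrable f) (s : ℝ) :
    balAnti f s = (∫ x in Set.Iic s, f x) - (1 / 2 : ℝ) • ∫ x, f x := by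
  rw [← intervalIntegral.integral_Iic_add_Ioi (b := s) hf.integrableOn hf.integrableOn, balAnti]
  module

theorem norm_balAnti_le (f : ℝ → W) (hf : Integrable f) (s : ℝ) : ‖balAnti f s‖ ≤ ∫ x, ‖f x‖ := by
  have h1 : ‖∫ x in Set.Iic s, f x‖ ≤ ∫ x in Set.Iic s, ‖f x‖ := norm_integral_le_integral_norm _
  have h2 : ‖∫ x in Set.Ioi s, f x‖ ≤ ∫ x in Set.Ioi s, ‖f x‖ := norm_integral_le_integral_norm _
  have h3 := intervalIntegral.integral_Iic_add_Ioi (b := s) hf.norm.integrableOn hf.norm.integrableOn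
  have h4 := norm_sub_le (∫ x in Set.Iic s, f x) (∫ x in Set.Ioi s, f x)
  have h5 : 0 ≤ ∫ x, ‖f x‖ := integral_nonneg fun _ => norm_nonneg _
  rw [balAnti, norm_smul]
  norm_num
  linarith

theorem hasDerivAt_balAnti [CompleteSpace W] (hc : Continuous f) (hf : Integrable f) (s : ℝ) :
    HasDerivAt (balAnti f) (f s) s := by
  have h : balAnti f = fun t => (∫ x in (0 : ℝ)..t, f x) +
      ((∫ x in Set.Iic 0, f x) - (1 / 2 : ℝ) • ∫ x, f x) := by
    funext t
    rw [balAnti_eq hf, ← intervalIntegral.integral_Iic_sub_Iic hf.integrableOn hf.integrableOn]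
    abel
  rw [h]
  exact (hc.integral_hasStrictDerivAt 0 s).hasDerivAt.add_const _

theorem tendsto_balAnti_atTop (hf : Integrable f) :
    Tendsto (balAnti f) atTop (𝓝 ((1 / 2 : ℝ) • ∫ x, f x)) := by
  have h := (aecover_Iic (μ := volume) (tendsto_id (α := ℝ) (x := atTop)))
    |>.integral_tendsto_of_countably_generated hf
  rw [funext (balAnti_eq hf)]
  have h2 := h.sub_const ((1 / 2 : ℝ) • ∫ x, f x)
  rw [show (∫ x, f x) - (1 / 2 : ℝ) • ∫ x, f x = (1 / 2 : ℝ) • ∫ x, f x by module] at h2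
  exact h2

theorem tendsto_balAnti_atBot (hf : Integrable f) :
    Tendsto (balAnti f) atBot (𝓝 (-((1 / 2 : ℝ) • ∫ x, f x))) := by
  have h := (aecover_Ioi (μ := volume) (tendsto_id (α := ℝ) (x := atBot)))
    |>.integral_tendsto_of_countably_generated hf
  have h2 : balAnti f = fun s => (1 / 2 : ℝ) • (∫ x, f x) - ∫ x in Set.Ioi s, f x := by
    funext s
    rw [← intervalIntegral.integral_Iic_add_Ioi (b := s) hf.integrableOn hf.integrableOn, balAnti]
    module
  rw [h2]
  have h3 := h.const_sub ((1 / 2 : ℝ) • ∫ x, f x)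
  rw [show (1 / 2 : ℝ) • (∫ x, f x) - ∫ x, f x = -((1 / 2 : ℝ) • ∫ x, f x) by module] at h3
  exact h3

/-- A function with integrable derivative and opposite limits at `±∞` is the balanced
anti-derivative of its derivative. -/
theorem eq_balAnti [CompleteSpace W] {F : ℝ → W} (hF : ∀ s, HasDerivAt F (f s) s)
    (hf : Integrable f) {c : W} (ht : Tendsto F atTop (𝓝 c)) (hb : Tendsto F atBot (𝓝 (-c)))
    (s : ℝ) : balAnti f s = F s := by
  have h1 := integral_Iic_of_hasDerivAt_of_tendsto' (a := s) (fun x _ => hF x) hf.integrableOn hb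
  have h2 := integral_Ioi_of_hasDerivAt_of_tendsto' (a := s) (fun x _ => hF x) hf.integrableOn ht
  rw [balAnti, h1, h2]
  module

theorem contDiff_balAnti [CompleteSpace W] (hc : ContDiff ℝ ∞ f) (hf : Integrable f) :
    ContDiff ℝ ∞ (balAnti f) := by
  refine contDiff_infty_iff_deriv.2
    ⟨fun s => (hasDerivAt_balAnti hc.continuous hf s).differentiableAt, ?_⟩
  rwa [show deriv (balAnti f) = f from
    funext fun s => (hasDerivAt_balAnti hc.continuous hf s).deriv]

/-- Differentiation under the integral sign, at the single parameter value `ε = 0`. -/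
theorem hasDerivAt_setIntegral_of_dominated [CompleteSpace W] {F : ℝ → ℝ → W} {G : ℝ → W} {b : ℝ → ℝ}
    (hFc : ∀ᶠ ε in 𝓝 (0 : ℝ), Continuous (F ε)) (hF0 : Integrable (F 0)) (hG : Continuous G)
    (hb : Integrable b) (hF : ∀ᶠ ε in 𝓝 (0 : ℝ), ∀ s, ‖F ε s - F 0 s‖ ≤ |ε| * b s)
    (hd : ∀ s, HasDerivAt (fun ε => F ε s) (G s) 0) :
    Integrable G ∧
      ∀ A : Set ℝ, HasDerivAt (fun ε => ∫ x in A, F ε x) (∫ x in A, G x) 0 := by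
  have key : ∀ A : Set ℝ, IntegrableOn G A ∧
      HasDerivAt (fun ε => ∫ x in A, F ε x) (∫ x in A, G x) 0 := by
    intro A
    let L : W →L[ℝ] (ℝ →L[ℝ] W) := ContinuousLinearMap.smulRightL ℝ ℝ W 1
    have h := hasFDerivAt_integral_of_dominated_loc_of_lip' (𝕜 := ℝ) (μ := volume.restrict A)
      (F := F) (F' := fun a => L (G a)) (x₀ := (0 : ℝ)) (bound := b) (hFc.and hF)
      (fun x hx => hx.1.aestronglyMeasurable) hF0.integrableOn
      (L.continuous.comp hG).aestronglyMeasurable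
      (ae_of_all _ fun a x hx => by
        have := hx.2 a
        rwa [mul_comm, sub_zero, Real.norm_eq_abs])
      hb.integrableOn
      (ae_of_all _ fun a => (hd a).hasFDerivAt)
    have hint : IntegrableOn G A := by
      have := ((ContinuousLinearMap.apply ℝ W (1 : ℝ)).integrable_comp h.1)
      simpa [L, IntegrableOn] using this
    refine ⟨hint, ?_⟩
    have h2 := h.2.hasDerivAt
    convert h2 using 1
    rw [ContinuousLinearMap.integral_comp_comm L hint]
    simp [L]
  exact ⟨by simpa using (key Set.univ).1, fun A => (key A).2⟩

theorem hasDerivAt_balAnti_of_dominated [CompleteSpace W] {F : ℝ → ℝ → W} {G : ℝ → W} {b : ℝ → ℝ}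
    (hFc : ∀ᶠ ε in 𝓝 (0 : ℝ), Continuous (F ε)) (hF0 : Integrable (F 0)) (hG : Continuous G)
    (hb : Integrable b) (hF : ∀ᶠ ε in 𝓝 (0 : ℝ), ∀ s, ‖F ε s - F 0 s‖ ≤ |ε| * b s)
    (hd : ∀ s, HasDerivAt (fun ε => F ε s) (G s) 0) (s : ℝ) :
    HasDerivAt (fun ε => balAnti (F ε) s) (balAnti G s) 0 := by
  have h := (hasDerivAt_setIntegral_of_dominated hFc hF0 hG hb hF hd).2
  exact ((h _).sub (h _)).const_smul _

/-- Differentiation in the parameter commutes with differentiation in `s`: if the increments of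
`F ε` are of order `ε` together with all their derivatives, then the pointwise derivative in `ε`
of `F ε` determines that of `deriv (F ε)`. -/
theorem hasDerivAt_deriv_of_tame {w : ℝ → ℝ} (hw : Continuous w) {F : ℝ → ℝ → W} {G : ℝ → W}
    (hF : Tame (𝓝 0) (fun ε s => ε * w s) (fun ε s => F ε s - F 0 s))
    (hF0 : ContDiff ℝ ∞ (F 0)) (hG : ContDiff ℝ ∞ G)
    (hd : ∀ s, HasDerivAt (fun ε => F ε s) (G s) 0) (s : ℝ) :
    HasDerivAt (fun ε => deriv (F ε) s) (deriv G s) 0 := by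
  obtain ⟨C, m, hC, hb⟩ := hF.bdd 2
  -- a bound for the second derivative of `F ε - F 0 - ε G` near `s`
  obtain ⟨M₁, hM₁⟩ := (isCompact_Icc (a := s) (b := s + 1)).exists_bound_of_continuousOn
    (f := fun t => C * (1 + |t|) ^ m * w t) (by fun_prop)
  obtain ⟨M₂, hM₂⟩ := (isCompact_Icc (a := s) (b := s + 1)).exists_bound_of_continuousOn
    (f := iteratedDeriv 2 G) (hG.continuous_iteratedDeriv 2 (WithTop.coe_le_coe.2 le_top)).continuousOn
  have hs1 : s ∈ Set.Icc s (s + 1) := ⟨le_rfl, by linarith⟩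
  have hM₁0 : 0 ≤ M₁ := (norm_nonneg _).trans (hM₁ s hs1)
  have hM₂0 : 0 ≤ M₂ := (norm_nonneg _).trans (hM₂ s hs1)
  set M := M₁ + M₂ with hM
  rw [hasDerivAt_iff_isLittleO, Asymptotics.isLittleO_iff]
  intro η hη
  -- compare `deriv E s` with the difference quotient of `E = F ε - F 0 - ε • G` over a step `h`
  -- that is small but independent of `ε`
  set h := min 1 (η / (2 * (M + 1))) with hh
  have hpos : 0 < h := by positivity
  have hle1 : h ≤ 1 := min_le_left _ _
  have hMh : M * h ≤ η / 2 := by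
    have : h ≤ η / (2 * (M + 1)) := min_le_right _ _
    calc M * h ≤ (M + 1) * (η / (2 * (M + 1))) := by gcongr; linarith
      _ = η / 2 := by
          have : M + 1 ≠ 0 := by positivity
          field_simp
  have e1 := (Asymptotics.isLittleO_iff.1 (hasDerivAt_iff_isLittleO.1 (hd s)))
    (show 0 < η * h / 4 by positivity)
  have e2 := (Asymptotics.isLittleO_iff.1 (hasDerivAt_iff_isLittleO.1 (hd (s + h))))
    (show 0 < η * h / 4 by positivity)
  filter_upwards [hF.smooth, hb, e1, e2] with ε hsm hb e1 e2
  simp only [sub_zero] at e1 e2 ⊢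
  set E : ℝ → W := fun t => F ε t - F 0 t - ε • G t with hE
  have hEs : ContDiff ℝ ∞ E := hsm.sub (hG.const_smul ε)
  have hE1 : ContDiff ℝ ∞ (deriv E) := contDiff_infty_deriv hEs
  have hFε : ContDiff ℝ ∞ (F ε) := by
    have := hsm.add hF0
    simpa using this
  have hE2 : ∀ t ∈ Set.Icc s (s + 1), ‖deriv (deriv E) t‖ ≤ |ε| * M := by
    intro t ht
    have h1 : deriv (deriv E) t = iteratedDeriv 2 (fun t => F ε t - F 0 t) t
        + -(ε • iteratedDeriv 2 G t) := by
      have h2 : deriv (deriv E) t = iteratedDeriv 2 E t := by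
        rw [iteratedDeriv_succ', iteratedDeriv_one]
      rw [h2, hE]
      simp only [sub_eq_add_neg (_ - _)]
      rw [iteratedDeriv_add_apply' hsm (hG.const_smul ε).neg, iteratedDeriv_fun_neg,
        iteratedDeriv_fun_const_smul_field]
    rw [h1]
    have h3 := hM₁ t ht
    have h4 := hM₂ t ht
    rw [Real.norm_eq_abs, abs_mul, abs_of_nonneg (by positivity : 0 ≤ C * (1 + |t|) ^ m)] at h3
    calc _ ≤ ‖iteratedDeriv 2 (fun t => F ε t - F 0 t) t‖ + ‖-(ε • iteratedDeriv 2 G t)‖ :=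
          norm_add_le _ _
      _ ≤ C * (1 + |t|) ^ m * |ε * w t| + |ε| * ‖iteratedDeriv 2 G t‖ := by
          rw [norm_neg, norm_smul, Real.norm_eq_abs]
          gcongr
          exact hb t
      _ = |ε| * (C * (1 + |t|) ^ m * |w t| + ‖iteratedDeriv 2 G t‖) := by rw [abs_mul]; ring
      _ ≤ |ε| * M := by rw [hM]; gcongr
  have hE3 : ∀ t ∈ Set.Icc s (s + h), ‖deriv E t - deriv E s‖ ≤ |ε| * M * h := by
    intro t ht
    have := (convex_Icc s (s + 1)).norm_image_sub_le_of_norm_deriv_le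
      (fun x _ => contDiff_infty_differentiable hE1 x) hE2 hs1
      (show t ∈ Set.Icc s (s + 1) from ⟨ht.1, by linarith [ht.2]⟩)
    refine this.trans ?_
    gcongr
    rw [Real.norm_eq_abs, abs_of_nonneg (by linarith [ht.1])]
    linarith [ht.2]
  have hE4 : ‖(E (s + h) - (s + h) • deriv E s) - (E s - s • deriv E s)‖ ≤ |ε| * M * h * h := by
    have hder : ∀ t, HasDerivAt (fun t => E t - t • deriv E s) (deriv E t - deriv E s) t := by
      intro t
      have := (contDiff_infty_differentiable hEs t).hasDerivAt.fun_sub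
        ((hasDerivAt_id t).smul_const (deriv E s))
      simpa using this
    have := (convex_Icc s (s + h)).norm_image_sub_le_of_norm_deriv_le
      (f := fun t => E t - t • deriv E s)
      (fun x _ => (hder x).differentiableAt) (fun x hx => by rw [(hder x).deriv]; exact hE3 x hx)
      (show s ∈ Set.Icc s (s + h) from ⟨le_rfl, by linarith⟩)
      (show s + h ∈ Set.Icc s (s + h) from ⟨by linarith, le_rfl⟩)
    simpa [abs_of_pos hpos] using this
  have hE5 : h * ‖deriv E s‖ ≤ h * (η * |ε|) := by
    have h1 : h • deriv E s = E (s + h) - E s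
        - ((E (s + h) - (s + h) • deriv E s) - (E s - s • deriv E s)) := by module
    calc h * ‖deriv E s‖ = ‖h • deriv E s‖ := by rw [norm_smul, Real.norm_of_nonneg hpos.le]
      _ ≤ ‖E (s + h) - E s‖
          + ‖(E (s + h) - (s + h) • deriv E s) - (E s - s • deriv E s)‖ := by
          rw [h1]; exact norm_sub_le _ _
      _ ≤ (‖E (s + h)‖ + ‖E s‖) + |ε| * M * h * h := add_le_add (norm_sub_le _ _) hE4
      _ ≤ (η * h / 4 * |ε| + η * h / 4 * |ε|) + |ε| * h * (η / 2) := by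
          refine add_le_add (add_le_add e2 e1) ?_
          calc |ε| * M * h * h = |ε| * h * (M * h) := by ring
            _ ≤ _ := by gcongr
      _ = h * (η * |ε|) := by ring
  have hE6 : deriv E s = deriv (F ε) s - deriv (F 0) s - ε • deriv G s :=
    (((contDiff_infty_differentiable hFε s).hasDerivAt.sub
      (contDiff_infty_differentiable hF0 s).hasDerivAt).sub
      ((contDiff_infty_differentiable hG s).hasDerivAt.const_smul ε)).deriv
  rw [← hE6, Real.norm_eq_abs]
  exact le_of_mul_le_mul_left hE5 hpos

end Integration

/-! ### Polynomial bounds for asymptotically polynomial-like and rapidly decreasing functions -/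

section PolynomialBounds

theorem eventually_cocompact_bound {f g : ℝ → ℝ} (hf : Continuous f)
    (h : ∀ᶠ s in atBot ⊔ atTop, |f s| ≤ g s) : ∃ C, 0 ≤ C ∧ ∀ s, |f s| ≤ max C (g s) := by
  rw [← cocompact_eq_atBot_atTop, Filter.Eventually, mem_cocompact] at h
  obtain ⟨K, hK, h⟩ := h
  obtain ⟨C, hC⟩ := hK.exists_bound_of_continuousOn hf.continuousOn
  refine ⟨max C 0, le_max_right _ _, fun s => ?_⟩
  by_cases hs : s ∈ K
  · exact ((hC s hs).trans (le_max_left _ _)).trans (le_max_left _ _)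
  · exact (h hs).trans (le_max_right _ _)

theorem exists_bound_polynomial_eval (P : Polynomial ℝ) :
    ∃ C, 0 ≤ C ∧ ∀ s, |P.eval s| ≤ C * (1 + |s|) ^ P.natDegree := by
  refine ⟨∑ i ∈ Finset.range (P.natDegree + 1), |P.coeff i|, by positivity, fun s => ?_⟩
  rw [Polynomial.eval_eq_sum_range, Finset.sum_mul]
  refine (Finset.abs_sum_le_sum_abs _ _).trans (Finset.sum_le_sum fun i hi => ?_)
  rw [abs_mul, abs_pow]
  gcongr
  calc |s| ^ i ≤ (1 + |s|) ^ i := by gcongr; linarith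
    _ ≤ _ := one_add_abs_pow_mono (by simpa [Nat.lt_succ_iff] using hi) s

/-- An asymptotically polynomial-like function is of polynomial growth; the zeros of the polynomial,
where the quotient in the definition is a junk value, lie in a bounded set. -/
theorem AsympPolyLike.exists_bound {f : ℝ → ℝ} (h : AsympPolyLike f) (hf : Continuous f) :
    ∃ (C : ℝ) (m : ℕ), 0 ≤ C ∧ ∀ s, |f s| ≤ C * (1 + |s|) ^ m := by
  obtain ⟨P, hP, h⟩ := h
  have h1 : ∀ᶠ s in atBot ⊔ atTop, P.eval s ≠ 0 := by
    rw [← cocompact_eq_atBot_atTop]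
    refine cocompact_le_cofinite ?_
    refine (P.roots.toFinset.finite_toSet.subset fun s hs => ?_)
    simpa [hP] using hs
  have h2 : ∀ᶠ s in atBot ⊔ atTop, |f s| ≤ |P.eval s| := by
    filter_upwards [h1, h.eventually (Metric.ball_mem_nhds 0 one_pos)] with s hs hs2
    rw [dist_zero_right, Real.norm_eq_abs, abs_div,
      div_lt_one (abs_pos.2 hs)] at hs2
    exact hs2.le
  obtain ⟨C, hC, hb⟩ := eventually_cocompact_bound hf h2
  obtain ⟨D, hD, hP⟩ := exists_bound_polynomial_eval P
  refine ⟨C + D, P.natDegree, by positivity, fun s => (hb s).trans ?_⟩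
  have h1 : 1 ≤ (1 + |s|) ^ P.natDegree := one_le_pow₀ (by linarith [abs_nonneg s])
  refine max_le ?_ ((hP s).trans ?_)
  · nlinarith
  · nlinarith

theorem RapidlyDecreasing.exists_bound {f : ℝ → ℝ} (h : RapidlyDecreasing f) (hf : Continuous f)
    (m : ℕ) : ∃ C, 0 ≤ C ∧ ∀ s, (1 + |s|) ^ m * |f s| ≤ C := by
  have h1 := h ((1 + Polynomial.X ^ 2) ^ m)
  have h2 : ∀ᶠ s in atBot ⊔ atTop, |f s * ((1 + Polynomial.X ^ 2) ^ m : Polynomial ℝ).eval s|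
      ≤ 1 := by
    filter_upwards [h1.eventually (Metric.ball_mem_nhds 0 one_pos)] with s hs
    rw [dist_zero_right, Real.norm_eq_abs] at hs
    exact hs.le
  obtain ⟨C, hC, hb⟩ := eventually_cocompact_bound (g := fun _ => 1) (by fun_prop) h2
  refine ⟨2 ^ m * max C 1, by positivity, fun s => ?_⟩
  have h3 := hb s
  rw [abs_mul] at h3
  simp only [Polynomial.eval_pow, Polynomial.eval_add, Polynomial.eval_one, Polynomial.eval_X] at h3
  rw [abs_of_nonneg (by positivity : 0 ≤ (1 + s ^ 2) ^ m)] at h3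
  have h4 : 1 + |s| ≤ 2 * (1 + s ^ 2) := by nlinarith [sq_abs s, sq_nonneg (|s| - 1)]
  calc (1 + |s|) ^ m * |f s| ≤ (2 * (1 + s ^ 2)) ^ m * |f s| := by gcongr
    _ = 2 ^ m * (|f s| * (1 + s ^ 2) ^ m) := by rw [mul_pow]; ring
    _ ≤ _ := by gcongr

theorem RapidlyDecreasing.integrable {f : ℝ → ℝ} (h : RapidlyDecreasing f) (hf : Continuous f)
    (m : ℕ) : Integrable fun s => (1 + |s|) ^ m * |f s| := by
  obtain ⟨C, hC, hb⟩ := h.exists_bound hf (m + 2)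
  refine (integrable_inv_one_add_sq.const_mul C).mono'
    (Continuous.aestronglyMeasurable (by fun_prop)) (ae_of_all _ fun s => ?_)
  have h1 := hb s
  rw [Real.norm_of_nonneg (by positivity), ← div_eq_mul_inv, le_div_iff₀ (by positivity)]
  refine le_trans ?_ h1
  have h2 : 1 + s ^ 2 ≤ (1 + |s|) ^ 2 := by nlinarith [sq_abs s, abs_nonneg s]
  calc (1 + |s|) ^ m * |f s| * (1 + s ^ 2) ≤ (1 + |s|) ^ m * |f s| * (1 + |s|) ^ 2 := by gcongr
    _ = _ := by ring

end PolynomialBounds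

/-! ### The vector product -/

section VectorProduct

theorem cross_apply_zero (u v : E3) : cross u v 0 = u 1 * v 2 - u 2 * v 1 := by
  simp [cross, crossProduct]

theorem cross_apply_one (u v : E3) : cross u v 1 = u 2 * v 0 - u 0 * v 2 := by
  simp [cross, crossProduct]

theorem cross_apply_two (u v : E3) : cross u v 2 = u 0 * v 1 - u 1 * v 0 := by
  simp [cross, crossProduct]

theorem inner_E3 (u v : E3) : inner ℝ u v = u 0 * v 0 + u 1 * v 1 + u 2 * v 2 := by
  simp [PiLp.inner_apply, Fin.sum_univ_three, mul_comm]

theorem E3_ext {u v : E3} (h0 : u 0 = v 0) (h1 : u 1 = v 1) (h2 : u 2 = v 2) : u = v := by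
  ext i; fin_cases i <;> assumption

/-- The vector product as a continuous bilinear map. -/
noncomputable def crossL : E3 →L[ℝ] E3 →L[ℝ] E3 :=
  LinearMap.toContinuousLinearMap
    { toFun := fun u => LinearMap.toContinuousLinearMap
        { toFun := fun v => cross u v
          map_add' := fun v w => by
            apply E3_ext <;> simp [cross_apply_zero, cross_apply_one, cross_apply_two] <;> ring
          map_smul' := fun r v => by
            apply E3_ext <;> simp [cross_apply_zero, cross_apply_one, cross_apply_two] <;> ring }
      map_add' := fun u v => by
        ext1 w
        apply E3_ext <;> simp [cross_apply_zero, cross_apply_one, cross_apply_two] <;> ring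
      map_smul' := fun r v => by
        ext1 w
        apply E3_ext <;> simp [cross_apply_zero, cross_apply_one, cross_apply_two] <;> ring }

theorem cross_add_right (u v w : E3) : cross u (v + w) = cross u v + cross u w := (crossL u).map_add v w
theorem cross_sub_right (u v w : E3) : cross u (v - w) = cross u v - cross u w := (crossL u).map_sub v w
theorem cross_smul_right (r : ℝ) (u v : E3) : cross u (r • v) = r • cross u v :=
  (crossL u).map_smul r v
theorem cross_add_left (u v w : E3) : cross (u + v) w = cross u w + cross v w :=
  crossL.map_add₂ u v w
theorem cross_smul_left (r : ℝ) (u v : E3) : cross (r • u) v = r • cross u v :=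
  crossL.map_smul₂ r u v

theorem cross_anticomm (u v : E3) : cross u v = -cross v u := by
  apply E3_ext <;> simp [cross_apply_zero, cross_apply_one, cross_apply_two] <;> ring

theorem cross_self_eq_zero (u : E3) : cross u u = 0 := by
  apply E3_ext <;> simp [cross_apply_zero, cross_apply_one, cross_apply_two, mul_comm]

/-- Lagrange's formula. -/
theorem cross_cross_right (u v w : E3) :
    cross u (cross v w) = (inner ℝ u w : ℝ) • v - (inner ℝ u v : ℝ) • w := by
  apply E3_ext <;> simp [cross_apply_zero, cross_apply_one, cross_apply_two, inner_E3] <;> ring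

/-- The Jacobi identity. -/
theorem cross_cross_sub (t u v : E3) :
    cross (cross t u) v - cross (cross t v) u = cross t (cross u v) := by
  apply E3_ext <;> simp [cross_apply_zero, cross_apply_one, cross_apply_two] <;> ring

theorem inner_cross_left (u v : E3) : inner ℝ u (cross u v) = (0 : ℝ) := by
  rw [inner_E3, cross_apply_zero, cross_apply_one, cross_apply_two]; ring

theorem inner_cross_right (u v : E3) : inner ℝ v (cross u v) = (0 : ℝ) := by
  rw [inner_E3, cross_apply_zero, cross_apply_one, cross_apply_two]; ring

theorem inner_cross_cross (u v : E3) : inner ℝ (cross u v) (cross u v)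
    = (inner ℝ u u * inner ℝ v v - inner ℝ u v ^ 2 : ℝ) := by
  simp only [inner_E3, cross_apply_zero, cross_apply_one, cross_apply_two]; ring

/-- Coordinates with respect to the positively oriented orthonormal frame built from two
orthonormal vectors. -/
theorem eq_sum_inner_frame {t n : E3} (ht : inner ℝ t t = (1 : ℝ)) (hn : inner ℝ n n = (1 : ℝ))
    (htn : inner ℝ t n = (0 : ℝ)) (v : E3) :
    v = (inner ℝ t v : ℝ) • t + (inner ℝ n v : ℝ) • n
      + (inner ℝ (cross t n) v : ℝ) • cross t n := by
  have hb : inner ℝ (cross t n) (cross t n) = (1 : ℝ) := by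
    rw [inner_cross_cross, ht, hn, htn]; norm_num
  have h1 := cross_cross_right (cross t n) (cross t n) v
  have h2 : cross (cross t n) v = (inner ℝ t v : ℝ) • n - (inner ℝ n v : ℝ) • t := by
    rw [cross_anticomm, cross_cross_right, real_inner_comm t v, real_inner_comm n v]; module
  have h3 : cross (cross t n) t = n := by
    rw [cross_anticomm, cross_cross_right, ht, htn]; module
  have h4 : cross (cross t n) n = -t := by
    rw [cross_anticomm, cross_cross_right, hn, real_inner_comm, htn]; module
  rw [hb, h2, cross_sub_right, cross_smul_right, cross_smul_right, h3, h4, one_smul] at h1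
  rw [eq_sub_iff_add_eq] at h1
  rw [← sub_eq_zero, ← sub_eq_zero.2 h1]
  module

end VectorProduct

/-! ### The Frenet frame -/

section Frenet

variable {γ₀ c : ℝ → E3}

theorem IsArclengthCurve.contDiff_frameT (h : IsArclengthCurve c) : ContDiff ℝ ∞ (frameT c) :=
  contDiff_infty_deriv h.smooth

theorem IsBAL.curvature_pos (h : IsBAL γ₀ c) (s : ℝ) : 0 < curvature c s :=
  lt_of_le_of_ne (norm_nonneg _) (h.curvature_ne_zero s).symm

theorem IsBAL.contDiff_curvature (h : IsBAL γ₀ c) : ContDiff ℝ ∞ (curvature c) :=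
  (contDiff_infty_deriv h.contDiff_frameT).norm ℝ fun s => norm_ne_zero_iff.1 (h.curvature_ne_zero s)

theorem IsBAL.contDiff_frameN (h : IsBAL γ₀ c) : ContDiff ℝ ∞ (frameN c) :=
  (h.contDiff_curvature.inv h.curvature_ne_zero).smul (contDiff_infty_deriv h.contDiff_frameT)

theorem IsBAL.contDiff_frameB (h : IsBAL γ₀ c) : ContDiff ℝ ∞ (frameB c) :=
  contDiff_bilin crossL h.contDiff_frameT h.contDiff_frameN

theorem IsBAL.contDiff_torsion (h : IsBAL γ₀ c) : ContDiff ℝ ∞ (torsion c) :=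
  (contDiff_infty_deriv h.contDiff_frameN).inner ℝ h.contDiff_frameB

theorem IsBAL.deriv_frameT (h : IsBAL γ₀ c) (s : ℝ) :
    deriv (frameT c) s = curvature c s • frameN c s := by
  rw [frameN, smul_smul, mul_inv_cancel₀ (h.curvature_ne_zero s), one_smul]

theorem inner_frameT_frameT (h : IsArclengthCurve c) (s : ℝ) :
    inner ℝ (frameT c s) (frameT c s) = (1 : ℝ) := by
  rw [real_inner_self_eq_norm_sq, frameT, h.unit_speed]; norm_num

theorem inner_deriv_self_of_inner_const {f : ℝ → E3} (hf : ContDiff ℝ ∞ f) {r : ℝ}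
    (h : ∀ s, inner ℝ (f s) (f s) = r) (s : ℝ) : inner ℝ (f s) (deriv f s) = (0 : ℝ) := by
  have h1 := ((contDiff_infty_differentiable hf s).hasDerivAt.inner ℝ
    (contDiff_infty_differentiable hf s).hasDerivAt)
  rw [funext h] at h1
  have h2 := h1.unique (hasDerivAt_const s r)
  rw [real_inner_comm (f s)] at h2
  linarith

theorem IsBAL.inner_T_N (h : IsBAL γ₀ c) (s : ℝ) :
    inner ℝ (frameT c s) (frameN c s) = (0 : ℝ) := by
  rw [frameN, inner_smul_right, inner_deriv_self_of_inner_const h.contDiff_frameT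
    (inner_frameT_frameT h.toIsArclengthCurve), mul_zero]

theorem IsBAL.inner_N_N (h : IsBAL γ₀ c) (s : ℝ) :
    inner ℝ (frameN c s) (frameN c s) = (1 : ℝ) := by
  rw [frameN, inner_smul_right, inner_smul_left, real_inner_self_eq_norm_sq]
  have := h.curvature_ne_zero s
  change (curvature c s)⁻¹ * ((curvature c s)⁻¹ * curvature c s ^ 2) = 1
  field_simp

theorem IsBAL.inner_B_B (h : IsBAL γ₀ c) (s : ℝ) :
    inner ℝ (frameB c s) (frameB c s) = (1 : ℝ) := by
  rw [frameB, inner_cross_cross, inner_frameT_frameT h.toIsArclengthCurve, h.inner_N_N, h.inner_T_N]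
  norm_num

theorem inner_T_B (c : ℝ → E3) (s : ℝ) : inner ℝ (frameT c s) (frameB c s) = (0 : ℝ) :=
  inner_cross_left _ _

theorem inner_N_B (c : ℝ → E3) (s : ℝ) : inner ℝ (frameN c s) (frameB c s) = (0 : ℝ) :=
  inner_cross_right _ _

theorem IsBAL.eq_sum_inner (h : IsBAL γ₀ c) (s : ℝ) (v : E3) :
    v = (inner ℝ (frameT c s) v : ℝ) • frameT c s + (inner ℝ (frameN c s) v : ℝ) • frameN c s
      + (inner ℝ (frameB c s) v : ℝ) • frameB c s :=
  eq_sum_inner_frame (inner_frameT_frameT h.toIsArclengthCurve s) (h.inner_N_N s) (h.inner_T_N s) v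

theorem IsBAL.cross_T_B (h : IsBAL γ₀ c) (s : ℝ) :
    cross (frameT c s) (frameB c s) = -frameN c s := by
  rw [frameB, cross_cross_right, h.inner_T_N, inner_frameT_frameT h.toIsArclengthCurve]; module

theorem IsBAL.cross_N_B (h : IsBAL γ₀ c) (s : ℝ) :
    cross (frameN c s) (frameB c s) = frameT c s := by
  rw [frameB, cross_cross_right, h.inner_N_N, real_inner_comm, h.inner_T_N]; module

theorem IsBAL.deriv_frameN (h : IsBAL γ₀ c) (s : ℝ) :
    deriv (frameN c) s = -curvature c s • frameT c s + torsion c s • frameB c s := by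
  have h1 : inner ℝ (frameT c s) (deriv (frameN c) s) = -curvature c s := by
    have h2 := ((contDiff_infty_differentiable h.contDiff_frameT s).hasDerivAt.inner ℝ
      (contDiff_infty_differentiable h.contDiff_frameN s).hasDerivAt)
    rw [funext h.inner_T_N] at h2
    have h3 := h2.unique (hasDerivAt_const s 0)
    rw [h.deriv_frameT, inner_smul_left, h.inner_N_N] at h3
    simp at h3
    linarith
  have h2 := inner_deriv_self_of_inner_const h.contDiff_frameN h.inner_N_N s
  rw [h.eq_sum_inner s (deriv (frameN c) s), h1, h2, real_inner_comm _ (frameB c s), torsion]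
  module

theorem IsBAL.deriv_frameB (h : IsBAL γ₀ c) (s : ℝ) :
    deriv (frameB c) s = -torsion c s • frameN c s := by
  have : deriv (frameB c) s = cross (frameT c s) (deriv (frameN c) s)
      + cross (deriv (frameT c) s) (frameN c s) :=
    congrFun (deriv_bilin crossL h.contDiff_frameT h.contDiff_frameN) s
  rw [this, h.deriv_frameN, h.deriv_frameT, cross_add_right, cross_smul_right, cross_smul_right,
    cross_smul_left, cross_self_eq_zero, cross_self_eq_zero, h.cross_T_B]
  module

theorem norm_eq_one_of_inner {v : E3} (h : inner ℝ v v = (1 : ℝ)) : ‖v‖ = 1 := by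
  rw [real_inner_self_eq_norm_sq] at h
  nlinarith [norm_nonneg v]

end Frenet

/-! ### Fields of given decay along every curve -/

section TameFields

variable {γ₀ : ℝ → E3} {W W₁ W₂ W₃ : Type} [NormedAddCommGroup W] [NormedSpace ℝ W]
  [NormedAddCommGroup W₁] [NormedSpace ℝ W₁] [NormedAddCommGroup W₂] [NormedSpace ℝ W₂]
  [NormedAddCommGroup W₃] [NormedSpace ℝ W₃]

theorem kappa_pos (γ : BAL γ₀) (s : ℝ) : 0 < kappa γ s := γ.2.curvature_pos s

theorem continuous_kappa (γ : BAL γ₀) : Continuous (kappa γ) := γ.2.contDiff_curvature.continuous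

theorem kappa_ne (γ : BAL γ₀) (s : ℝ) : kappa γ s ≠ 0 := (kappa_pos γ s).ne'

/-- The weight `κ ^ n` decreases with `n`, up to a constant. -/
theorem polyBdd_zpow {ι : Type*} (l : Filter ι) (γ : BAL γ₀) {m n : ℤ} (h : m ≤ n) :
    PolyBdd l (fun _ s => kappa γ s ^ m) (fun _ s => kappa γ s ^ n) := by
  obtain ⟨C, hC, hb⟩ := γ.2.curvature_rapid.exists_bound γ.2.contDiff_curvature.continuous 0
  obtain ⟨k, hk⟩ := Int.eq_ofNat_of_zero_le (sub_nonneg.2 h)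
  refine PolyBdd.of_le (C ^ k) 0 (Eventually.of_forall fun _ s => ?_)
  have hs : kappa γ s ≤ C := (le_abs_self _).trans (by simpa [kappa] using hb s)
  have h0 := kappa_pos γ s
  rw [Real.norm_of_nonneg (zpow_nonneg h0.le n), abs_of_pos (zpow_pos h0 m),
    show n = k + m by omega, zpow_add₀ h0.ne', zpow_natCast, pow_zero, mul_one]
  have := zpow_nonneg h0.le m
  gcongr

omit [NormedSpace ℝ W] in
/-- A family bounded by the weight `δ κ` is dominated by `|δ|` times an integrable function, because
the curvature is rapidly decreasing. -/
theorem PolyBdd.dominated {ι : Type*} {l : Filter ι} {γ : BAL γ₀} {δ : ι → ℝ} {F : ι → ℝ → W}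
    (h : PolyBdd l (fun i s => δ i * kappa γ s ^ (1 : ℤ)) F) : ∃ b : ℝ → ℝ, Integrable b ∧
      ∀ᶠ i in l, ∀ s, ‖F i s‖ ≤ |δ i| * b s := by
  obtain ⟨C, m, hC, h⟩ := h
  refine ⟨fun s => C * ((1 + |s|) ^ m * |curvature γ.1 s|),
    (γ.2.curvature_rapid.integrable γ.2.contDiff_curvature.continuous m).const_mul C, ?_⟩
  filter_upwards [h] with i h s
  refine (h s).trans (le_of_eq ?_)
  rw [zpow_one, abs_mul, kappa]
  ring

omit [NormedSpace ℝ W] in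
theorem PolyBdd.uniform_bound {ι : Type*} {l : Filter ι} {γ : BAL γ₀} {δ : ι → ℝ}
    {F : ι → ℝ → W} (h : PolyBdd l (fun i s => δ i * kappa γ s ^ (1 : ℤ)) F) :
    ∃ C, 0 ≤ C ∧ ∀ᶠ i in l, ∀ s, ‖F i s‖ ≤ |δ i| * C := by
  obtain ⟨C, m, hC, h⟩ := h
  obtain ⟨D, hD, hb⟩ := γ.2.curvature_rapid.exists_bound γ.2.contDiff_curvature.continuous m
  refine ⟨C * D, by positivity, h.mono fun i h s => (h s).trans ?_⟩
  calc C * (1 + |s|) ^ m * |δ i * kappa γ s ^ (1 : ℤ)|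
      = |δ i| * (C * ((1 + |s|) ^ m * |curvature γ.1 s|)) := by
        rw [zpow_one, abs_mul, kappa]; ring
    _ ≤ _ := by gcongr; exact hb s

/-- Fields that are smooth along every curve and, with all derivatives, bounded by `κ ^ n` up to
polynomial factors. -/
def TameField (n : ℤ) (f : BAL γ₀ → ℝ → W) : Prop :=
  ∀ γ, Tame (𝓝 (0 : ℝ)) (fun _ s => kappa γ s ^ n) (fun _ => f γ)

variable {n m : ℤ} {f g : BAL γ₀ → ℝ → W}

theorem TameField.contDiff (hf : TameField n f) (γ : BAL γ₀) : ContDiff ℝ ∞ (f γ) :=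
  eventually_const.1 (hf γ).smooth

theorem TameField.hasDerivAt (hf : TameField n f) (γ : BAL γ₀) (s : ℝ) :
    HasDerivAt (f γ) (deriv (f γ) s) s :=
  (contDiff_infty_differentiable (hf.contDiff γ) s).hasDerivAt

theorem TameField.bound (hf : TameField n f) (γ : BAL γ₀) :
    ∃ (C : ℝ) (m : ℕ), 0 ≤ C ∧ ∀ s, ‖f γ s‖ ≤ C * (1 + |s|) ^ m * kappa γ s ^ n := by
  obtain ⟨C, m, hC, h⟩ := (hf γ).polyBdd
  refine ⟨C, m, hC, fun s => ?_⟩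
  have := eventually_const.1 h s
  rwa [abs_of_pos (zpow_pos (kappa_pos γ s) n)] at this

theorem TameField.mono (hf : TameField n f) (h : m ≤ n) : TameField m f :=
  fun γ => (hf γ).trans (polyBdd_zpow _ γ h)

theorem TameField.add (hf : TameField n f) (hg : TameField n g) :
    TameField n (fun γ s => f γ s + g γ s) := fun γ => (hf γ).add (hg γ)

theorem TameField.const_smul (c : ℝ) (hf : TameField n f) :
    TameField n (fun γ s => c • f γ s) := fun γ => (hf γ).const_smul c

theorem TameField.neg (hf : TameField n f) : TameField n (fun γ s => -f γ s) :=
  fun γ => (hf γ).neg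

theorem TameField.clm (L : W₁ →L[ℝ] W₂) {f : BAL γ₀ → ℝ → W₁} (hf : TameField n f) :
    TameField n (fun γ s => L (f γ s)) := fun γ => (hf γ).clm L

theorem TameField.bilin (L : W₁ →L[ℝ] W₂ →L[ℝ] W₃) {f : BAL γ₀ → ℝ → W₁} {g : BAL γ₀ → ℝ → W₂}
    (hf : TameField n f) (hg : TameField m g) :
    TameField (n + m) (fun γ s => L (f γ s) (g γ s)) := fun γ =>
  ((hf γ).bilin L (hg γ)).congr_weight (Eventually.of_forall fun _ s => by
    rw [zpow_add₀ (kappa_ne γ s)])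

theorem TameField.smul {f : ScalarField γ₀} (hf : TameField n f) (hg : TameField m g) :
    TameField (n + m) (fun γ s => f γ s • g γ s) :=
  hf.bilin (ContinuousLinearMap.lsmul ℝ ℝ) hg

theorem TameField.mul {f g : ScalarField γ₀} (hf : TameField n f) (hg : TameField m g) :
    TameField (n + m) (f * g) :=
  hf.bilin (ContinuousLinearMap.mul ℝ ℝ) hg

theorem TameField.deriv (hf : TameField n f) : TameField n (fun γ s => deriv (f γ) s) :=
  fun γ => (hf γ).deriv

theorem TameField.fun_const (c : BAL γ₀ → W) : TameField 0 (fun γ (_ : ℝ) => c γ) := fun γ =>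
  (Tame.const (c γ)).congr_weight (by simp)

theorem TameField.integrable (hf : TameField n f) (hn : 1 ≤ n) (γ : BAL γ₀) :
    Integrable (f γ) := by
  obtain ⟨C, m, hC, hb⟩ := (hf.mono hn).bound γ
  refine ((γ.2.curvature_rapid.integrable γ.2.contDiff_curvature.continuous m).const_mul C).mono'
    (hf.contDiff γ).continuous.aestronglyMeasurable (ae_of_all _ fun s => (hb s).trans ?_)
  rw [zpow_one, mul_assoc]
  gcongr
  exact le_abs_self _

theorem TameField.tendsto_zero (hf : TameField n f) (hn : 1 ≤ n) (γ : BAL γ₀) :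
    Tendsto (f γ) (atBot ⊔ atTop) (𝓝 0) := by
  obtain ⟨C, m, hC, hb⟩ := (hf.mono hn).bound γ
  obtain ⟨D, hD, hb2⟩ := γ.2.curvature_rapid.exists_bound γ.2.contDiff_curvature.continuous (m + 1)
  have h1 : Tendsto (fun s : ℝ => C * D * (1 + |s|)⁻¹) (atBot ⊔ atTop) (𝓝 (C * D * 0)) := by
    refine Tendsto.const_mul _ (tendsto_inv_atTop_zero.comp (tendsto_atTop_add_const_left _ _ ?_))
    exact tendsto_sup.2 ⟨tendsto_abs_atBot_atTop, tendsto_abs_atTop_atTop⟩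
  rw [mul_zero] at h1
  refine squeeze_zero_norm (fun s => (hb s).trans ?_) h1
  have h2 := hb2 s
  have h3 : 0 < 1 + |s| := by positivity
  rw [zpow_one, ← div_eq_mul_inv, le_div_iff₀ h3]
  calc C * (1 + |s|) ^ m * kappa γ s * (1 + |s|) = C * ((1 + |s|) ^ (m + 1) * kappa γ s) := by ring
    _ ≤ C * D := by
      gcongr
      exact (mul_le_mul_of_nonneg_left (le_abs_self _) (by positivity)).trans h2

theorem antiS_eq_balAnti (f : ScalarField γ₀) (γ : BAL γ₀) (s : ℝ) :
    antiS f γ s = balAnti (f γ) s := rfl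

theorem TameField.hasDerivAt_antiS {f : ScalarField γ₀} (hf : TameField n f) (hn : 1 ≤ n)
    (γ : BAL γ₀) (s : ℝ) : HasDerivAt (antiS f γ) (f γ s) s :=
  hasDerivAt_balAnti (hf.contDiff γ).continuous (hf.integrable hn γ) s

theorem TameField.antiS {f : ScalarField γ₀} (hf : TameField n f) (hn : 1 ≤ n) :
    TameField 0 (antiS f) := fun γ => by
  refine Tame.of_deriv (Eventually.of_forall fun _ =>
    contDiff_balAnti (hf.contDiff γ) (hf.integrable hn γ)) ?_ ?_
  · refine PolyBdd.of_le (∫ x, ‖f γ x‖) 0 (Eventually.of_forall fun _ s => ?_)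
    simpa [antiS_eq_balAnti] using norm_balAnti_le (f γ) (hf.integrable hn γ) s
  · rw [show _root_.deriv (VortexFilament.antiS f γ) = f γ from
      funext fun s => (hf.hasDerivAt_antiS hn γ s).deriv]
    exact (hf.mono (by omega)) γ

theorem tameField_kappa : TameField 1 (kappa : ScalarField γ₀) := fun γ => by
  have hs := γ.2.contDiff_curvature
  refine ⟨Eventually.of_forall fun _ => hs, fun k => ?_⟩
  obtain ⟨C, m, hC, hb⟩ := (γ.2.curvature_poly k).exists_bound
    ((hs.continuous.inv₀ γ.2.curvature_ne_zero).mul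
      (hs.continuous_iteratedDeriv k (WithTop.coe_le_coe.2 le_top)))
  refine ⟨C, m, hC, Eventually.of_forall fun _ s => ?_⟩
  have h1 := hb s
  have h0 : 0 < curvature γ.1 s := kappa_pos γ s
  rw [abs_mul, abs_inv, abs_of_pos h0, inv_mul_le_iff₀ h0] at h1
  simp only [zpow_one]
  rw [abs_of_pos (kappa_pos γ s), mul_comm]
  exact h1

theorem tameField_tau : TameField 0 (tau : ScalarField γ₀) := fun γ => by
  have hs := γ.2.contDiff_torsion
  refine ⟨Eventually.of_forall fun _ => hs, fun k => ?_⟩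
  obtain ⟨C, m, hC, hb⟩ := (γ.2.torsion_poly k).exists_bound
    (hs.continuous_iteratedDeriv k (WithTop.coe_le_coe.2 le_top))
  exact ⟨C, m, hC, Eventually.of_forall fun _ s => (hb s).trans (by simp)⟩

theorem tameField_kappaInv : TameField (-1) (kappaInv : ScalarField γ₀) := fun γ => by
  refine (tameField_kappa γ).inv (Eventually.of_forall fun _ => kappa_ne γ) ?_ ?_
  · exact PolyBdd.of_norm_le (Eventually.of_forall fun _ s => by simp)
  · refine Eventually.of_forall fun _ s => ?_
    rw [← zpow_add₀ (kappa_ne γ s)]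
    simp

theorem tameField_arc : TameField 0 (arc : ScalarField γ₀) := fun γ => by
  refine Tame.of_deriv (Eventually.of_forall fun _ => contDiff_id) ?_ ?_
  · refine PolyBdd.of_le 1 1 (Eventually.of_forall fun _ s => ?_)
    simp [arc]
  · have : deriv (arc γ) = fun _ => (1 : ℝ) := by
      funext s; exact (hasDerivAt_id s).deriv
    rw [this]
    exact TameField.fun_const (fun _ => (1 : ℝ)) γ

/-- The Frenet equations bound the derivatives of the three frame vectors simultaneously. -/
theorem tameField_frame : TameField 0 (fieldT : TangentField γ₀) ∧
    TameField 0 (fieldN : TangentField γ₀) ∧ TameField 0 (fieldB : TangentField γ₀) := by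
  have key : ∀ (γ : BAL γ₀) (k : ℕ), ∀ j ≤ k,
      PolyBdd (𝓝 (0 : ℝ)) (fun _ _ => 1) (fun _ => iteratedDeriv j (frameT γ.1)) ∧
      PolyBdd (𝓝 (0 : ℝ)) (fun _ _ => 1) (fun _ => iteratedDeriv j (frameN γ.1)) ∧
      PolyBdd (𝓝 (0 : ℝ)) (fun _ _ => 1) (fun _ => iteratedDeriv j (frameB γ.1)) := by
    intro γ k
    have hκ : Tame (𝓝 (0 : ℝ)) (fun _ _ => 1) (fun _ => kappa γ) :=
      (tameField_kappa.mono zero_le_one γ).congr_weight (by simp)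
    have hτ : Tame (𝓝 (0 : ℝ)) (fun _ _ => 1) (fun _ => tau γ) :=
      (tameField_tau γ).congr_weight (by simp)
    have hT := γ.2.contDiff_frameT
    have hN := γ.2.contDiff_frameN
    have hB := γ.2.contDiff_frameB
    have hsm : ∀ {A : ℝ → ℝ} {G : ℝ → E3} (k : ℕ), Tame (𝓝 (0 : ℝ)) (fun _ _ => 1) (fun _ => A) →
        ContDiff ℝ ∞ G → (∀ j ≤ k, PolyBdd (𝓝 (0 : ℝ)) (fun _ _ => 1)
          (fun _ => iteratedDeriv j G)) →
        PolyBdd (𝓝 (0 : ℝ)) (fun _ _ => 1) (fun _ => iteratedDeriv k (fun s => A s • G s)) := by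
      intro A G k hA hG h
      exact (PolyBdd.iteratedDeriv_bilin (ContinuousLinearMap.lsmul ℝ ℝ) k hA.smooth
        (Eventually.of_forall fun _ => hG) (fun j _ => hA.bdd j) h).congr_weight (by simp)
    induction k with
    | zero =>
      intro j hj
      obtain rfl : j = 0 := by omega
      refine ⟨?_, ?_, ?_⟩ <;>
        refine PolyBdd.of_norm_le (Eventually.of_forall fun _ s => ?_) <;>
        rw [iteratedDeriv_zero, abs_one]
      · exact (norm_eq_one_of_inner (inner_frameT_frameT γ.2.toIsArclengthCurve s)).le
      · exact (norm_eq_one_of_inner (γ.2.inner_N_N s)).le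
      · exact (norm_eq_one_of_inner (γ.2.inner_B_B s)).le
    | succ k ih =>
      intro j hj
      rcases Nat.lt_or_ge j (k + 1) with h | h
      · exact ih j (by omega)
      obtain rfl : j = k + 1 := by omega
      refine ⟨?_, ?_, ?_⟩
      · rw [iteratedDeriv_succ', funext γ.2.deriv_frameT]
        exact hsm k hκ hN fun j hj => (ih j hj).2.1
      · have h1 := hsm k hκ.neg hT fun j hj => (ih j hj).1
        have h2 := hsm k hτ hB fun j hj => (ih j hj).2.2
        refine (h1.add h2).congr (Eventually.of_forall fun _ s => ?_)
        rw [iteratedDeriv_succ', funext γ.2.deriv_frameN]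
        exact iteratedDeriv_add_apply' (γ.2.contDiff_curvature.neg.smul hT)
          (γ.2.contDiff_torsion.smul hB) k s
      · rw [iteratedDeriv_succ', funext γ.2.deriv_frameB]
        exact hsm k hτ.neg hN fun j hj => (ih j hj).2.1
  refine ⟨fun γ => ?_, fun γ => ?_, fun γ => ?_⟩
  · exact Tame.congr_weight ⟨Eventually.of_forall fun _ => γ.2.contDiff_frameT,
      fun k => (key γ k k le_rfl).1⟩ (by simp)
  · exact Tame.congr_weight ⟨Eventually.of_forall fun _ => γ.2.contDiff_frameN,
      fun k => (key γ k k le_rfl).2.1⟩ (by simp)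
  · exact Tame.congr_weight ⟨Eventually.of_forall fun _ => γ.2.contDiff_frameB,
      fun k => (key γ k k le_rfl).2.2⟩ (by simp)

theorem tameField_T : TameField 0 (fieldT : TangentField γ₀) := tameField_frame.1
theorem tameField_N : TameField 0 (fieldN : TangentField γ₀) := tameField_frame.2.1
theorem tameField_B : TameField 0 (fieldB : TangentField γ₀) := tameField_frame.2.2

/-- The grading of the algebra of scalar fields bounds the size of its elements. -/
theorem Alg.tameField {f : ScalarField γ₀} (hf : Alg n f) : TameField n f := by
  induction hf with
  | add _ _ hf hg => exact hf.add hg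
  | smul r _ hf => exact hf.const_smul r
  | lower _ hf => exact hf.mono (by omega)
  | mul _ _ hf hg => exact hf.mul hg
  | dS _ hf => exact hf.deriv
  | antiS _ hf => exact hf.antiS (by norm_num)
  | @integ f _ hf => exact TameField.fun_const fun γ => ∫ x, f γ x
  | kappa => exact tameField_kappa
  | kappaInv => exact tameField_kappaInv
  | tau => exact tameField_tau
  | arc => exact tameField_arc
  | ell => exact TameField.fun_const fun γ => renormalizedLength γ
  | one => exact TameField.fun_const fun _ => (1 : ℝ)

end TameFields

/-! ### Controlled variational differentials -/

section VariationalDifferentials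

variable {γ₀ : ℝ → E3} {W W₁ W₂ W₃ : Type} [NormedAddCommGroup W] [NormedSpace ℝ W]
  [NormedAddCommGroup W₁] [NormedSpace ℝ W₁] [NormedAddCommGroup W₂] [NormedSpace ℝ W₂]
  [NormedAddCommGroup W₃] [NormedSpace ℝ W₃]

/-- `f'` is a variational differential of `f` along `X`, and along every variation `Γ` the
increments `f (Γ ε) - f γ` are, with all their `s`-derivatives, of size `ε κ ^ n` up to polynomial
factors. Unlike bare differentiability, this passes to `s`-derivatives and integrals. -/
structure VarDiff (X : TangentField γ₀) (n : ℤ) (f f' : BAL γ₀ → ℝ → W) : Prop where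
  tame : TameField n f
  tame' : TameField n f'
  incr : ∀ γ Γ, IsVariation γ (X γ) Γ →
    Tame (𝓝 0) (fun ε s => ε * kappa γ s ^ n) (fun ε s => f (Γ ε) s - f γ s)
  hasVariation : HasVariation X f f'

variable {X : TangentField γ₀} {n m : ℤ} {f f' g g' : BAL γ₀ → ℝ → W}

theorem eventually_abs_le_one : ∀ᶠ ε in 𝓝 (0 : ℝ), |ε| ≤ 1 := by
  filter_upwards [Metric.ball_mem_nhds (0 : ℝ) one_pos] with ε hε
  rw [mem_ball_zero_iff] at hε
  exact hε.le

theorem polyBdd_eps_mul (w : ℝ → ℝ) :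
    PolyBdd (𝓝 (0 : ℝ)) (fun _ s => w s) (fun ε s => ε * w s) :=
  PolyBdd.of_norm_le (eventually_abs_le_one.mono fun ε hε s => by
    rw [Real.norm_eq_abs, abs_mul]
    exact mul_le_of_le_one_left (abs_nonneg _) hε)

theorem polyBdd_eps_mul_mul {w w' : ℝ → ℝ} (h : PolyBdd (𝓝 (0 : ℝ)) (fun _ => w') (fun _ => w)) :
    PolyBdd (𝓝 (0 : ℝ)) (fun ε s => ε * w' s) (fun ε s => ε * w s) :=
  PolyBdd.bilin (ContinuousLinearMap.mul ℝ ℝ) (F := fun ε _ => ε) (w₁ := fun ε _ => ε)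
    (PolyBdd.of_norm_le (by simp)) h

theorem tame_of_increment {w : ℝ → ℝ} {F : ℝ → ℝ → W} {F₀ : ℝ → W}
    (h : Tame (𝓝 0) (fun ε s => ε * w s) (fun ε s => F ε s - F₀ s))
    (h0 : Tame (𝓝 (0 : ℝ)) (fun _ => w) (fun _ => F₀)) :
    Tame (𝓝 (0 : ℝ)) (fun _ => w) F := by
  simpa using (h.trans (polyBdd_eps_mul w)).add h0

theorem VarDiff.tame_family (h : VarDiff X n f f') {γ : BAL γ₀} {Γ : ℝ → BAL γ₀}
    (hΓ : IsVariation γ (X γ) Γ) :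
    Tame (𝓝 (0 : ℝ)) (fun _ s => kappa γ s ^ n) (fun ε => f (Γ ε)) :=
  tame_of_increment (h.incr γ Γ hΓ) (h.tame γ)

theorem VarDiff.congr (h : VarDiff X n f f') (hf : f = g) (hf' : f' = g') : VarDiff X n g g' := by
  subst hf hf'; exact h

theorem VarDiff.mono (h : VarDiff X n f f') (hm : m ≤ n) : VarDiff X m f f' :=
  ⟨h.tame.mono hm, h.tame'.mono hm, fun γ Γ hΓ =>
    (h.incr γ Γ hΓ).trans (polyBdd_eps_mul_mul (polyBdd_zpow _ γ hm)), h.hasVariation⟩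

theorem VarDiff.add (hf : VarDiff X n f f') (hg : VarDiff X n g g') :
    VarDiff X n (fun γ s => f γ s + g γ s) (fun γ s => f' γ s + g' γ s) where
  tame := hf.tame.add hg.tame
  tame' := hf.tame'.add hg.tame'
  incr γ Γ hΓ := ((hf.incr γ Γ hΓ).add (hg.incr γ Γ hΓ)).congr
    (Eventually.of_forall fun ε s => by abel)
  hasVariation γ Γ hΓ s := (hf.hasVariation γ Γ hΓ s).add (hg.hasVariation γ Γ hΓ s)

theorem VarDiff.bilin (L : W₁ →L[ℝ] W₂ →L[ℝ] W₃) {f f' : BAL γ₀ → ℝ → W₁}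
    {g g' : BAL γ₀ → ℝ → W₂} (hf : VarDiff X n f f') (hg : VarDiff X m g g') :
    VarDiff X (n + m) (fun γ s => L (f γ s) (g γ s))
      (fun γ s => L (f' γ s) (g γ s) + L (f γ s) (g' γ s)) where
  tame := hf.tame.bilin L hg.tame
  tame' := (hf.tame'.bilin L hg.tame).add (hf.tame.bilin L hg.tame')
  incr γ Γ hΓ := by
    have h1 := (hf.incr γ Γ hΓ).bilin L (hg.tame_family hΓ)
    have h2 := Tame.bilin L (hf.tame γ) (hg.incr γ Γ hΓ)
    refine ((h1.congr_weight ?_).add (h2.congr_weight ?_)).congr ?_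
    · refine Eventually.of_forall fun ε s => ?_
      rw [zpow_add₀ (kappa_ne γ s), mul_assoc]
    · refine Eventually.of_forall fun ε s => ?_
      rw [zpow_add₀ (kappa_ne γ s)]; ring_nf
    · refine Eventually.of_forall fun ε s => ?_
      simp only [map_sub, _root_.sub_apply]
      abel
  hasVariation γ Γ hΓ s := by
    have h1 := (L.hasFDerivAt.comp_hasDerivAt (0 : ℝ) (hf.hasVariation γ Γ hΓ s)).clm_apply
      (hg.hasVariation γ Γ hΓ s)
    simp only [Function.comp, hΓ.base] at h1
    exact h1

theorem VarDiff.clm (L : W₁ →L[ℝ] W₂) {f f' : BAL γ₀ → ℝ → W₁} (hf : VarDiff X n f f') :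
    VarDiff X n (fun γ s => L (f γ s)) (fun γ s => L (f' γ s)) where
  tame := hf.tame.clm L
  tame' := hf.tame'.clm L
  incr γ Γ hΓ := ((hf.incr γ Γ hΓ).clm L).congr (Eventually.of_forall fun ε s => by simp)
  hasVariation γ Γ hΓ s := L.hasFDerivAt.comp_hasDerivAt (0 : ℝ) (hf.hasVariation γ Γ hΓ s)

theorem VarDiff.const_smul (c : ℝ) (hf : VarDiff X n f f') :
    VarDiff X n (fun γ s => c • f γ s) (fun γ s => c • f' γ s) :=
  hf.clm (c • ContinuousLinearMap.id ℝ W)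

theorem VarDiff.smul {f f' : ScalarField γ₀} (hf : VarDiff X n f f') (hg : VarDiff X m g g') :
    VarDiff X (n + m) (fun γ s => f γ s • g γ s)
      (fun γ s => f' γ s • g γ s + f γ s • g' γ s) :=
  hf.bilin (ContinuousLinearMap.lsmul ℝ ℝ) hg

theorem VarDiff.mul {f f' g g' : ScalarField γ₀} (hf : VarDiff X n f f')
    (hg : VarDiff X m g g') : VarDiff X (n + m) (f * g) (f' * g + f * g') :=
  hf.bilin (ContinuousLinearMap.mul ℝ ℝ) hg

theorem VarDiff.cross {f f' g g' : TangentField γ₀} (hf : VarDiff X n f f')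
    (hg : VarDiff X m g g') : VarDiff X (n + m) (fun γ s => cross (f γ s) (g γ s))
      (fun γ s => VortexFilament.cross (f' γ s) (g γ s) + VortexFilament.cross (f γ s) (g' γ s)) :=
  hf.bilin crossL hg

theorem VarDiff.inner {f f' g g' : TangentField γ₀} (hf : VarDiff X n f f')
    (hg : VarDiff X m g g') : VarDiff X (n + m) (fun γ s => (Inner.inner ℝ (f γ s) (g γ s) : ℝ))
      (fun γ s => (Inner.inner ℝ (f' γ s) (g γ s) + Inner.inner ℝ (f γ s) (g' γ s) : ℝ)) :=
  hf.bilin (innerSL ℝ) hg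

theorem VarDiff.const (c : W) :
    VarDiff X 0 (fun _ _ => c) (fun _ _ => (0 : W)) where
  tame := TameField.fun_const _
  tame' := TameField.fun_const _
  incr γ Γ hΓ := (Tame.fun_const (fun _ => (0 : W)) (by simp)).congr (by simp)
  hasVariation γ Γ hΓ s := hasDerivAt_const _ _

theorem continuous_kappa_zpow (γ : BAL γ₀) (n : ℤ) : Continuous fun s => kappa γ s ^ n :=
  (continuous_kappa γ).zpow₀ n fun s => Or.inl (kappa_ne γ s)

/-- Variational differentials commute with the `s`-derivative. -/
theorem VarDiff.deriv (hf : VarDiff X n f f') :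
    VarDiff X n (fun γ s => deriv (f γ) s) (fun γ s => _root_.deriv (f' γ) s) where
  tame := hf.tame.deriv
  tame' := hf.tame'.deriv
  incr γ Γ hΓ := (hf.incr γ Γ hΓ).deriv.congr (Eventually.of_forall fun ε s =>
    ((hf.tame.hasDerivAt (Γ ε) s).sub (hf.tame.hasDerivAt γ s)).deriv.symm)
  hasVariation γ Γ hΓ s := by
    refine hasDerivAt_deriv_of_tame (continuous_kappa_zpow γ n) ?_ (hf.tame.contDiff _)
      (hf.tame'.contDiff γ) (hf.hasVariation γ Γ hΓ) s
    rw [hΓ.base]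
    exact hf.incr γ Γ hΓ

/-- The integrable bound needed to differentiate under the integral sign. -/
theorem VarDiff.dominated (hf : VarDiff X n f f') (hn : 1 ≤ n) {γ : BAL γ₀} {Γ : ℝ → BAL γ₀}
    (hΓ : IsVariation γ (X γ) Γ) : ∃ b : ℝ → ℝ, Integrable b ∧
      ∀ᶠ ε in 𝓝 (0 : ℝ), ∀ s, ‖f (Γ ε) s - f (Γ 0) s‖ ≤ |ε| * b s := by
  rw [hΓ.base]
  exact ((hf.mono hn).incr γ Γ hΓ).polyBdd.dominated

theorem VarDiff.antiS {f f' : ScalarField γ₀} (hf : VarDiff X n f f') (hn : 1 ≤ n) :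
    VarDiff X 0 (antiS f) (antiS f') where
  tame := hf.tame.antiS hn
  tame' := hf.tame'.antiS hn
  incr γ Γ hΓ := by
    obtain ⟨b, hb, hbd⟩ := hf.dominated hn hΓ
    refine Tame.of_deriv (Eventually.of_forall fun ε =>
      ((hf.tame.antiS hn).contDiff _).sub ((hf.tame.antiS hn).contDiff _)) ?_ ?_
    · refine PolyBdd.of_le (∫ x, |b x|) 0 ?_
      filter_upwards [hbd] with ε h s
      have h1 : VortexFilament.antiS f (Γ ε) s - VortexFilament.antiS f γ s
          = balAnti (fun x => f (Γ ε) x - f γ x) s := by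
        rw [antiS_eq_balAnti, antiS_eq_balAnti, balAnti, balAnti, balAnti,
          integral_sub (hf.tame.integrable hn _).integrableOn
            (hf.tame.integrable hn _).integrableOn,
          integral_sub (hf.tame.integrable hn _).integrableOn
            (hf.tame.integrable hn _).integrableOn]
        module
      have hi := (hf.tame.integrable hn (Γ ε)).sub (hf.tame.integrable hn γ)
      rw [h1]
      refine (norm_balAnti_le _ hi s).trans ?_
      rw [hΓ.base] at h
      calc ∫ x, ‖f (Γ ε) x - f γ x‖ ≤ ∫ x, |ε| * |b x| :=
            integral_mono hi.norm (hb.norm.const_mul _) fun x =>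
              (h x).trans (mul_le_mul_of_nonneg_left (le_abs_self _) (abs_nonneg _))
        _ = _ := by rw [integral_const_mul]; simp; ring
    · refine ((hf.incr γ Γ hΓ).trans (polyBdd_eps_mul_mul
        (polyBdd_zpow (m := 0) _ γ (by omega)))).congr (Eventually.of_forall fun ε s => ?_)
      exact ((hf.tame.hasDerivAt_antiS hn (Γ ε) s).sub (hf.tame.hasDerivAt_antiS hn γ s)).deriv
  hasVariation γ Γ hΓ s := by
    obtain ⟨b, hb, hbd⟩ := hf.dominated hn hΓ
    exact hasDerivAt_balAnti_of_dominated
      (Eventually.of_forall fun ε => (hf.tame.contDiff (Γ ε)).continuous)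
      (hf.tame.integrable hn _) (hf.tame'.contDiff γ).continuous hb hbd
      (hf.hasVariation γ Γ hΓ) s

/-- Fields that are constant in `s` only need differentiability and a Lipschitz bound at `ε = 0`,
and the latter follows from the former. -/
theorem VarDiff.of_const {c c' : BAL γ₀ → W}
    (h : ∀ γ Γ, IsVariation γ (X γ) Γ → HasDerivAt (fun ε => c (Γ ε)) (c' γ) 0) :
    VarDiff X 0 (fun γ _ => c γ) (fun γ _ => c' γ) where
  tame := TameField.fun_const _
  tame' := TameField.fun_const _
  incr γ Γ hΓ := by
    obtain ⟨C, hC⟩ := (h γ Γ hΓ).isBigO_sub.bound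
    refine (Tame.fun_const (w := fun ε _ => C * ε) (fun ε => c (Γ ε) - c γ) ?_).trans ?_
    · filter_upwards [hC] with ε h s
      rw [hΓ.base] at h
      rw [abs_mul]
      refine h.trans ?_
      rw [sub_zero, Real.norm_eq_abs]
      gcongr
      exact le_abs_self C
    · exact PolyBdd.of_le |C| 0 (Eventually.of_forall fun ε s => by simp)
  hasVariation γ Γ hΓ s := h γ Γ hΓ

theorem VarDiff.integ {f f' : ScalarField γ₀} (hf : VarDiff X n f f') (hn : 1 ≤ n) :
    VarDiff X 0 (integ f) (integ f') := by
  refine VarDiff.of_const (c := fun γ => ∫ x, f γ x) (c' := fun γ => ∫ x, f' γ x)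
    fun γ Γ hΓ => ?_
  obtain ⟨b, hb, hbd⟩ := hf.dominated hn hΓ
  have := (hasDerivAt_setIntegral_of_dominated
      (Eventually.of_forall fun ε => (hf.tame.contDiff (Γ ε)).continuous)
      (hf.tame.integrable hn _) (hf.tame'.contDiff γ).continuous hb hbd
      (hf.hasVariation γ Γ hΓ)).2 Set.univ
  simpa using this

/-! ### The Frenet apparatus along a variation -/

theorem IsVariation.tame_increment_T {γ : BAL γ₀} {V : ℝ → E3} {Γ : ℝ → BAL γ₀}
    (hΓ : IsVariation γ V Γ) :
    Tame (𝓝 0) (fun ε s => ε * kappa γ s ^ (1 : ℤ)) (fun ε s => fieldT (Γ ε) s - fieldT γ s) where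
  smooth := Eventually.of_forall fun ε => (tameField_T.contDiff _).sub (tameField_T.contDiff _)
  bdd k := by
    obtain ⟨C, m, h⟩ := hΓ.bound k
    refine PolyBdd.of_le C m (h.mono fun ε h s => ?_)
    have h1 : iteratedDeriv k (fun s => fieldT (Γ ε) s - fieldT γ s) s
        = iteratedDeriv k (frameT (Γ ε).1) s - iteratedDeriv k (frameT γ.1) s := by
      simp only [sub_eq_add_neg]
      rw [iteratedDeriv_add_apply' (tameField_T.contDiff _) (tameField_T.contDiff _).neg,
        iteratedDeriv_fun_neg]
      rfl
    rw [h1]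
    refine (h s).trans (le_of_eq ?_)
    rw [zpow_one, abs_mul, abs_of_pos (kappa_pos γ s), kappa]
    ring

theorem IsVariation.hasDerivAt_T {γ : BAL γ₀} {V : ℝ → E3} {Γ : ℝ → BAL γ₀}
    (hΓ : IsVariation γ V Γ) (s : ℝ) :
    HasDerivAt (fun ε => fieldT (Γ ε) s) (_root_.deriv V s) 0 := by
  simpa [iteratedDeriv_one] using! hΓ.velocity 1 s

theorem varDiff_T (hX : TameField 1 (nablaS X)) : VarDiff X 0 fieldT (nablaS X) where
  tame := tameField_T
  tame' := hX.mono zero_le_one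
  incr _ _ hΓ := hΓ.tame_increment_T.trans
    (polyBdd_eps_mul_mul (polyBdd_zpow _ _ zero_le_one))
  hasVariation _ _ hΓ s := hΓ.hasDerivAt_T s

theorem nablaS_fieldT (γ : BAL γ₀) (s : ℝ) :
    nablaS fieldT γ s = kappa γ s • fieldN γ s := γ.2.deriv_frameT s

theorem nablaS_fieldN (γ : BAL γ₀) (s : ℝ) :
    nablaS fieldN γ s = -kappa γ s • fieldT γ s + tau γ s • fieldB γ s := γ.2.deriv_frameN s

theorem nablaS_fieldB (γ : BAL γ₀) (s : ℝ) :
    nablaS fieldB γ s = -tau γ s • fieldN γ s := γ.2.deriv_frameB s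

theorem tameField_nablaS_T : TameField 1 (nablaS fieldT : TangentField γ₀) := by
  rw [show (nablaS fieldT : TangentField γ₀) = fun γ s => kappa γ s • fieldN γ s from
    funext fun γ => funext fun s => nablaS_fieldT γ s]
  simpa using tameField_kappa.smul tameField_N

theorem varDiff_nablaS_T (hX : TameField 1 (nablaS X)) :
    VarDiff X 1 (nablaS fieldT) (nablaS (nablaS X)) where
  tame := tameField_nablaS_T
  tame' := hX.deriv
  incr γ Γ hΓ := hΓ.tame_increment_T.deriv.congr (Eventually.of_forall fun ε s =>
    ((tameField_T.hasDerivAt (Γ ε) s).sub (tameField_T.hasDerivAt γ s)).deriv.symm)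
  hasVariation := (varDiff_T hX).deriv.hasVariation

theorem kappa_sq_eq (γ : BAL γ₀) (s : ℝ) :
    inner ℝ (nablaS fieldT γ s) (nablaS fieldT γ s) = kappa γ s ^ 2 :=
  real_inner_self_eq_norm_sq _

theorem IsVariation.polyBdd_kappaInv {γ : BAL γ₀} {V : ℝ → E3} {Γ : ℝ → BAL γ₀}
    (hΓ : IsVariation γ V Γ) :
    PolyBdd (𝓝 0) (fun _ s => kappa γ s ^ (-1 : ℤ)) (fun ε => kappaInv (Γ ε)) := by
  obtain ⟨C, m, h⟩ := hΓ.nondegenerate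
  refine PolyBdd.of_le C m (h.mono fun ε h s => ?_)
  have h1 := h s
  have h2 : 0 < curvature γ.1 s := kappa_pos γ s
  have h3 : 0 < curvature (Γ ε).1 s := kappa_pos (Γ ε) s
  rw [zpow_neg_one, abs_inv, abs_of_pos (kappa_pos γ s), kappaInv, norm_inv, Real.norm_of_nonneg h3.le,
    kappa, ← div_eq_mul_inv, le_div_iff₀ h2, inv_mul_le_iff₀ h3]
  linarith

variable (hX : TameField 1 (nablaS X))
include hX

/-- The curvatures along a variation have the decay of `κ` uniformly, the lower bound on them
entering through the square root in `κ = √⟪T', T'⟫`. -/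
theorem tame_kappa_family {γ : BAL γ₀} {Γ : ℝ → BAL γ₀} (hΓ : IsVariation γ (X γ) Γ) :
    Tame (𝓝 0) (fun _ s => kappa γ s ^ (1 : ℤ)) (fun ε => kappa (Γ ε)) := by
  have hP := (varDiff_nablaS_T hX).tame_family hΓ
  have hq := (hP.bilin (innerSL ℝ) hP).congr (G := fun ε s => kappa (Γ ε) s ^ 2)
    (Eventually.of_forall fun ε s => (kappa_sq_eq _ _).symm)
  have hinv := (hΓ.polyBdd_kappaInv.bilin (ContinuousLinearMap.mul ℝ ℝ)
    hΓ.polyBdd_kappaInv).congr (G := fun ε s => (kappa (Γ ε) s ^ 2)⁻¹)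
    (Eventually.of_forall fun ε s => by
      rw [sq, mul_inv]
      rfl)
  have hsqrt : ∀ ε s, Real.sqrt (kappa (Γ ε) s ^ 2) = kappa (Γ ε) s := fun ε s =>
    Real.sqrt_sq (kappa_pos _ _).le
  have := hq.sqrt (w := fun _ s => kappa γ s ^ (1 : ℤ)) ?_ hinv ?_ ?_
  · exact this.congr (Eventually.of_forall fun ε s => (hsqrt ε s).symm)
  · exact Eventually.of_forall fun ε s => pow_pos (kappa_pos _ _) 2
  · refine Eventually.of_forall fun ε s => ?_
    have := kappa_ne γ s
    rw [zpow_one, zpow_neg_one]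
    field_simp
    simp
  · obtain ⟨C, m, hC, hb⟩ := hP.polyBdd
    refine ⟨C, m, hC, hb.mono fun ε hb s => ?_⟩
    refine le_trans (le_of_eq ?_) (hb s)
    simp only [hsqrt]
    rw [Real.norm_of_nonneg (kappa_pos _ _).le]
    rfl

/-- The first variation of the curvature. -/
theorem varDiff_kappa : VarDiff X 1 kappa
    (fun γ s => (inner ℝ (fieldN γ s) (nablaS (nablaS X) γ s) : ℝ)) where
  tame := tameField_kappa
  tame' := (tameField_N.bilin (innerSL ℝ) hX.deriv).mono (by norm_num)
  incr γ Γ hΓ := by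
    have hP := varDiff_nablaS_T hX
    have hq := (hP.inner hP).incr γ Γ hΓ
    have hk := tame_kappa_family hX hΓ
    have hsum := hk.add (tameField_kappa γ)
    -- `κ_ε - κ = (κ_ε² - κ²) / (κ_ε + κ)`, where the denominator is at least `κ`
    have hinv := hsum.inv (w' := fun _ s => kappa γ s ^ (-1 : ℤ)) ?_ ?_ ?_
    · refine ((hq.mul hinv).congr_weight ?_).congr ?_
      · refine Eventually.of_forall fun ε s => ?_
        rw [mul_assoc, ← zpow_add₀ (kappa_ne γ s)]
        norm_num
      · refine Eventually.of_forall fun ε s => ?_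
        have := kappa_pos γ s
        have := kappa_pos (Γ ε) s
        rw [kappa_sq_eq, kappa_sq_eq]
        field_simp
        ring
    · exact Eventually.of_forall fun ε s => (add_pos (kappa_pos _ _) (kappa_pos _ _)).ne'
    · refine PolyBdd.of_norm_le (Eventually.of_forall fun ε s => ?_)
      have h1 := kappa_pos γ s
      have h2 := kappa_pos (Γ ε) s
      rw [zpow_neg_one, abs_inv, abs_of_pos h1, norm_inv, Real.norm_of_nonneg (by positivity)]
      gcongr
      linarith
    · refine Eventually.of_forall fun ε s => ?_
      rw [← zpow_add₀ (kappa_ne γ s)]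
      norm_num
  hasVariation γ Γ hΓ s := by
    have hP := varDiff_nablaS_T hX
    have hq := (hP.inner hP).hasVariation γ Γ hΓ s
    have hs := hq.sqrt (by
      rw [hΓ.base, kappa_sq_eq]
      exact (pow_pos (kappa_pos γ s) 2).ne')
    rw [hΓ.base] at hs
    simp only [kappa_sq_eq, Real.sqrt_sq (kappa_pos _ _).le] at hs
    refine hs.congr_deriv ?_
    have := kappa_ne γ s
    rw [real_inner_comm, nablaS_fieldT, inner_smul_left]
    simp only [conj_trivial]
    field_simp
    ring

theorem varDiff_kappaInv : VarDiff X (-1) kappaInv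
    (fun γ s => -(kappaInv γ s * kappaInv γ s *
      (inner ℝ (fieldN γ s) (nablaS (nablaS X) γ s) : ℝ))) where
  tame := tameField_kappaInv
  tame' := (((tameField_kappaInv.mul tameField_kappaInv).mul (varDiff_kappa hX).tame').mono
    (by norm_num)).neg
  incr γ Γ hΓ := by
    have hk := tame_kappa_family hX hΓ
    have hinv := hk.inv (Eventually.of_forall fun ε => kappa_ne (Γ ε)) hΓ.polyBdd_kappaInv
      (Eventually.of_forall fun ε s => by rw [← zpow_add₀ (kappa_ne γ s)]; norm_num)
    refine (((((varDiff_kappa hX).incr γ Γ hΓ).mul hinv).mul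
      (tameField_kappaInv γ)).neg.congr_weight ?_).congr ?_
    · refine Eventually.of_forall fun ε s => ?_
      rw [mul_assoc ε, ← zpow_add₀ (kappa_ne γ s), mul_assoc ε, ← zpow_add₀ (kappa_ne γ s)]
      norm_num
    · refine Eventually.of_forall fun ε s => ?_
      change (kappa (Γ ε) s)⁻¹ - (kappa γ s)⁻¹
        = -((kappa (Γ ε) s - kappa γ s) * (kappa (Γ ε) s)⁻¹ * (kappa γ s)⁻¹)
      have := kappa_ne γ s
      have := kappa_ne (Γ ε) s
      field_simp
      ring
  hasVariation γ Γ hΓ s := by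
    have h := ((varDiff_kappa hX).hasVariation γ Γ hΓ s).fun_inv (kappa_ne _ s)
    rw [hΓ.base] at h
    refine h.congr_deriv ?_
    change _ = -((kappa γ s)⁻¹ * (kappa γ s)⁻¹ * _)
    have := kappa_ne γ s
    field_simp

end VariationalDifferentials

/-! ### The asymptotic direction and the renormalized length -/

section AsymptoticDirection

variable {γ₀ : ℝ → E3} {e : E3}

/-- The unit vector `e` is the direction of the line to which `γ₀` is asymptotic. -/
def HasDirection (γ₀ : ℝ → E3) (e : E3) : Prop :=
  ‖e‖ = 1 ∧ ∃ (p : E3) (a b : ℝ),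
    Tendsto (fun s => γ₀ s - (p + (s + a) • e)) atTop (𝓝 0) ∧
    Tendsto (fun s => γ₀ s - (p + (s + b) • e)) atBot (𝓝 0)

theorem IsReferenceCurve.exists_hasDirection (h : IsReferenceCurve γ₀) :
    ∃ e, HasDirection γ₀ e := by
  obtain ⟨p, e, a, b, he, h⟩ := h.asymptotic
  exact ⟨e, he, p, a, b, h⟩

theorem HasDirection.inner_self (he : HasDirection γ₀ e) : inner ℝ e e = (1 : ℝ) := by
  rw [real_inner_self_eq_norm_sq, he.1]; norm_num

theorem tendsto_sub_line_atTop {c : ℝ → E3} {L a : ℝ} {p : E3}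
    (h : Tendsto (fun s => γ₀ s - (p + (s + a) • e)) atTop (𝓝 0))
    (hc : Tendsto (fun s => c (s + L) - γ₀ s) atTop (𝓝 0)) :
    Tendsto (fun s => c s - (p + (s - L + a) • e)) atTop (𝓝 0) := by
  have h1 := (hc.add h).comp (tendsto_atTop_add_const_right atTop (-L) tendsto_id)
  rw [add_zero] at h1
  refine h1.congr fun s => ?_
  simp only [Function.comp, id, neg_add_cancel_right]
  module

theorem tendsto_sub_line_atBot {c : ℝ → E3} {L b : ℝ} {p : E3}
    (h : Tendsto (fun s => γ₀ s - (p + (s + b) • e)) atBot (𝓝 0))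
    (hc : Tendsto (fun s => c (s - L) - γ₀ s) atBot (𝓝 0)) :
    Tendsto (fun s => c s - (p + (s + L + b) • e)) atBot (𝓝 0) := by
  have h1 := (hc.add h).comp (tendsto_atBot_add_const_right atBot L tendsto_id)
  rw [add_zero] at h1
  refine h1.congr fun s => ?_
  simp only [Function.comp, id, add_sub_cancel_right]
  module

/-- If a curve is asymptotic to a line and its velocity converges, then the limit of the velocity
is the velocity of the line. -/
theorem limit_deriv_eq_of_asymptotic {c : ℝ → E3} (hc : Differentiable ℝ c) {p t e : E3}
    (ht : Tendsto (deriv c) atTop (𝓝 t)) (h : Tendsto (fun s => c s - (p + s • e)) atTop (𝓝 0)) :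
    t = e := by
  have h1 : Tendsto (fun s : ℝ => c (s + 1) - c s) atTop (𝓝 e) := by
    have h2 := ((h.comp (tendsto_atTop_add_const_right atTop (1 : ℝ) tendsto_id)).sub h).add_const e
    rw [sub_zero, zero_add] at h2
    refine h2.congr fun s => ?_
    simp only [Function.comp, id]
    module
  refine eq_of_forall_dist_le fun η hη => ?_
  rw [dist_comm, dist_eq_norm]
  have h3 : ∀ᶠ s in atTop, ‖c (s + 1) - c s - t‖ ≤ η := by
    obtain ⟨S, hS⟩ := eventually_atTop.1 (ht.eventually (Metric.closedBall_mem_nhds t hη))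
    refine eventually_atTop.2 ⟨S, fun s hs => ?_⟩
    have hd : ∀ x, HasDerivAt (fun x => c x - x • t) (deriv c x - t) x := fun x => by
      simpa using (hc x).hasDerivAt.fun_sub ((hasDerivAt_id x).smul_const t)
    have := (convex_Icc s (s + 1)).norm_image_sub_le_of_norm_deriv_le
      (f := fun x => c x - x • t) (C := η) (x := s) (y := s + 1)
      (fun x _ => (hd x).differentiableAt)
      (fun x hx => by
        rw [(hd x).deriv]
        have := hS x (hs.trans hx.1)
        rwa [dist_eq_norm] at this)
      ⟨le_rfl, by linarith⟩ ⟨by linarith, le_rfl⟩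
    rw [add_sub_cancel_left, norm_one, mul_one] at this
    refine le_trans (le_of_eq ?_) this
    congr 1
    module
  exact le_of_tendsto (h1.sub_const t).norm h3

theorem tendsto_fieldT_atTop (he : HasDirection γ₀ e) (γ : BAL γ₀) :
    Tendsto (fieldT γ) atTop (𝓝 e) := by
  obtain ⟨-, p, a, b, ha, hb⟩ := he
  obtain ⟨L, hL, hL'⟩ := γ.2.balanced
  have hint := tameField_nablaS_T.integrable le_rfl γ
  obtain ⟨t, ht⟩ : ∃ t, Tendsto (fieldT γ) atTop (𝓝 t) :=
    ⟨_, tendsto_limUnder_of_hasDerivAt_of_integrableOn_Ioi (a := 0)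
      (fun x _ => tameField_T.hasDerivAt γ x) hint.integrableOn⟩
  suffices h : t = e from h ▸ ht
  refine limit_deriv_eq_of_asymptotic (contDiff_infty_differentiable γ.2.smooth)
    (p := p + (a - L) • e) ht ?_
  refine (tendsto_sub_line_atTop ha hL).congr fun s => ?_
  module

theorem tendsto_fieldT_atBot (he : HasDirection γ₀ e) (γ : BAL γ₀) :
    Tendsto (fieldT γ) atBot (𝓝 e) := by
  obtain ⟨-, p, a, b, ha, hb⟩ := he
  obtain ⟨L, hL, hL'⟩ := γ.2.balanced
  have hint := tameField_nablaS_T.integrable le_rfl γ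
  obtain ⟨t, ht⟩ : ∃ t, Tendsto (fieldT γ) atBot (𝓝 t) :=
    ⟨_, tendsto_limUnder_of_hasDerivAt_of_integrableOn_Iic (a := 0)
      (fun x _ => tameField_T.hasDerivAt γ x) hint.integrableOn⟩
  suffices h : t = e from h ▸ ht
  -- reverse the orientation of the curve
  have hder : ∀ s, HasDerivAt (fun s => γ.1 (-s)) (-fieldT γ (-s)) s := fun s => by
    have h := (contDiff_infty_differentiable γ.2.smooth (-s)).hasDerivAt.scomp s (hasDerivAt_neg s)
    rw [neg_one_smul] at h
    exact h
  have := limit_deriv_eq_of_asymptotic (c := fun s => γ.1 (-s))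
    (fun s => (hder s).differentiableAt) (p := p + (b + L) • e) (e := -e)
    (by
      rw [funext fun s => (hder s).deriv]
      exact (ht.comp tendsto_neg_atTop_atBot).neg)
    (((tendsto_sub_line_atBot hb hL').comp tendsto_neg_atTop_atBot).congr fun s => by
      simp only [Function.comp]
      module)
  exact neg_injective this

/-- Comparison of the renormalized lengths of two curves. -/
theorem renormalizedLength_sub_smul (he : HasDirection γ₀ e) (γ γ' : BAL γ₀)
    (hint : Integrable fun s => fieldT γ' s - fieldT γ s) :
    (renormalizedLength γ' - renormalizedLength γ) • e
      = -∫ s, (fieldT γ' s - fieldT γ s) := by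
  obtain ⟨-, p, a, b, ha, hb⟩ := he
  have h1 := Classical.choose_spec γ.2.balanced
  have h2 := Classical.choose_spec γ'.2.balanced
  rw [renormalizedLength, renormalizedLength]
  set L := Classical.choose γ.2.balanced
  set L' := Classical.choose γ'.2.balanced
  have ht : Tendsto (fun s => γ'.1 s - γ.1 s) atTop (𝓝 ((L - L') • e)) := by
    have := ((tendsto_sub_line_atTop ha h2.1).sub (tendsto_sub_line_atTop ha h1.1)).add_const
      ((L - L') • e)
    rw [sub_zero, zero_add] at this
    refine this.congr fun s => ?_
    module
  have hbt : Tendsto (fun s => γ'.1 s - γ.1 s) atBot (𝓝 ((L' - L) • e)) := by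
    have := ((tendsto_sub_line_atBot hb h2.2).sub (tendsto_sub_line_atBot hb h1.2)).add_const
      ((L' - L) • e)
    rw [sub_zero, zero_add] at this
    refine this.congr fun s => ?_
    module
  have h3 := integral_of_hasDerivAt_of_tendsto (fun s =>
    ((contDiff_infty_differentiable γ'.2.smooth s).hasDerivAt.sub
      (contDiff_infty_differentiable γ.2.smooth s).hasDerivAt)) hint hbt ht
  change ∫ s, (fieldT γ' s - fieldT γ s) = _ at h3
  rw [h3]
  module

/-- The first variation of the renormalized length. -/
theorem varDiff_ell (he : HasDirection γ₀ e) {X : TangentField γ₀} (hX : TameField 1 (nablaS X)) :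
    VarDiff X 0 ell (fun γ _ => -(inner ℝ e (∫ s, nablaS X γ s) : ℝ)) := by
  refine VarDiff.of_const (c := fun γ => renormalizedLength γ) fun γ Γ hΓ => ?_
  obtain ⟨b, hbint, hb'⟩ := hΓ.tame_increment_T.polyBdd.dominated
  have hcont : ∀ ε, Continuous fun s => fieldT (Γ ε) s - fieldT γ s := fun ε =>
    ((tameField_T.contDiff (Γ ε)).sub (tameField_T.contDiff γ)).continuous
  have h := (hasDerivAt_setIntegral_of_dominated
    (F := fun ε s => fieldT (Γ ε) s - fieldT γ s) (Eventually.of_forall hcont)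
    (by simp [hΓ.base]) (hX.contDiff γ).continuous hbint
    (by simpa [hΓ.base] using hb') (fun s => (hΓ.hasDerivAt_T s).sub_const _)).2 Set.univ
  simp only [Measure.restrict_univ] at h
  have h2 := ((innerSL ℝ e).hasFDerivAt.comp_hasDerivAt (0 : ℝ) h).neg.add_const
    (renormalizedLength γ)
  refine h2.congr_of_eventuallyEq ?_
  filter_upwards [hb'] with ε hε
  have hint : Integrable fun s => fieldT (Γ ε) s - fieldT γ s :=
    (hbint.const_mul |ε|).mono' (hcont ε).aestronglyMeasurable (ae_of_all _ hε)
  have h3 := congrArg (fun v => (inner ℝ e v : ℝ)) (renormalizedLength_sub_smul he γ (Γ ε) hint)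
  simp only [inner_smul_right, he.inner_self, inner_neg_right] at h3
  change renormalizedLength (Γ ε) = -(inner ℝ e (∫ s, (fieldT (Γ ε) s - fieldT γ s)))
    + renormalizedLength γ
  linarith

end AsymptoticDirection

/-! ### Fields given by their components in the Frenet frame -/

section FrameFields

variable {γ₀ : ℝ → E3} {n : ℤ}

/-- The tangent field with given components in the Frenet frame. -/
noncomputable def frameField (f g h : ScalarField γ₀) : TangentField γ₀ := fun γ s =>
  f γ s • fieldT γ s + g γ s • fieldN γ s + h γ s • fieldB γ s

theorem wp_eq_frameField (X : NormalField γ₀) :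
    wp X = frameField (antiS (kappa * X.1)) X.1 X.2 := rfl

variable {f g h : ScalarField γ₀}

theorem fieldT_inner_T (γ : BAL γ₀) (s : ℝ) : inner ℝ (fieldT γ s) (fieldT γ s) = (1 : ℝ) :=
  inner_frameT_frameT γ.2.toIsArclengthCurve s
theorem fieldT_inner_N (γ : BAL γ₀) (s : ℝ) : inner ℝ (fieldT γ s) (fieldN γ s) = (0 : ℝ) :=
  γ.2.inner_T_N s
theorem fieldT_inner_B (γ : BAL γ₀) (s : ℝ) : inner ℝ (fieldT γ s) (fieldB γ s) = (0 : ℝ) :=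
  inner_T_B _ _
theorem fieldN_inner_T (γ : BAL γ₀) (s : ℝ) : inner ℝ (fieldN γ s) (fieldT γ s) = (0 : ℝ) := by
  rw [real_inner_comm, fieldT_inner_N]
theorem fieldN_inner_N (γ : BAL γ₀) (s : ℝ) : inner ℝ (fieldN γ s) (fieldN γ s) = (1 : ℝ) :=
  γ.2.inner_N_N s
theorem fieldN_inner_B (γ : BAL γ₀) (s : ℝ) : inner ℝ (fieldN γ s) (fieldB γ s) = (0 : ℝ) :=
  inner_N_B _ _
theorem fieldB_inner_T (γ : BAL γ₀) (s : ℝ) : inner ℝ (fieldB γ s) (fieldT γ s) = (0 : ℝ) := by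
  rw [real_inner_comm, fieldT_inner_B]
theorem fieldB_inner_N (γ : BAL γ₀) (s : ℝ) : inner ℝ (fieldB γ s) (fieldN γ s) = (0 : ℝ) := by
  rw [real_inner_comm, fieldN_inner_B]
theorem fieldB_inner_B (γ : BAL γ₀) (s : ℝ) : inner ℝ (fieldB γ s) (fieldB γ s) = (1 : ℝ) :=
  γ.2.inner_B_B s

theorem inner_T_frameField (γ : BAL γ₀) (s : ℝ) :
    inner ℝ (fieldT γ s) (frameField f g h γ s) = f γ s := by
  rw [frameField, inner_add_right, inner_add_right, inner_smul_right, inner_smul_right,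
    inner_smul_right, fieldT_inner_T, fieldT_inner_N, fieldT_inner_B]
  ring

theorem inner_N_frameField (γ : BAL γ₀) (s : ℝ) :
    inner ℝ (fieldN γ s) (frameField f g h γ s) = g γ s := by
  rw [frameField, inner_add_right, inner_add_right, inner_smul_right, inner_smul_right,
    inner_smul_right, fieldN_inner_T, fieldN_inner_N, fieldN_inner_B]
  ring

theorem inner_B_frameField (γ : BAL γ₀) (s : ℝ) :
    inner ℝ (fieldB γ s) (frameField f g h γ s) = h γ s := by
  rw [frameField, inner_add_right, inner_add_right, inner_smul_right, inner_smul_right,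
    inner_smul_right, fieldB_inner_T, fieldB_inner_N, fieldB_inner_B]
  ring

theorem phi_frameField : phi (frameField f g h) = (g, h) := by
  ext γ s
  · exact inner_N_frameField γ s
  · exact inner_B_frameField γ s

theorem frameField_phi (V : TangentField γ₀) :
    V = frameField (fun γ s => inner ℝ (fieldT γ s) (V γ s)) (phi V).1 (phi V).2 := by
  funext γ s
  exact γ.2.eq_sum_inner s (V γ s)

theorem TameField.frameField (hf : TameField n f) (hg : TameField n g) (hh : TameField n h) :
    TameField n (frameField f g h) := by
  have := ((hf.smul tameField_T).add (hg.smul tameField_N)).add (hh.smul tameField_B)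
  simpa using! this

theorem nablaS_frameField (hf : TameField n f) (hg : TameField n g) (hh : TameField n h) :
    nablaS (frameField f g h)
      = frameField (dS f - kappa * g) (dS g + kappa * f - tau * h) (dS h + tau * g) := by
  funext γ s
  have h1 := (((hf.hasDerivAt γ s).fun_smul (tameField_T.hasDerivAt γ s)).fun_add
    ((hg.hasDerivAt γ s).fun_smul (tameField_N.hasDerivAt γ s))).fun_add
    ((hh.hasDerivAt γ s).fun_smul (tameField_B.hasDerivAt γ s))
  refine h1.deriv.trans ?_
  have hT := nablaS_fieldT γ s
  have hN := nablaS_fieldN γ s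
  have hB := nablaS_fieldB γ s
  rw [nablaS] at hT hN hB
  rw [hT, hN, hB]
  simp only [frameField, dS, Pi.add_apply, Pi.sub_apply, Pi.mul_apply]
  module

theorem frameField_congr {f' g' h' : ScalarField γ₀} (hf : f = f') (hg : g = g') (hh : h = h') :
    frameField f g h = frameField f' g' h' := by
  subst hf hg hh; rfl

theorem cross_frameField (f g h f' g' h' : ScalarField γ₀) (γ : BAL γ₀) (s : ℝ) :
    cross (frameField f g h γ s) (frameField f' g' h' γ s)
      = frameField (g * h' - h * g') (h * f' - f * h') (f * g' - g * f') γ s := by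
  have hTB := γ.2.cross_T_B s
  have hNB := γ.2.cross_N_B s
  have hTN : cross (frameT γ.1 s) (frameN γ.1 s) = frameB γ.1 s := rfl
  have hBT := cross_anticomm (frameB γ.1 s) (frameT γ.1 s)
  have hBN := cross_anticomm (frameB γ.1 s) (frameN γ.1 s)
  have hNT := cross_anticomm (frameN γ.1 s) (frameT γ.1 s)
  rw [hTB] at hBT
  rw [hNB] at hBN
  rw [hTN] at hNT
  simp only [frameField, fieldT, fieldN, fieldB, cross_add_left, cross_add_right, cross_smul_left,
    cross_smul_right, cross_self_eq_zero, hTB, hNB, hTN, hBT, hBN, hNT, Pi.sub_apply,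
    Pi.mul_apply]
  module

theorem fieldT_eq : (fieldT : TangentField γ₀) = frameField 1 0 0 := by
  funext γ s; simp [frameField]

theorem fieldN_eq : (fieldN : TangentField γ₀) = frameField 0 1 0 := by
  funext γ s; simp [frameField]

end FrameFields

/-! ### First variations along vector fields -/

section AlgebraVariation

variable {γ₀ : ℝ → E3} {n m : ℤ} {f g : ScalarField γ₀} {X Y : NormalField γ₀}

theorem Alg.neg (hf : Alg n f) : Alg n (-f) := by
  simpa using Alg.smul (-1) hf

theorem Alg.sub (hf : Alg n f) (hg : Alg n g) : Alg n (f - g) := by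
  rw [sub_eq_add_neg]; exact hf.add hg.neg

theorem Alg.mul' (hf : Alg n f) (hg : Alg m g) {k : ℤ} (hk : n + m = k) : Alg k (f * g) :=
  hk ▸ hf.mul hg

theorem Alg.zero : Alg 0 (0 : ScalarField γ₀) := by
  simpa using Alg.smul (0 : ℝ) (Alg.one (γ₀ := γ₀))

/-- The `N`-component of `∇ₛ (℘ X)`. -/
noncomputable def coefN (X : NormalField γ₀) : ScalarField γ₀ :=
  dS X.1 + kappa * antiS (kappa * X.1) - tau * X.2

/-- The `B`-component of `∇ₛ (℘ X)`. -/
noncomputable def coefB (X : NormalField γ₀) : ScalarField γ₀ := dS X.2 + tau * X.1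

/-- The rotation of the normal plane of the frame induced by a variation along `℘ X`. -/
noncomputable def coefRot (X : NormalField γ₀) : ScalarField γ₀ :=
  kappaInv * (dS (coefB X) + tau * coefN X)

theorem alg_kappa_mul (hX : X ∈ vectorFields γ₀) : Alg 2 (kappa * X.1) := Alg.kappa.mul' hX.1 rfl

theorem alg_coefN (hX : X ∈ vectorFields γ₀) : Alg 1 (coefN X) :=
  ((hX.1.dS).add (Alg.kappa.mul' (alg_kappa_mul hX).antiS rfl)).sub (Alg.tau.mul' hX.2 rfl)

theorem alg_coefB (hX : X ∈ vectorFields γ₀) : Alg 1 (coefB X) :=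
  hX.2.dS.add (Alg.tau.mul' hX.1 rfl)

theorem alg_coefRot (hX : X ∈ vectorFields γ₀) : Alg 0 (coefRot X) :=
  Alg.kappaInv.mul' ((alg_coefB hX).dS.add (Alg.tau.mul' (alg_coefN hX) rfl)) rfl

theorem tameField_wp (hX : X ∈ vectorFields γ₀) : TameField 0 (wp X) :=
  (alg_kappa_mul hX).antiS.tameField.frameField (hX.1.tameField.mono zero_le_one)
    (hX.2.tameField.mono zero_le_one)

theorem dS_antiS (hf : Alg 2 f) : dS (antiS f) = f := by
  funext γ s
  exact (hf.tameField.hasDerivAt_antiS (by norm_num) γ s).deriv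

theorem nablaS_wp (hX : X ∈ vectorFields γ₀) :
    nablaS (wp X) = frameField 0 (coefN X) (coefB X) := by
  rw [wp_eq_frameField, nablaS_frameField (alg_kappa_mul hX).antiS.tameField
    (hX.1.tameField.mono zero_le_one) (hX.2.tameField.mono zero_le_one), dS_antiS (alg_kappa_mul hX),
    sub_self]
  rfl

theorem tameField_zero (n : ℤ) : TameField n (0 : ScalarField γ₀) := fun γ =>
  Tame.fun_const (fun _ => (0 : ℝ)) (Eventually.of_forall fun _ s => by
    rw [norm_zero]; exact abs_nonneg _)

theorem tameField_nablaS_wp (hX : X ∈ vectorFields γ₀) : TameField 1 (nablaS (wp X)) := by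
  rw [nablaS_wp hX]
  exact (tameField_zero 1).frameField (alg_coefN hX).tameField (alg_coefB hX).tameField

theorem nablaS_nablaS_wp (hX : X ∈ vectorFields γ₀) : nablaS (nablaS (wp X)) =
    frameField (-(kappa * coefN X)) (dS (coefN X) - tau * coefB X)
      (dS (coefB X) + tau * coefN X) := by
  rw [nablaS_wp hX, nablaS_frameField (tameField_zero 1) (alg_coefN hX).tameField
    (alg_coefB hX).tameField]
  have h0 : dS (0 : ScalarField γ₀) = 0 := by
    funext γ s
    exact deriv_const s (0 : ℝ)
  rw [h0, mul_zero, add_zero, zero_sub]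

theorem varDiff_T_wp (hX : X ∈ vectorFields γ₀) :
    VarDiff (wp X) 0 fieldT (frameField 0 (coefN X) (coefB X)) :=
  (varDiff_T (tameField_nablaS_wp hX)).congr rfl (nablaS_wp hX)

theorem varDiff_kappa_wp (hX : X ∈ vectorFields γ₀) :
    VarDiff (wp X) 1 kappa (dS (coefN X) - tau * coefB X) := by
  refine (varDiff_kappa (tameField_nablaS_wp hX)).congr rfl ?_
  rw [nablaS_nablaS_wp hX]
  funext γ s
  exact inner_N_frameField γ s

theorem varDiff_kappaInv_wp (hX : X ∈ vectorFields γ₀) :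
    VarDiff (wp X) (-1) kappaInv (-(kappaInv * kappaInv * (dS (coefN X) - tau * coefB X))) := by
  refine (varDiff_kappaInv (tameField_nablaS_wp hX)).congr rfl ?_
  rw [nablaS_nablaS_wp hX]
  funext γ s
  rw [inner_N_frameField γ s]
  rfl

theorem kappaInv_smul_nablaS_T :
    (fun γ s => kappaInv γ s • nablaS fieldT γ s) = (fieldN : TangentField γ₀) := rfl

theorem varDiff_N_wp (hX : X ∈ vectorFields γ₀) :
    VarDiff (wp X) 0 fieldN (frameField (-coefN X) 0 (coefRot X)) := by
  refine ((varDiff_kappaInv_wp hX).smul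
    (varDiff_nablaS_T (tameField_nablaS_wp hX))).congr kappaInv_smul_nablaS_T ?_
  rw [nablaS_nablaS_wp hX]
  funext γ s
  have hk : kappaInv γ s * kappa γ s = 1 := inv_mul_cancel₀ (kappa_ne γ s)
  rw [nablaS_fieldT]
  simp only [frameField, coefRot, Pi.neg_apply, Pi.mul_apply, Pi.sub_apply, Pi.add_apply,
    Pi.zero_apply]
  match_scalars
  · linear_combination (-kappaInv γ s * (dS (coefN X) γ s - tau γ s * coefB X γ s)) * hk
  · linear_combination (-coefN X γ s) * hk
  · ring

theorem varDiff_B_wp (hX : X ∈ vectorFields γ₀) :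
    VarDiff (wp X) 0 fieldB (frameField (-coefB X) (-coefRot X) 0) := by
  refine ((varDiff_T_wp hX).cross (varDiff_N_wp hX)).congr rfl ?_
  funext γ s
  rw [fieldN_eq, fieldT_eq, cross_frameField, cross_frameField]
  simp only [frameField, Pi.neg_apply, Pi.mul_apply, Pi.sub_apply, Pi.zero_apply, Pi.one_apply]
  module

theorem varDiff_tau_wp (hX : X ∈ vectorFields γ₀) :
    VarDiff (wp X) 0 tau (dS (coefRot X) + kappa * coefB X) := by
  refine (((varDiff_N_wp hX).deriv).inner (varDiff_B_wp hX)).congr rfl ?_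
  have h := nablaS_frameField (f := -coefN X) (g := 0) (h := coefRot X)
    ((alg_coefN hX).neg.tameField.mono zero_le_one) (tameField_zero 0) (alg_coefRot hX).tameField
  funext γ s
  rw [show deriv (frameField (-coefN X) 0 (coefRot X) γ) s = _ from congrFun (congrFun h γ) s,
    real_inner_comm, inner_B_frameField, real_inner_comm,
    show deriv (fieldN γ) s = _ from nablaS_fieldN γ s, inner_add_right, inner_smul_right,
    inner_smul_right, real_inner_comm, inner_T_frameField, real_inner_comm, inner_B_frameField]
  simp only [Pi.neg_apply, Pi.mul_apply, Pi.add_apply, Pi.zero_apply]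
  ring

theorem tendsto_wp_atTop {e : E3} (he : HasDirection γ₀ e) (hX : X ∈ vectorFields γ₀)
    (γ : BAL γ₀) :
    Tendsto (wp X γ) atTop (𝓝 (((1 / 2 : ℝ) • ∫ s, kappa γ s * X.1 γ s) • e)) := by
  have h1 := tendsto_balAnti_atTop ((alg_kappa_mul hX).tameField.integrable (by norm_num) γ)
  have h2 := (hX.1.tameField.smul tameField_N).tendsto_zero (by norm_num) γ
  have h3 := (hX.2.tameField.smul tameField_B).tendsto_zero (by norm_num) γ
  have := ((h1.smul (tendsto_fieldT_atTop he γ)).add (h2.mono_left le_sup_right)).add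
    (h3.mono_left le_sup_right)
  rwa [add_zero, add_zero] at this

theorem tendsto_wp_atBot {e : E3} (he : HasDirection γ₀ e) (hX : X ∈ vectorFields γ₀)
    (γ : BAL γ₀) :
    Tendsto (wp X γ) atBot (𝓝 (-(((1 / 2 : ℝ) • ∫ s, kappa γ s * X.1 γ s) • e))) := by
  have h1 := tendsto_balAnti_atBot ((alg_kappa_mul hX).tameField.integrable (by norm_num) γ)
  have h2 := (hX.1.tameField.smul tameField_N).tendsto_zero (by norm_num) γ
  have h3 := (hX.2.tameField.smul tameField_B).tendsto_zero (by norm_num) γ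
  have := ((h1.smul (tendsto_fieldT_atBot he γ)).add (h2.mono_left le_sup_left)).add
    (h3.mono_left le_sup_left)
  rwa [add_zero, add_zero, neg_smul] at this

/-- The tangential component of `℘ X` is balanced, so the first variation moves the two ends of the
curve by opposite multiples of `e`. -/
theorem integral_nablaS_wp {e : E3} (he : HasDirection γ₀ e) (hX : X ∈ vectorFields γ₀)
    (γ : BAL γ₀) : ∫ s, nablaS (wp X) γ s = (∫ s, kappa γ s * X.1 γ s) • e := by
  refine (integral_of_hasDerivAt_of_tendsto (fun s => (tameField_wp hX).hasDerivAt γ s)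
    ((tameField_nablaS_wp hX).integrable le_rfl γ) (tendsto_wp_atBot he hX γ)
    (tendsto_wp_atTop he hX γ)).trans ?_
  module

theorem varDiff_ell_wp {e : E3} (he : HasDirection γ₀ e) (hX : X ∈ vectorFields γ₀) :
    VarDiff (wp X) 0 ell (-integ (kappa * X.1)) := by
  refine (varDiff_ell he (tameField_nablaS_wp hX)).congr rfl ?_
  funext γ s
  rw [integral_nablaS_wp he hX, inner_smul_right, he.inner_self, mul_one]
  rfl

/-- The algebra of scalar fields is closed under variational differentials along vector fields. -/
theorem Alg.exists_varDiff {e : E3} (he : HasDirection γ₀ e) (hX : X ∈ vectorFields γ₀)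
    (hf : Alg n f) : ∃ f', Alg n f' ∧ VarDiff (wp X) n f f' := by
  induction hf with
  | add _ _ hf hg =>
    obtain ⟨f', hf', hf⟩ := hf
    obtain ⟨g', hg', hg⟩ := hg
    exact ⟨_, hf'.add hg', hf.add hg⟩
  | smul r _ hf =>
    obtain ⟨f', hf', hf⟩ := hf
    exact ⟨_, hf'.smul r, hf.const_smul r⟩
  | lower _ hf =>
    obtain ⟨f', hf', hf⟩ := hf
    exact ⟨_, hf'.lower, hf.mono (by omega)⟩
  | mul hf₀ hg₀ hf hg =>
    obtain ⟨f', hf', hf⟩ := hf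
    obtain ⟨g', hg', hg⟩ := hg
    exact ⟨_, (hf'.mul hg₀).add (hf₀.mul hg'), hf.mul hg⟩
  | dS _ hf =>
    obtain ⟨f', hf', hf⟩ := hf
    exact ⟨_, hf'.dS, hf.deriv⟩
  | antiS _ hf =>
    obtain ⟨f', hf', hf⟩ := hf
    exact ⟨_, hf'.antiS, hf.antiS (by norm_num)⟩
  | integ _ hf =>
    obtain ⟨f', hf', hf⟩ := hf
    exact ⟨_, hf'.integ, hf.integ (by norm_num)⟩
  | kappa =>
    exact ⟨_, (alg_coefN hX).dS.sub (Alg.tau.mul' (alg_coefB hX) rfl), varDiff_kappa_wp hX⟩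
  | kappaInv =>
    exact ⟨_, ((Alg.kappaInv.mul Alg.kappaInv).mul' ((alg_coefN hX).dS.sub
      (Alg.tau.mul' (alg_coefB hX) rfl)) rfl).neg, varDiff_kappaInv_wp hX⟩
  | tau =>
    exact ⟨_, (alg_coefRot hX).dS.add (Alg.kappa.mul (alg_coefB hX)).lower.lower,
      varDiff_tau_wp hX⟩
  | arc =>
    refine ⟨0, Alg.zero, tameField_arc, tameField_zero 0, fun γ Γ hΓ => ?_, fun γ Γ hΓ s => ?_⟩
    · exact (Tame.fun_const (fun _ => (0 : ℝ)) (Eventually.of_forall fun _ s => by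
        rw [norm_zero]; exact abs_nonneg _)).congr
        (Eventually.of_forall fun ε s => sub_self s)
    · exact hasDerivAt_const _ _
  | ell => exact ⟨_, (alg_kappa_mul hX).integ.neg, varDiff_ell_wp he hX⟩
  | one => exact ⟨0, Alg.zero, VarDiff.const 1⟩

/-- The first variation of a field given by its components, the frame rotating with angular velocity
made up of `coefN X`, `coefB X` and `coefRot X`. -/
theorem VarDiff.frameField {f' g g' h h' : ScalarField γ₀} (hX : X ∈ vectorFields γ₀)
    (hf : VarDiff (wp X) 0 f f') (hg : VarDiff (wp X) 0 g g') (hh : VarDiff (wp X) 0 h h') :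
    VarDiff (wp X) 0 (frameField f g h)
      (frameField (f' - coefN X * g - coefB X * h) (g' + coefN X * f - coefRot X * h)
        (h' + coefB X * f + coefRot X * g)) := by
  have := ((hf.smul (varDiff_T_wp hX)).add (hg.smul (varDiff_N_wp hX))).add
    (hh.smul (varDiff_B_wp hX))
  refine VarDiff.congr (n := 0) this rfl ?_
  funext γ s
  simp only [VortexFilament.frameField, Pi.neg_apply, Pi.mul_apply, Pi.sub_apply, Pi.zero_apply,
    Pi.add_apply]
  module
end AlgebraVariation

/-! ### Unit vectors near a given one -/

section UnitPerturbation

variable {ι : Type*} {l : Filter ι} {w : ι → ℝ → ℝ}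

theorem Tame.inv_of_le {q : ι → ℝ → ℝ} (hq : Tame l (fun _ _ => 1) q) {δ : ℝ} (hδ : 0 < δ)
    (h : ∀ᶠ i in l, ∀ s, δ ≤ q i s) : Tame l (fun _ _ => 1) (fun i s => (q i s)⁻¹) := by
  refine hq.inv (h.mono fun i h s => (hδ.trans_le (h s)).ne') ?_ (by simp)
  refine PolyBdd.of_le δ⁻¹ 0 (h.mono fun i h s => ?_)
  rw [norm_inv, Real.norm_of_nonneg (hδ.le.trans (h s)), pow_zero, abs_one, mul_one, mul_one]
  exact inv_anti₀ hδ (h s)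

theorem Tame.sqrt_of_le {q : ι → ℝ → ℝ} (hq : Tame l (fun _ _ => 1) q) {δ : ℝ} (hδ : 0 < δ)
    (h : ∀ᶠ i in l, ∀ s, δ ≤ q i s) : Tame l (fun _ _ => 1) (fun i s => Real.sqrt (q i s)) := by
  refine hq.sqrt (h.mono fun i h s => hδ.trans_le (h s)) (hq.inv_of_le hδ h).polyBdd (by simp) ?_
  refine (PolyBdd.of_norm_le (w := fun i s => q i s + 1) (h.mono fun i h s => ?_)).trans
    (hq.add (Tame.const (1 : ℝ))).polyBdd
  have h0 : 0 ≤ q i s := hδ.le.trans (h s)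
  rw [Real.norm_of_nonneg (Real.sqrt_nonneg _), abs_of_nonneg (by linarith)]
  nlinarith [Real.sq_sqrt h0, sq_nonneg (Real.sqrt (q i s) - 1)]

/-- For orthogonal `t`, `q` with `t` of unit length: the unit vector in direction `t + q`. -/
noncomputable def unitPerturb (t q : E3) : E3 :=
  (Real.sqrt (1 + inner ℝ q q))⁻¹ • (t + q)

theorem inner_self_nonneg_real (q : E3) : 0 ≤ (inner ℝ q q : ℝ) := real_inner_self_nonneg

theorem norm_unitPerturb {t q : E3} (ht : inner ℝ t t = (1 : ℝ)) (h : inner ℝ t q = (0 : ℝ)) :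
    ‖unitPerturb t q‖ = 1 := by
  apply norm_eq_one_of_inner
  have h0 := inner_self_nonneg_real q
  have h1 : Real.sqrt (1 + inner ℝ q q) ≠ 0 := (Real.sqrt_pos.2 (by linarith)).ne'
  have h2 := Real.sq_sqrt (by linarith : 0 ≤ 1 + (inner ℝ q q : ℝ))
  rw [unitPerturb, inner_smul_left, inner_smul_right, inner_add_left, inner_add_right,
    inner_add_right, ht, h, real_inner_comm t q, h]
  simp only [conj_trivial, add_zero, zero_add]
  field_simp
  rw [h2]

theorem unitPerturb_zero (t : E3) : unitPerturb t 0 = t := by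
  simp [unitPerturb]

/-- The change of the unit vector is of the size of `Q`: the difference `1 / √(1 + |Q|²) - 1` is
written without cancellation. -/
theorem tame_unitPerturb_sub {T : ℝ → E3} {Q : ι → ℝ → E3}
    (hT : Tame l (fun _ _ => 1) (fun _ => T)) (hQ : Tame l w Q)
    (hw : PolyBdd l (fun _ _ => 1) w) :
    Tame l w (fun i s => unitPerturb (T s) (Q i s) - T s) := by
  have hG : Tame l w (fun i s => (inner ℝ (Q i s) (Q i s) : ℝ)) := by
    refine (hQ.bilin (innerSL ℝ) hQ).trans (w' := w) ?_
    simpa using hw.bilin (ContinuousLinearMap.mul ℝ ℝ) (PolyBdd.of_norm_le (w := w) (F := w)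
      (by simp))
  have hD : Tame l (fun _ _ => 1) (fun i s => 1 + (inner ℝ (Q i s) (Q i s) : ℝ)) :=
    (Tame.const 1).add (hG.trans hw)
  have hR := hD.sqrt_of_le one_pos (Eventually.of_forall fun i s => by
    linarith [inner_self_nonneg_real (Q i s)])
  have hR1 : ∀ i s, 1 ≤ Real.sqrt (1 + (inner ℝ (Q i s) (Q i s) : ℝ)) := fun i s => by
    rw [Real.one_le_sqrt]
    linarith [inner_self_nonneg_real (Q i s)]
  have hRi := hR.inv_of_le one_pos (Eventually.of_forall hR1)
  have hRi2 := ((Tame.const (1 : ℝ)).add hR).inv_of_le one_pos (Eventually.of_forall fun i s => by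
    linarith [hR1 i s])
  refine (((hRi.smul hQ).congr_weight (w' := w) (by simp)).add
    ((((hG.mul hRi).mul hRi2).neg.smul hT).congr_weight (w' := w) (by simp))).congr ?_
  refine Eventually.of_forall fun i s => ?_
  rw [unitPerturb]
  set G := (inner ℝ (Q i s) (Q i s) : ℝ) with hGdef
  have h0 : 0 ≤ G := inner_self_nonneg_real _
  have h1 : 1 ≤ Real.sqrt (1 + G) := hR1 i s
  have h2 := Real.sq_sqrt (by linarith : 0 ≤ 1 + G)
  set R := Real.sqrt (1 + G)
  have h3 : -(G * R⁻¹ * (1 + R)⁻¹) = R⁻¹ - 1 := by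
    have : G = R ^ 2 - 1 := by linarith
    have h4 : R ≠ 0 := by positivity
    have h5 : 1 + R ≠ 0 := by positivity
    rw [this]
    field_simp
    ring
  rw [h3]
  module

/-- The coefficient of `e` which turns `v - a` into a unit vector again, where `v` is a unit vector,
`a` is orthogonal to `e` and `x` is the `e`-component of `v`: the root near zero of a quadratic
equation, written without cancellation. -/
noncomputable def closingCoef (v a : E3) (x : ℝ) : ℝ :=
  (2 * inner ℝ v a - inner ℝ a a) *
    (x + Real.sqrt (x ^ 2 + (2 * inner ℝ v a - inner ℝ a a)))⁻¹

variable {e v a : E3} {x : ℝ}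

theorem closingCoef_zero (v : E3) (x : ℝ) : closingCoef v 0 x = 0 := by
  simp [closingCoef]

theorem abs_closing_le (hv : ‖v‖ = 1) (ha : ‖a‖ ≤ 1 / 64) :
    |2 * inner ℝ v a - inner ℝ a a| ≤ 3 * ‖a‖ := by
  have h1 := abs_real_inner_le_norm v a
  rw [hv, one_mul] at h1
  rw [real_inner_self_eq_norm_sq]
  have h2 := abs_le.1 h1
  rw [abs_le]
  constructor <;> nlinarith [norm_nonneg a]

theorem closing_radicand_ge (hv : ‖v‖ = 1) (ha : ‖a‖ ≤ 1 / 64) (hx : 1 / 4 ≤ x) :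
    1 / 64 ≤ x ^ 2 + (2 * inner ℝ v a - inner ℝ a a) := by
  have h1 := abs_le.1 (abs_closing_le hv ha)
  nlinarith

theorem abs_closingCoef_le (hv : ‖v‖ = 1) (ha : ‖a‖ ≤ 1 / 64) (hx : 1 / 4 ≤ x) :
    |closingCoef v a x| ≤ 12 * ‖a‖ := by
  have h1 := abs_closing_le hv ha
  have h2 := Real.sqrt_nonneg (x ^ 2 + (2 * inner ℝ v a - inner ℝ a a))
  rw [closingCoef, abs_mul, abs_inv, abs_of_nonneg (by positivity : 0 ≤ x + _),
    ← div_eq_mul_inv, div_le_iff₀ (by linarith)]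
  nlinarith [norm_nonneg a]

/-- For `‖v‖ = 1` and `⟪e, a⟫ = 0`, unit length of `v - a + λ e` means
`λ² + 2 x λ = 2 ⟪v, a⟫ - ⟪a, a⟫` with `x = ⟪e, v⟫`. -/
theorem norm_add_closingCoef (he : inner ℝ e e = (1 : ℝ)) (hv : ‖v‖ = 1)
    (hae : inner ℝ e a = (0 : ℝ)) (ha : ‖a‖ ≤ 1 / 64) (hx : 1 / 4 ≤ x) (hxv : x = inner ℝ e v) :
    ‖v - a + closingCoef v a x • e‖ = 1 := by
  have h1 := closing_radicand_ge hv ha hx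
  have h2 := Real.sq_sqrt (by linarith : 0 ≤ x ^ 2 + (2 * inner ℝ v a - inner ℝ a a))
  have h3 := Real.sqrt_nonneg (x ^ 2 + (2 * inner ℝ v a - inner ℝ a a))
  set S := Real.sqrt (x ^ 2 + (2 * inner ℝ v a - inner ℝ a a)) with hS
  have h4 : closingCoef v a x = S - x := by
    have h5 : x + S ≠ 0 := by positivity
    rw [closingCoef, ← hS, show 2 * inner ℝ v a - inner ℝ a a = S ^ 2 - x ^ 2 by linarith]
    field_simp
    ring
  apply norm_eq_one_of_inner
  have hvv : inner ℝ v v = (1 : ℝ) := by rw [real_inner_self_eq_norm_sq, hv]; norm_num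
  rw [h4]
  simp only [inner_add_left, inner_add_right, inner_sub_left, inner_sub_right, inner_smul_left,
    inner_smul_right, conj_trivial]
  rw [real_inner_comm v a, real_inner_comm e v, real_inner_comm e a, hae, hvv, he, ← hxv]
  linarith

theorem tame_closingCoef {v a : ι → ℝ → E3} {x : ι → ℝ → ℝ} (hv : Tame l (fun _ _ => 1) v)
    (ha : Tame l w a) (hx : Tame l (fun _ _ => 1) x) (hw : PolyBdd l (fun _ _ => 1) w)
    (hv1 : ∀ᶠ i in l, ∀ s, ‖v i s‖ = 1) (ha1 : ∀ᶠ i in l, ∀ s, ‖a i s‖ ≤ 1 / 64)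
    (hx1 : ∀ᶠ i in l, ∀ s, 1 / 4 ≤ x i s) :
    Tame l w (fun i s => closingCoef (v i s) (a i s) (x i s)) := by
  have hG : Tame l w (fun i s => 2 * (inner ℝ (v i s) (a i s) : ℝ) - inner ℝ (a i s) (a i s)) := by
    have h1 : Tame l w (fun i s => (inner ℝ (v i s) (a i s) : ℝ)) :=
      (hv.bilin (innerSL ℝ) ha).congr_weight (by simp)
    have h2 : Tame l w (fun i s => (inner ℝ (a i s) (a i s) : ℝ)) :=
      ((ha.trans hw).bilin (innerSL ℝ) ha).congr_weight (by simp)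
    exact (h1.const_smul 2).sub h2
  have hq := ((hx.mul hx).congr_weight (w' := fun _ _ => 1) (by simp)).add (hG.trans hw)
  have hS := hq.sqrt_of_le (δ := 1 / 64) (by norm_num) (by
    filter_upwards [hv1, ha1, hx1] with i h1 h2 h3 s
    have := closing_radicand_ge (h1 s) (h2 s) (h3 s)
    rwa [sq] at this)
  have hI := (hx.add hS).inv_of_le (δ := 1 / 4) (by norm_num) (hx1.mono fun i h s => by
    linarith [h s, Real.sqrt_nonneg (x i s * x i s
      + (2 * (inner ℝ (v i s) (a i s) : ℝ) - inner ℝ (a i s) (a i s)))])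
  refine ((hG.mul hI).congr_weight (w' := w) (by simp)).congr
    (Eventually.of_forall fun i s => ?_)
  rw [closingCoef, sq]

end UnitPerturbation

/-! ### Cut-off functions -/

section CutOff

variable {γ₀ : ℝ → E3} {ι : Type*} {l : Filter ι}

theorem hasCompactSupport_iteratedDeriv {g : ℝ → ℝ} (hc : HasCompactSupport g) (k : ℕ) :
    HasCompactSupport (iteratedDeriv k g) := by
  induction k with
  | zero => simpa using hc
  | succ k ih => rw [iteratedDeriv_succ]; exact ih.deriv

/-- On compact sets the weight `κ` is bounded below. -/
theorem tame_of_hasCompactSupport (γ : BAL γ₀) {g : ℝ → ℝ} (hg : ContDiff ℝ ∞ g)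
    (hc : HasCompactSupport g) :
    Tame l (fun _ s => kappa γ s ^ (1 : ℤ)) (fun _ => g) where
  smooth := Eventually.of_forall fun _ => hg
  bdd k := by
    obtain ⟨C, hC⟩ := Continuous.bounded_above_of_compact_support
      (f := fun s => iteratedDeriv k g s * (kappa γ s)⁻¹)
      ((hg.continuous_iteratedDeriv k (WithTop.coe_le_coe.2 le_top)).mul
        ((continuous_kappa γ).inv₀ (kappa_ne γ)))
      (hasCompactSupport_iteratedDeriv hc k).mul_right
    refine PolyBdd.of_le C 0 (Eventually.of_forall fun _ s => ?_)
    have h1 := hC s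
    have h0 := kappa_pos γ s
    rw [norm_mul, norm_inv, Real.norm_of_nonneg h0.le, ← div_eq_mul_inv, div_le_iff₀ h0] at h1
    simpa [abs_of_pos h0] using h1

/-- Dilations `g (r s)` of a cut-off are bounded with all derivatives, uniformly for `|r| ≤ 1`. -/
theorem tame_dilation {g : ℝ → ℝ} (hg : ContDiff ℝ ∞ g) (hc : HasCompactSupport g) {r : ι → ℝ}
    (hr : ∀ᶠ i in l, |r i| ≤ 1) : Tame l (fun _ _ => 1) (fun i s => g (r i * s)) where
  smooth := Eventually.of_forall fun i => hg.comp (contDiff_const.mul contDiff_id)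
  bdd k := by
    have hk : ((k : ℕ∞) : WithTop ℕ∞) ≤ ∞ := WithTop.coe_le_coe.2 le_top
    obtain ⟨C, hC⟩ := (hg.continuous_iteratedDeriv k hk).bounded_above_of_compact_support
      (hasCompactSupport_iteratedDeriv hc k)
    refine PolyBdd.of_le C 0 (hr.mono fun i hi s => ?_)
    rw [iteratedDeriv_comp_const_mul (hg.of_le hk), norm_mul, norm_pow, Real.norm_eq_abs,
      pow_zero, abs_one, mul_one, mul_one]
    exact (mul_le_of_le_one_left (norm_nonneg _) (pow_le_one₀ (abs_nonneg _) hi)).trans (hC _)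

end CutOff

/-! ### Closed families of tangents -/

section ClosedFamily

variable {γ₀ : ℝ → E3}

/-- The orthogonal projection along the unit vector `e`. -/
noncomputable def perp (e : E3) : E3 →L[ℝ] E3 :=
  ContinuousLinearMap.id ℝ E3 - (innerSL ℝ e).smulRight e

theorem perp_apply (e v : E3) : perp e v = v - (inner ℝ e v : ℝ) • e := by
  simp [perp]

theorem inner_perp {e : E3} (he : inner ℝ e e = (1 : ℝ)) (v : E3) :
    inner ℝ e (perp e v) = (0 : ℝ) := by
  rw [perp_apply, inner_sub_right, inner_smul_right, he]; ring

theorem perp_smul {e : E3} (he : inner ℝ e e = (1 : ℝ)) (r : ℝ) : perp e (r • e) = 0 := by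
  rw [perp_apply, inner_smul_right, he]; module

/-- The filter along which the deformation parameter `ε` tends to zero while the dilation
parameter `r` of the cut-off ranges over `[0, 1]`. -/
def paramFilter : Filter (ℝ × ℝ) := 𝓝 0 ×ˢ 𝓟 (Set.Icc 0 1)

theorem eventually_paramFilter_fst {p : ℝ → Prop} (h : ∀ᶠ ε in 𝓝 0, p ε) :
    ∀ᶠ i in paramFilter, p i.1 := tendsto_fst.eventually h

theorem eventually_paramFilter_snd : ∀ᶠ i in paramFilter, i.2 ∈ Set.Icc (0 : ℝ) 1 :=
  tendsto_snd.eventually (mem_principal_self _)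

theorem hasDerivAt_unitPerturb (t q : E3) :
    HasDerivAt (fun ε : ℝ => unitPerturb t (ε • q)) q 0 := by
  have hq : HasDerivAt (fun ε : ℝ => ε • q) q 0 := by
    simpa using (hasDerivAt_id (0 : ℝ)).smul_const q
  have h1 : HasDerivAt (fun ε : ℝ => 1 + (inner ℝ (ε • q) (ε • q) : ℝ)) 0 0 := by
    have := (hq.inner ℝ hq).const_add 1
    simpa using this
  have h2 := (h1.sqrt (by simp)).fun_inv (by simp)
  have h3 := h2.fun_smul (hq.const_add t)
  refine h3.congr_deriv ?_
  simp

/-- Data for closing up the curve: a region far out, where the tangent is close to the asymptotic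
direction, with a bump function `ψ` of integral one and a cut-off `η` which is one on the support
of `ψ`. -/
theorem exists_closing_region {e : E3} (he : HasDirection γ₀ e) (γ : BAL γ₀) :
    ∃ (ψ η : ℝ → ℝ) (R : ℝ), ContDiff ℝ ∞ ψ ∧ HasCompactSupport ψ ∧ ∫ s, ψ s = 1 ∧
      ContDiff ℝ ∞ η ∧ HasCompactSupport η ∧ (∀ s, η s ∈ Set.Icc (0 : ℝ) 1) ∧
      (∀ s, ψ s ≠ 0 → η s = 1) ∧ (∀ s, R < |s| → ψ s = 0) ∧
      (∀ s, η s ≠ 0 → 1 / 2 ≤ (inner ℝ e (fieldT γ s) : ℝ)) := by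
  have h1 : Tendsto (fun s => (inner ℝ e (fieldT γ s) : ℝ)) atTop (𝓝 1) := by
    have := ((innerSL ℝ e).continuous.tendsto e).comp (tendsto_fieldT_atTop he γ)
    rwa [innerSL_apply_apply, he.inner_self] at this
  obtain ⟨S, hS⟩ := eventually_atTop.1 (h1.eventually (eventually_ge_nhds (by norm_num : (1/2 : ℝ) < 1)))
  let ψ : ContDiffBump (S + 3) := ⟨1, 2, one_pos, by norm_num⟩
  let η : ContDiffBump (S + 3) := ⟨2, 3, two_pos, by norm_num⟩
  have hψ : ∀ s, ψ.normed volume s ≠ 0 → |s - (S + 3)| < 2 := by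
    intro s hs
    have : s ∈ Function.support (ψ.normed volume) := hs
    rw [ψ.support_normed_eq, Metric.mem_ball, Real.dist_eq] at this
    exact this
  refine ⟨ψ.normed volume, η, |S + 3| + 2, ψ.contDiff_normed, ψ.hasCompactSupport_normed,
    ψ.integral_normed, η.contDiff, η.hasCompactSupport, fun s => ⟨η.nonneg, η.le_one⟩, ?_, ?_, ?_⟩
  · intro s hs
    apply η.one_of_mem_closedBall
    rw [Metric.mem_closedBall, Real.dist_eq]
    exact (hψ s hs).le
  · intro s hs
    by_contra h
    have := hψ s h
    have h2 := abs_sub_abs_le_abs_sub s (S + 3)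
    linarith
  · intro s hs
    have : s ∈ Function.support η := hs
    rw [η.support_eq, Metric.mem_ball, Real.dist_eq] at this
    have h3 : |s - (S + 3)| < 3 := this
    exact hS s (by linarith [(abs_lt.1 h3).1])

/-- A family of increments `F` of the unit tangent, with first variation `U`, that keeps unit
length, changes the tangent over a compact interval only when `r ≠ 0`, and changes the end points
of the curve only in the asymptotic direction. -/
theorem exists_tangent_increment {e : E3} (he : HasDirection γ₀ e) (γ : BAL γ₀) {U : ℝ → E3}
    (hU : Tame (𝓝 (0 : ℝ)) (fun _ s => kappa γ s ^ (1 : ℤ)) (fun _ => U))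
    (hperp : ∀ s, inner ℝ (fieldT γ s) (U s) = (0 : ℝ)) {ρ : ℝ} (hρ : ∫ s, U s = ρ • e) :
    ∃ F : ℝ × ℝ → ℝ → E3,
      Tame paramFilter (fun i s => i.1 * kappa γ s ^ (1 : ℤ)) F ∧
      (∀ᶠ i in paramFilter, ∀ s, ‖fieldT γ s + F i s‖ = 1) ∧
      (∀ᶠ i in paramFilter, ∃ c : ℝ, ∫ s, F i s = c • e) ∧
      (∃ R, ∀ i s, R < |s| → 2 < |i.2 * s| → F i s = 0) ∧
      (∀ r s, F (0, r) s = 0) ∧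
      ∀ r : ℝ → ℝ, Tendsto (fun ε => (ε, r ε)) (𝓝 0) paramFilter → Tendsto r (𝓝 0) (𝓝 0) →
        ∀ s, HasDerivAt (fun ε => F (ε, r ε) s) (U s) 0 := by
  obtain ⟨ψ, η, R, hψ, hψc, hψ1, hη, hηc, hη01, hψη, hψR, hηT⟩ := exists_closing_region he γ
  have hee := he.inner_self
  let χ : ContDiffBump (0 : ℝ) := ⟨1, 2, one_pos, by norm_num⟩
  -- the cut-off variation of the tangent
  let Q : ℝ × ℝ → ℝ → E3 := fun i s => (i.1 * χ (i.2 * s)) • U s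
  let v : ℝ × ℝ → ℝ → E3 := fun i s => unitPerturb (fieldT γ s) (Q i s)
  -- the defect of the end points and its compensation
  let u : ℝ × ℝ → E3 := fun i => perp e (∫ s, (v i s - fieldT γ s))
  let a : ℝ × ℝ → ℝ → E3 := fun i s => ψ s • u i
  let x : ℝ × ℝ → ℝ → ℝ := fun i s => 1 + η s * ((inner ℝ e (v i s) : ℝ) - 1)
  let lam : ℝ × ℝ → ℝ → ℝ := fun i s => closingCoef (v i s) (a i s) (x i s)
  let F : ℝ × ℝ → ℝ → E3 := fun i s => (v i s - fieldT γ s) - a i s + lam i s • e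
  let w : ℝ × ℝ → ℝ → ℝ := fun i s => i.1 * kappa γ s ^ (1 : ℤ)
  have hle1 : ∀ᶠ i in paramFilter, |i.1| ≤ 1 := eventually_paramFilter_fst eventually_abs_le_one
  have hκ1 : PolyBdd paramFilter (fun _ _ => 1) (fun _ s => kappa γ s ^ (1 : ℤ)) :=
    (polyBdd_zpow paramFilter γ zero_le_one).congr_weight (by simp)
  have hw : PolyBdd paramFilter (fun _ _ => 1) w :=
    (PolyBdd.bilin (ContinuousLinearMap.mul ℝ ℝ) (F := fun i _ => i.1) (w₁ := fun _ _ => 1)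
      (PolyBdd.of_norm_le (by simpa using hle1)) hκ1).congr_weight (by simp)
  have hT : Tame paramFilter (fun _ _ => 1) (fun _ => fieldT γ) :=
    (tameField_T γ).const_filter.congr_weight (by simp)
  have hQ : Tame paramFilter w Q := by
    have h1 : Tame paramFilter (fun i _ => i.1) (fun i (_ : ℝ) => i.1) :=
      Tame.fun_const _ (by simp)
    have h2 := tame_dilation (l := paramFilter) (r := fun i => i.2) χ.contDiff
      χ.hasCompactSupport (eventually_paramFilter_snd.mono fun i hi => by
        rw [abs_of_nonneg hi.1]; exact hi.2)
    exact ((h1.mul h2).smul (hU.const_filter (l' := paramFilter))).congr_weight (by simp [w])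
  have hQperp : ∀ i s, inner ℝ (fieldT γ s) (Q i s) = (0 : ℝ) := fun i s => by
    simp only [Q]
    rw [inner_smul_right, hperp, mul_zero]
  have hv1 : ∀ i s, ‖v i s‖ = 1 := fun i s => norm_unitPerturb (fieldT_inner_T γ s) (hQperp i s)
  have hA : Tame paramFilter w (fun i s => v i s - fieldT γ s) := tame_unitPerturb_sub hT hQ hw
  have hv : Tame paramFilter (fun _ _ => 1) v := by
    simpa using (hA.trans hw).add hT
  obtain ⟨b, hb, hAb⟩ := hA.polyBdd.dominated
  obtain ⟨C, hC, hAC⟩ := hA.polyBdd.uniform_bound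
  have hAint : ∀ᶠ i in paramFilter, Integrable fun s => v i s - fieldT γ s := by
    filter_upwards [hA.smooth, hAb] with i h1 h2
    exact (hb.const_mul |i.1|).mono' h1.continuous.aestronglyMeasurable (ae_of_all _ h2)
  -- the defect is of order `ε`
  have hu : ∃ D, 0 ≤ D ∧ ∀ᶠ i in paramFilter, ‖u i‖ ≤ D * |i.1| := by
    refine ⟨‖perp e‖ * ∫ s, |b s|, by positivity, ?_⟩
    filter_upwards [hAb] with i h
    calc ‖u i‖ ≤ ‖perp e‖ * ‖∫ s, (v i s - fieldT γ s)‖ := (perp e).le_opNorm _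
      _ ≤ ‖perp e‖ * ∫ s, |i.1| * |b s| := by
          gcongr
          refine norm_integral_le_of_norm_le (hb.norm.const_mul _) (ae_of_all _ fun s => ?_)
          exact (h s).trans (mul_le_mul_of_nonneg_left (le_abs_self _) (abs_nonneg _))
      _ = _ := by rw [integral_const_mul]; ring
  obtain ⟨D, hD, hu⟩ := hu
  have hψt : Tame paramFilter (fun _ s => kappa γ s ^ (1 : ℤ)) (fun _ => ψ) :=
    tame_of_hasCompactSupport γ hψ hψc
  have hηt : Tame paramFilter (fun _ _ => 1) (fun _ => η) :=
    (tame_of_hasCompactSupport γ hη hηc).trans hκ1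
  have ha : Tame paramFilter w a := by
    have h1 : Tame paramFilter (fun i _ => D * i.1) (fun i (_ : ℝ) => u i) :=
      Tame.fun_const _ (hu.mono fun i h s => by rwa [abs_mul, abs_of_nonneg hD])
    refine (hψt.smul h1).trans (PolyBdd.of_le D 0 (Eventually.of_forall fun i s => ?_))
    rw [Real.norm_eq_abs, pow_zero, mul_one, ← abs_of_nonneg hD, ← abs_mul, abs_of_nonneg hD]
    exact le_of_eq (congrArg _ (by simp only [w]; ring))
  have hx : Tame paramFilter (fun _ _ => 1) x := by
    have h1 : Tame paramFilter (fun _ _ => 1) (fun i s => (inner ℝ e (v i s) : ℝ)) :=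
      hv.clm (innerSL ℝ e)
    exact (Tame.const (1 : ℝ)).add
      ((hηt.mul (h1.sub (Tame.const (1 : ℝ)))).congr_weight (by simp))
  -- uniform smallness of the increments
  have hsmall : ∀ δ > 0, ∀ K : ℝ, 0 ≤ K → ∀ᶠ i in paramFilter, K * |i.1| ≤ δ := by
    intro δ hδ K hK
    refine eventually_paramFilter_fst (p := fun ε => K * |ε| ≤ δ) ?_
    have : Tendsto (fun ε : ℝ => K * |ε|) (𝓝 0) (𝓝 (K * |(0 : ℝ)|)) :=
      (continuous_const.mul continuous_abs).tendsto 0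
    rw [abs_zero, mul_zero] at this
    exact this.eventually (eventually_le_nhds hδ)
  obtain ⟨M, hM⟩ := hψ.continuous.bounded_above_of_compact_support hψc
  have hM0 : 0 ≤ M := (norm_nonneg _).trans (hM 0)
  have ha1 : ∀ᶠ i in paramFilter, ∀ s, ‖a i s‖ ≤ 1 / 64 := by
    filter_upwards [hu, hsmall (1 / 64) (by norm_num) (M * D) (by positivity)] with i h1 h2 s
    calc ‖a i s‖ = ‖ψ s‖ * ‖u i‖ := norm_smul _ _
      _ ≤ M * (D * |i.1|) := by gcongr; exact hM s
      _ ≤ 1 / 64 := by rwa [← mul_assoc]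
  have hx1 : ∀ᶠ i in paramFilter, ∀ s, 1 / 4 ≤ x i s := by
    filter_upwards [hAC, hsmall (1 / 4) (by norm_num) C hC] with i h1 h2 s
    have h01 := hη01 s
    by_cases h0 : η s = 0
    · simp only [x, h0]; norm_num
    have h3 := hηT s h0
    have h4 : |(inner ℝ e (v i s - fieldT γ s) : ℝ)| ≤ 1 / 4 := by
      refine (abs_real_inner_le_norm _ _).trans ?_
      rw [he.1, one_mul]
      refine (h1 s).trans ?_
      linarith
    rw [inner_sub_right] at h4
    have h5 := (abs_le.1 h4).1
    simp only [x]
    nlinarith [h01.1, h01.2]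
  have hlam : Tame paramFilter w lam :=
    tame_closingCoef hv ha hx hw (Eventually.of_forall hv1) ha1 hx1
  have hlame : Tame paramFilter w (fun i s => lam i s • e) :=
    hlam.clm ((ContinuousLinearMap.id ℝ ℝ).smulRight e)
  have hF : Tame paramFilter w F := (hA.sub ha).add hlame
  have hea : ∀ i s, inner ℝ e (a i s) = (0 : ℝ) := fun i s => by
    simp only [a, u]
    rw [inner_smul_right, inner_perp hee, mul_zero]
  have ha0 : ∀ i s, ψ s = 0 → a i s = 0 ∧ lam i s = 0 := fun i s h => by
    have : a i s = 0 := by simp only [a, h, zero_smul]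
    exact ⟨this, by simp only [lam, this, closingCoef_zero]⟩
  refine ⟨F, hF, ?_, ?_, ?_, ?_, ?_⟩
  · filter_upwards [ha1, hx1] with i h1 h2 s
    have h3 : fieldT γ s + F i s = v i s - a i s + lam i s • e := by simp only [F]; abel
    rw [h3]
    by_cases h0 : ψ s = 0
    · rw [(ha0 i s h0).1, (ha0 i s h0).2, sub_zero, zero_smul, add_zero]
      exact hv1 i s
    · refine norm_add_closingCoef hee (hv1 i s) (hea i s) (h1 s) (h2 s) ?_
      simp only [x, hψη s h0]
      ring
  · obtain ⟨b', hb', hlb⟩ := hlam.polyBdd.dominated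
    filter_upwards [hAint, hlam.smooth, hlb] with i h1 h2 h3
    have hli : Integrable (lam i) :=
      (hb'.const_mul |i.1|).mono' h2.continuous.aestronglyMeasurable (ae_of_all _ h3)
    have hψi : Integrable ψ := hψ.continuous.integrable_of_hasCompactSupport hψc
    have h4 : ∫ s, F i s = (∫ s, (v i s - fieldT γ s)) - u i + (∫ s, lam i s) • e := by
      simp only [F, a]
      have h5 : Integrable (fun s => v i s - fieldT γ s - ψ s • u i) := by
        exact h1.sub (hψi.smul_const _)
      rw [integral_add h5 (hli.smul_const e), integral_sub h1 (hψi.smul_const (u i)),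
        integral_smul_const, integral_smul_const, hψ1, one_smul]
    refine ⟨inner ℝ e (∫ s, (v i s - fieldT γ s)) + ∫ s, lam i s, ?_⟩
    rw [h4]
    simp only [u, perp_apply]
    module
  · refine ⟨R, fun i s h1 h2 => ?_⟩
    have h3 := ha0 i s (hψR s h1)
    have h4 : χ (i.2 * s) = 0 := by
      apply χ.zero_of_le_dist
      rw [dist_zero_right, Real.norm_eq_abs]
      exact h2.le
    simp only [F, h3, v, Q, h4, mul_zero, zero_smul, unitPerturb_zero, sub_self, add_zero]
  · intro r s
    have h1 : ∀ s, v (0, r) s - fieldT γ s = 0 := fun s => by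
      simp only [v, Q, zero_mul, zero_smul, unitPerturb_zero, sub_self]
    have h2 : u (0, r) = 0 := by
      simp only [u, h1, integral_zero, map_zero]
    have h3 : a (0, r) s = 0 := by simp only [a, h2, smul_zero]
    simp only [F, h1, h3, lam, closingCoef_zero, zero_smul, sub_self, add_zero]
  · intro r hr hr0 s
    -- near a fixed point the cut-off is invisible for small `ε`
    have hvd : ∀ s, HasDerivAt (fun ε => v (ε, r ε) s - fieldT γ s) (U s) 0 := by
      intro s
      have h0 := (hasDerivAt_unitPerturb (fieldT γ s) (U s)).sub_const (fieldT γ s)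
      refine HasDerivAt.congr_of_eventuallyEq h0 ?_
      have h1 : Tendsto (fun ε => r ε * s) (𝓝 0) (𝓝 0) := by
        simpa using hr0.mul_const s
      filter_upwards [h1.eventually (Metric.ball_mem_nhds 0 one_pos)] with ε hε
      have h2 : χ (r ε * s) = 1 := χ.one_of_mem_closedBall (Metric.ball_subset_closedBall hε)
      simp only [v, Q, h2, mul_one]
    have hv0 : ∀ s, v (0, r 0) s - fieldT γ s = 0 := fun s => by
      simp only [v, Q, zero_mul, zero_smul, unitPerturb_zero, sub_self]
    have hud : HasDerivAt (fun ε => u (ε, r ε)) 0 0 := by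
      have h1 := (hasDerivAt_setIntegral_of_dominated
        (F := fun ε s => v (ε, r ε) s - fieldT γ s) (G := U) (b := b)
        ((hr.eventually hA.smooth).mono fun ε h => h.continuous)
        (by simp only [hv0]; exact integrable_zero _ _ _)
        (eventually_const.1 hU.smooth).continuous hb
        ((hr.eventually hAb).mono fun ε h s => by rw [hv0, sub_zero]; exact h s) hvd).2 Set.univ
      simp only [Measure.restrict_univ] at h1
      have h2 := (perp e).hasFDerivAt.comp_hasDerivAt (0 : ℝ) h1
      rw [hρ, perp_smul hee] at h2
      exact h2
    have hu0 : u (0, r 0) = 0 := by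
      simp only [u, hv0, integral_zero, map_zero]
    have had : HasDerivAt (fun ε => a (ε, r ε) s) 0 0 := by
      have h := hud.fun_const_smul (ψ s)
      rw [smul_zero] at h
      exact h
    have ha00 : a (0, r 0) s = 0 := by simp only [a, hu0, smul_zero]
    have hld : HasDerivAt (fun ε => lam (ε, r ε) s) 0 0 := by
      rw [hasDerivAt_iff_isLittleO] at had ⊢
      have hl0 : lam (0, r 0) s = 0 := by simp only [lam, ha00, closingCoef_zero]
      simp only [hl0, ha00, smul_zero, sub_zero] at had ⊢
      refine (Asymptotics.IsBigO.of_bound 12 ?_).trans_isLittleO had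
      filter_upwards [hr.eventually ha1, hr.eventually hx1] with ε h1 h2
      exact abs_closingCoef_le (hv1 _ s) (h1 s) (h2 s)
    have h := ((hvd s).fun_sub had).fun_add (hld.smul_const e)
    exact h.congr_deriv (by simp)

end ClosedFamily

/-! ### Existence of variations -/

section Existence

variable {γ₀ : ℝ → E3} {e : E3}

/-- All conditions on a balanced curve but the last concern the tangent near infinity only. -/
theorem IsBAL.of_frameT_eventuallyEq {c c' : ℝ → E3} (h : IsBAL γ₀ c) (hc' : IsArclengthCurve c')
    (hk : ∀ s, curvature c' s ≠ 0)
    (hT : ∀ᶠ s in atBot ⊔ atTop, frameT c' =ᶠ[𝓝 s] frameT c)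
    (hL : ∃ L : ℝ, Tendsto (fun s => c' (s + L) - γ₀ s) atTop (𝓝 0) ∧
      Tendsto (fun s => c' (s - L) - γ₀ s) atBot (𝓝 0)) : IsBAL γ₀ c' := by
  have hκ : ∀ᶠ s in atBot ⊔ atTop, curvature c' =ᶠ[𝓝 s] curvature c :=
    hT.mono fun s hs => hs.deriv.fun_comp norm
  have hN : ∀ᶠ s in atBot ⊔ atTop, frameN c' =ᶠ[𝓝 s] frameN c := by
    filter_upwards [hT, hκ] with s h1 h2
    exact h2.fun_inv.smul h1.deriv
  have hτ : ∀ᶠ s in atBot ⊔ atTop, torsion c' =ᶠ[𝓝 s] torsion c := by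
    filter_upwards [hT, hN] with s h1 h2
    filter_upwards [h1, h2, h2.deriv] with t h3 h4 h5
    rw [torsion, torsion, frameB, frameB, h3, h4, h5]
  refine ⟨hc', hk, fun P => ?_, fun n => ?_, fun n => ?_, hL⟩
  · refine (h.curvature_rapid P).congr' (hκ.mono fun s hs => ?_)
    simp only [hs.self_of_nhds]
  · obtain ⟨P, hP, hlim⟩ := h.curvature_poly n
    refine ⟨P, hP, hlim.congr' (hκ.mono fun s hs => ?_)⟩
    simp only [hs.self_of_nhds, hs.iteratedDeriv_eq]
  · obtain ⟨P, hP, hlim⟩ := h.torsion_poly n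
    refine ⟨P, hP, hlim.congr' (hτ.mono fun s hs => ?_)⟩
    simp only [hs.iteratedDeriv_eq]

theorem eventually_lt_abs (R : ℝ) : ∀ᶠ s : ℝ in atBot ⊔ atTop, R < |s| :=
  eventually_sup.2 ⟨tendsto_abs_atBot_atTop.eventually_gt_atTop R,
    tendsto_abs_atTop_atTop.eventually_gt_atTop R⟩

section Perturbation

variable {γ : BAL γ₀} {A : ℝ → E3} {R : ℝ}

theorem integrable_of_eq_zero (hA : ContDiff ℝ ∞ A) (h0 : ∀ s, R < |s| → A s = 0) :
    Integrable A := by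
  refine hA.continuous.integrable_of_hasCompactSupport
    (HasCompactSupport.intro (isCompact_closedBall (0 : ℝ) R) fun s hs => h0 s ?_)
  rwa [Metric.mem_closedBall, dist_zero_right, Real.norm_eq_abs, not_le] at hs

theorem hasDerivAt_add_balAnti (hA : ContDiff ℝ ∞ A) (hi : Integrable A) (s : ℝ) :
    HasDerivAt (fun s => γ.1 s + balAnti A s) (fieldT γ s + A s) s :=
  (contDiff_infty_differentiable γ.2.smooth s).hasDerivAt.fun_add
    (hasDerivAt_balAnti hA.continuous hi s)

/-- A compactly supported change of the unit tangent, whose integral has the asymptotic direction,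
leads to a balanced curve. -/
theorem IsBAL.add_balAnti (he : HasDirection γ₀ e) (hA : ContDiff ℝ ∞ A)
    (h0 : ∀ s, R < |s| → A s = 0) {r : ℝ} (hr : ∫ s, A s = r • e)
    (h1 : ∀ s, ‖fieldT γ s + A s‖ = 1) (hk : ∀ s, deriv (fun t => fieldT γ t + A t) s ≠ 0) :
    IsBAL γ₀ (fun s => γ.1 s + balAnti A s) := by
  have hi := integrable_of_eq_zero hA h0
  have hd : frameT (fun s => γ.1 s + balAnti A s) = fun s => fieldT γ s + A s :=
    funext fun s => (hasDerivAt_add_balAnti hA hi s).deriv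
  refine γ.2.of_frameT_eventuallyEq ⟨γ.2.smooth.add (contDiff_balAnti hA hi), fun s => ?_⟩
    (fun s => ?_) ?_ ?_
  · exact (congrArg norm (congrFun hd s)).trans (h1 s)
  · rw [curvature, hd]
    exact norm_ne_zero_iff.2 (hk s)
  · filter_upwards [eventually_lt_abs R] with s hs
    filter_upwards [continuous_abs.continuousAt.eventually (eventually_gt_nhds hs)] with t ht
    rw [hd]
    simp only [h0 t ht, add_zero]
    rfl
  · obtain ⟨-, p, a, b, ha, hb⟩ := he
    obtain ⟨L, hL, hL'⟩ := γ.2.balanced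
    -- the parameter shift makes up for the displacements `±(r / 2) • e` of the two ends
    refine ⟨L - r / 2, ?_, ?_⟩
    · have h2 := (tendsto_sub_line_atTop ha hL).add
        ((tendsto_balAnti_atTop hi).sub_const ((r / 2) • e))
      have h3 := (h2.comp (tendsto_atTop_add_const_right atTop (L - r / 2) tendsto_id)).sub ha
      rw [hr] at h3
      rw [show (0 : E3) + ((1 / 2 : ℝ) • r • e - (r / 2) • e) - 0 = 0 by module] at h3
      refine h3.congr fun s => ?_
      simp only [Function.comp, id]
      module
    · have h2 := (tendsto_sub_line_atBot hb hL').add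
        ((tendsto_balAnti_atBot hi).add_const ((r / 2) • e))
      have h3 := (h2.comp (tendsto_atBot_add_const_right atBot (-(L - r / 2)) tendsto_id)).sub hb
      rw [hr] at h3
      rw [show (0 : E3) + (-((1 / 2 : ℝ) • r • e) + (r / 2) • e) - 0 = 0 by module] at h3
      refine h3.congr fun s => ?_
      simp only [Function.comp, id, ← sub_eq_add_neg]
      module

end Perturbation

theorem hasDerivAt_iteratedDeriv_of_tame {w : ℝ → ℝ} (hw : Continuous w) (n : ℕ) {F : ℝ → ℝ → E3}
    {G : ℝ → E3} (hF : Tame (𝓝 0) (fun ε s => ε * w s) (fun ε s => F ε s - F 0 s))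
    (hF0 : ContDiff ℝ ∞ (F 0)) (hG : ContDiff ℝ ∞ G)
    (hd : ∀ s, HasDerivAt (fun ε => F ε s) (G s) 0) (s : ℝ) :
    HasDerivAt (fun ε => iteratedDeriv n (F ε) s) (iteratedDeriv n G s) 0 := by
  induction n generalizing F G with
  | zero => simpa using hd s
  | succ n ih =>
    simp only [iteratedDeriv_succ']
    refine ih (F := fun ε => deriv (F ε)) ?_ (contDiff_infty_deriv hF0) (contDiff_infty_deriv hG)
      (hasDerivAt_deriv_of_tame hw hF hF0 hG hd)
    refine hF.deriv.congr (hF.smooth.mono fun ε h s => ?_)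
    have h1 : F ε = fun s => (F ε s - F 0 s) + F 0 s := by simp
    have h2 := (contDiff_infty_differentiable h s).hasDerivAt.fun_add
      (contDiff_infty_differentiable hF0 s).hasDerivAt
    rw [← h1] at h2
    rw [h2.deriv, add_sub_cancel_right]

/-- There is a variation of every curve along every vector field. -/
theorem exists_isVariation (he : HasDirection γ₀ e) {X : NormalField γ₀}
    (hX : X ∈ vectorFields γ₀) (γ : BAL γ₀) : ∃ Γ, IsVariation γ (wp X γ) Γ := by
  classical
  have hU := tameField_nablaS_wp hX
  obtain ⟨F, hF, hF1, hFint, ⟨R, hR⟩, hF0, hFd⟩ := exists_tangent_increment he γ (hU γ)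
    (fun s => by rw [nablaS_wp hX, inner_T_frameField]; rfl) (integral_nablaS_wp he hX γ)
  obtain ⟨C, m, hC, hb⟩ := hF.bdd 1
  -- the cut-off at distance of order `1 / r` has to let `r ^ m` dominate the bound for `F'`
  let r : ℝ → ℝ := fun ε => |ε| ^ (((m + 1 : ℕ) : ℝ)⁻¹)
  have hrpow : ∀ ε, r ε ^ (m + 1) = |ε| := fun ε =>
    Real.rpow_inv_natCast_pow (abs_nonneg ε) (Nat.succ_ne_zero m)
  have hrnn : ∀ ε, 0 ≤ r ε := fun ε => Real.rpow_nonneg (abs_nonneg ε) _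
  have hrpos : ∀ ε, ε ≠ 0 → 0 < r ε := fun ε hε => Real.rpow_pos_of_pos (abs_pos.2 hε) _
  have hm1 : 0 < ((m + 1 : ℕ) : ℝ)⁻¹ := by positivity
  have hr0 : Tendsto r (𝓝 0) (𝓝 0) := by
    have h1 : Continuous r := continuous_abs.rpow_const fun _ => Or.inr hm1.le
    have h2 : r 0 = 0 := by simp only [r, abs_zero, Real.zero_rpow hm1.ne']
    simpa [h2] using h1.tendsto 0
  have hr : Tendsto (fun ε => (ε, r ε)) (𝓝 0) paramFilter := by
    refine tendsto_id.prodMk (tendsto_principal.2 ?_)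
    filter_upwards [hr0.eventually (eventually_le_nhds one_pos)] with ε hε using ⟨hrnn ε, hε⟩
  let A : ℝ → ℝ → E3 := fun ε => F (ε, r ε)
  have hA : Tame (𝓝 0) (fun ε s => ε * kappa γ s ^ (1 : ℤ)) A := hF.comp hr
  have hA0 : A 0 = 0 := funext fun s => hF0 _ s
  have hAd := hFd r hr hr0
  have hsupp : ∀ ε, ∃ R', ∀ s, R' < |s| → A ε s = 0 := by
    intro ε
    rcases eq_or_ne ε 0 with rfl | hε
    · exact ⟨0, fun s _ => by rw [hA0]; rfl⟩
    · refine ⟨max R (2 / r ε), fun s hs => hR _ s ((le_max_left _ _).trans_lt hs) ?_⟩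
      have h1 := (le_max_right _ _).trans_lt hs
      rw [abs_mul, abs_of_nonneg (hrnn ε), mul_comm]
      exact (div_lt_iff₀ (hrpos ε hε)).1 h1
  -- the curvature changes at most by half
  have hhalf : ∀ᶠ ε in 𝓝 (0 : ℝ), ∀ s, ‖deriv (A ε) s‖ ≤ kappa γ s / 2 := by
    have h1 : Tendsto (fun ε => C * 3 ^ m * r ε) (𝓝 0) (𝓝 0) := by
      simpa using hr0.const_mul (C * 3 ^ m)
    have h2 : Tendsto (fun ε => r ε * R) (𝓝 0) (𝓝 0) := by simpa using hr0.mul_const R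
    filter_upwards [hr.eventually hb, h1.eventually (eventually_le_nhds one_half_pos),
      h2.eventually (eventually_lt_nhds two_pos), hr0.eventually (eventually_le_nhds one_pos)]
      with ε h3 h4 h5 h5' s
    have hk := kappa_pos γ s
    rcases le_or_gt (r ε * |s|) 2 with h6 | h6
    · have h7 : r ε ≤ 1 := h5'
      have h8 : (1 + |s|) * r ε ≤ 3 := by linarith
      have h9 : 0 ≤ (1 + |s|) * r ε := mul_nonneg (by positivity) (hrnn ε)
      have h10 := h3 s
      rw [iteratedDeriv_one, zpow_one, abs_mul, abs_of_pos hk, ← hrpow ε] at h10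
      refine h10.trans ?_
      calc C * (1 + |s|) ^ m * (r ε ^ (m + 1) * kappa γ s)
          = C * ((1 + |s|) * r ε) ^ m * r ε * kappa γ s := by rw [mul_pow]; ring
        _ ≤ C * 3 ^ m * r ε * kappa γ s := by
            have := hrnn ε
            gcongr
        _ ≤ 1 / 2 * kappa γ s := by gcongr
        _ = kappa γ s / 2 := by ring
    · have h7 : ∀ᶠ t in 𝓝 s, A ε t = 0 := by
        have h8 : ∀ᶠ t in 𝓝 s, 2 < r ε * |t| :=
          (continuous_const.mul continuous_abs).continuousAt.eventually (eventually_gt_nhds h6)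
        filter_upwards [h8] with t ht
        refine hR _ t ?_ (by rwa [abs_mul, abs_of_nonneg (hrnn ε)])
        exact lt_of_mul_lt_mul_left (h5.trans ht) (hrnn ε)
      have h9 : deriv (A ε) s = 0 := by
        have : A ε =ᶠ[𝓝 s] fun _ => 0 := h7
        rw [this.deriv_eq, deriv_const]
      rw [h9, norm_zero]
      positivity
  have hderivT : ∀ ε, ContDiff ℝ ∞ (A ε) → ∀ s, deriv (fun t => fieldT γ t + A ε t) s
      = deriv (fieldT γ) s + deriv (A ε) s := fun ε h s =>
    ((tameField_T.hasDerivAt γ s).fun_add (contDiff_infty_differentiable h s).hasDerivAt).deriv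
  have hnormT : ∀ s, ‖deriv (fieldT γ) s‖ = kappa γ s := fun s => rfl
  have hcurv : ∀ᶠ ε in 𝓝 (0 : ℝ), ∀ s,
      kappa γ s / 2 ≤ ‖deriv (fun t => fieldT γ t + A ε t) s‖ := by
    filter_upwards [hA.smooth, hhalf] with ε h1 h2 s
    rw [hderivT ε h1]
    have h3 := norm_sub_le_norm_add (deriv (fieldT γ) s) (deriv (A ε) s)
    have h4 := h2 s
    rw [hnormT] at h3
    linarith
  let c : ℝ → ℝ → E3 := fun ε s => γ.1 s + balAnti (A ε) s
  have hc : ∀ᶠ ε in 𝓝 (0 : ℝ), IsBAL γ₀ (c ε) := by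
    filter_upwards [hA.smooth, hr.eventually hF1, hr.eventually hFint, hcurv] with ε h1 h2 h3 h4
    obtain ⟨R', hR'⟩ := hsupp ε
    obtain ⟨q, hq⟩ := h3
    refine IsBAL.add_balAnti he h1 hR' hq h2 fun s h => ?_
    have h5 := h4 s
    rw [h, norm_zero] at h5
    linarith [kappa_pos γ s]
  let Γ : ℝ → BAL γ₀ := fun ε => if h : IsBAL γ₀ (c ε) then ⟨c ε, h⟩ else γ
  have hΓ : ∀ᶠ ε in 𝓝 (0 : ℝ), (Γ ε).1 = c ε := hc.mono fun ε h =>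
    congrArg Subtype.val (dif_pos h)
  have hΓT : ∀ᶠ ε in 𝓝 (0 : ℝ), frameT (Γ ε).1 = fun s => fieldT γ s + A ε s := by
    filter_upwards [hΓ, hA.smooth] with ε h1 h2
    obtain ⟨R', hR'⟩ := hsupp ε
    rw [h1]
    exact funext fun s => (hasDerivAt_add_balAnti h2 (integrable_of_eq_zero h2 hR') s).deriv
  have hincr : Tame (𝓝 0) (fun ε s => ε * kappa γ s ^ (1 : ℤ))
      (fun ε s => (fieldT γ s + A ε s) - (fieldT γ s + A 0 s)) :=
    hA.congr (Eventually.of_forall fun ε s => by simp [hA0])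
  have hTd : ∀ s, HasDerivAt (fun ε => fieldT γ s + A ε s) (nablaS (wp X) γ s) 0 := fun s =>
    (hAd s).const_add _
  refine ⟨Γ, ?_, fun n s => ?_, fun n => ?_, ⟨2, 0, ?_⟩⟩
  · refine Subtype.ext (hΓ.self_of_nhds.trans (funext fun s => ?_))
    simp [c, hA0, balAnti]
  · cases n with
    | zero =>
      simp only [iteratedDeriv_zero]
      obtain ⟨b, hbi, hAb⟩ := hA.polyBdd.dominated
      have h1 := hasDerivAt_balAnti_of_dominated (hA.smooth.mono fun ε h => h.continuous)
        (by rw [hA0]; exact integrable_zero _ _ _) (hU.contDiff γ).continuous hbi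
        (hAb.mono fun ε h s => by rw [hA0]; simpa using h s) hAd s
      have h2 := h1.congr_deriv (eq_balAnti (fun s => (tameField_wp hX).hasDerivAt γ s)
        (hU.integrable le_rfl γ) (tendsto_wp_atTop he hX γ) (tendsto_wp_atBot he hX γ) s)
      exact (h2.const_add (γ.1 s)).congr_of_eventuallyEq (hΓ.mono fun ε h => congrFun h s)
    | succ n =>
      simp only [iteratedDeriv_succ']
      refine (hasDerivAt_iteratedDeriv_of_tame (w := fun s => kappa γ s ^ (1 : ℤ))
        (continuous_kappa_zpow γ 1) n hincr ?_ (hU.contDiff γ) hTd s).congr_of_eventuallyEq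
        (hΓT.mono fun ε h => ?_)
      · simpa [hA0] using tameField_T.contDiff γ
      · change iteratedDeriv n (frameT (Γ ε).1) s = _
        rw [h]
  · obtain ⟨C, m, -, hb⟩ := hA.bdd n
    refine ⟨C, m, ?_⟩
    filter_upwards [hb, hΓT, hA.smooth] with ε h1 h2 h3 s
    rw [h2, iteratedDeriv_add_apply' (tameField_T.contDiff γ) h3]
    have h4 := h1 s
    rw [zpow_one, abs_mul, abs_of_pos (kappa_pos γ s)] at h4
    change ‖iteratedDeriv n (fieldT γ) s + iteratedDeriv n (A ε) s - iteratedDeriv n (fieldT γ) s‖ ≤ _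
    rw [add_sub_cancel_left]
    refine h4.trans (le_of_eq ?_)
    change _ = |ε| * (C * (1 + |s|) ^ m * kappa γ s)
    ring
  · filter_upwards [hcurv, hΓT] with ε h1 h2 s
    have h3 := h1 s
    rw [pow_zero, mul_one, curvature, curvature, h2]
    change kappa γ s ≤ _
    linarith

end Existence

/-! ### The recursion operator -/

section Recursion

variable {γ₀ : ℝ → E3} {e : E3} {X Y : NormalField γ₀} {P Q S : TangentField γ₀}

/-- Uniqueness of variational differentials rests on the existence of variations. -/
theorem HasVariation.unique (he : HasDirection γ₀ e) (hX : X ∈ vectorFields γ₀)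
    {W : Type} [NormedAddCommGroup W] [NormedSpace ℝ W] {f f' f'' : BAL γ₀ → ℝ → W}
    (h : HasVariation (wp X) f f') (h' : HasVariation (wp X) f f'') : f' = f'' := by
  funext γ s
  obtain ⟨Γ, hΓ⟩ := exists_isVariation he hX γ
  exact (h γ Γ hΓ s).unique (h' γ Γ hΓ s)

theorem HasVariation.existsUnique (he : HasDirection γ₀ e) (hX : X ∈ vectorFields γ₀)
    {W : Type} [NormedAddCommGroup W] [NormedSpace ℝ W] {f f' : BAL γ₀ → ℝ → W}
    (h : HasVariation (wp X) f f') : ∃! V, HasVariation (wp X) f V :=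
  ⟨f', h, fun _ h' => HasVariation.unique he hX h' h⟩

theorem HasVariation.variation_eq (he : HasDirection γ₀ e) (hX : X ∈ vectorFields γ₀)
    {W : Type} [NormedAddCommGroup W] [NormedSpace ℝ W] {f f' : BAL γ₀ → ℝ → W}
    (h : HasVariation (wp X) f f') : variation (wp X) f = f' := by
  have hu := HasVariation.existsUnique he hX h
  rw [variation, dif_pos hu]
  exact HasVariation.unique he hX hu.choose_spec.1 h

/-- Tangent fields with components in the algebra, the tangential one being a balanced
antiderivative up to a rapidly decreasing summand. -/
def BalancedField (P : TangentField γ₀) : Prop :=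
  ∃ ρ σ α β, Alg 2 ρ ∧ Alg 2 σ ∧ Alg 1 α ∧ Alg 1 β ∧ P = frameField (antiS ρ + σ) α β

theorem antiS_add {f g : ScalarField γ₀} (hf : Alg 2 f) (hg : Alg 2 g) :
    antiS (f + g) = antiS f + antiS g := by
  have hf' := fun γ => hf.tameField.integrable (by norm_num) γ
  have hg' := fun γ => hg.tameField.integrable (by norm_num) γ
  funext γ s
  simp only [antiS, Pi.add_apply]
  rw [integral_add (hf' γ).integrableOn (hg' γ).integrableOn,
    integral_add (hf' γ).integrableOn (hg' γ).integrableOn]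
  ring

theorem antiS_const_mul {F : BAL γ₀ → ℝ} (f : ScalarField γ₀) :
    antiS (fun γ s => F γ * f γ s) = fun γ s => F γ * antiS f γ s := by
  funext γ s
  simp only [antiS]
  rw [integral_const_mul, integral_const_mul]
  ring

theorem BalancedField.add (hP : BalancedField P) (hQ : BalancedField Q) :
    BalancedField (P + Q) := by
  obtain ⟨ρ, σ, α, β, hρ, hσ, hα, hβ, rfl⟩ := hP
  obtain ⟨ρ', σ', α', β', hρ', hσ', hα', hβ', rfl⟩ := hQ
  refine ⟨ρ + ρ', σ + σ', α + α', β + β', hρ.add hρ', hσ.add hσ', hα.add hα', hβ.add hβ', ?_⟩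
  rw [antiS_add hρ hρ']
  funext γ s
  simp only [frameField, Pi.add_apply]
  module

theorem BalancedField.neg (hP : BalancedField P) : BalancedField (-P) := by
  obtain ⟨ρ, σ, α, β, hρ, hσ, hα, hβ, rfl⟩ := hP
  refine ⟨-ρ, -σ, -α, -β, hρ.neg, hσ.neg, hα.neg, hβ.neg, ?_⟩
  have : antiS (-ρ) = -antiS ρ := by
    have h := antiS_const_mul (F := fun _ => -1) ρ
    simp only [neg_one_mul] at h
    exact h
  rw [this]
  funext γ s
  simp only [frameField, Pi.add_apply, Pi.neg_apply]
  module

theorem BalancedField.sub (hP : BalancedField P) (hQ : BalancedField Q) :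
    BalancedField (P - Q) := by
  rw [sub_eq_add_neg]; exact hP.add hQ.neg

theorem balancedField_cross_wp (hX : X ∈ vectorFields γ₀) (hY : Y ∈ vectorFields γ₀) :
    BalancedField (fun γ s => cross (wp X γ s) (wp Y γ s)) := by
  have h1 := (alg_kappa_mul hX).antiS
  have h2 := (alg_kappa_mul hY).antiS
  have h0 : Alg 2 ((0 : ℝ) • (kappa * X.1)) := (alg_kappa_mul hX).smul 0
  refine ⟨(0 : ℝ) • (kappa * X.1), _, _, _, h0, (hX.1.mul' hY.2 rfl).sub (hX.2.mul' hY.1 rfl),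
    (hX.2.mul' h2 rfl).sub (h1.mul' hY.2 rfl), (h1.mul' hY.1 rfl).sub (hX.1.mul' h2 rfl), ?_⟩
  funext γ s
  rw [wp_eq_frameField, wp_eq_frameField, cross_frameField]
  simp [frameField, antiS]

/-- A balanced field whose `s`-derivative is normal to the curve is determined by its normal
component. -/
theorem BalancedField.eq_wp (hP : BalancedField P)
    (h : ∀ γ s, inner ℝ (fieldT γ s) (nablaS P γ s) = (0 : ℝ)) :
    phi P ∈ vectorFields γ₀ ∧ P = wp (phi P) := by
  obtain ⟨ρ, σ, α, β, hρ, hσ, hα, hβ, rfl⟩ := hP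
  rw [phi_frameField]
  refine ⟨⟨hα, hβ⟩, ?_⟩
  rw [wp_eq_frameField]
  refine frameField_congr ?_ rfl rfl
  have hf : TameField 0 (antiS ρ + σ) :=
    hρ.antiS.tameField.add (hσ.tameField.mono (by norm_num))
  have hd : ∀ γ s, HasDerivAt ((antiS ρ + σ) γ) (ρ γ s + deriv (σ γ) s) s := fun γ s =>
    (hρ.tameField.hasDerivAt_antiS (by norm_num) γ s).add (hσ.tameField.hasDerivAt γ s)
  have hκ : ∀ γ s, HasDerivAt ((antiS ρ + σ) γ) ((kappa * α : ScalarField γ₀) γ s) s := by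
    intro γ s
    have h1 := h γ s
    rw [nablaS_frameField hf (hα.tameField.mono zero_le_one)
      (hβ.tameField.mono zero_le_one), inner_T_frameField] at h1
    have h2 : dS (antiS ρ + σ) γ s = ρ γ s + deriv (σ γ) s := (hd γ s).deriv
    rw [Pi.sub_apply, Pi.sub_apply, sub_eq_zero] at h1
    rw [← h1, h2]
    exact hd γ s
  funext γ s
  have h1 := hσ.tameField.tendsto_zero (by norm_num) γ
  have ht := (tendsto_balAnti_atTop (hρ.tameField.integrable (by norm_num) γ)).add
    (h1.mono_left le_sup_right)
  have hb := (tendsto_balAnti_atBot (hρ.tameField.integrable (by norm_num) γ)).add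
    (h1.mono_left le_sup_left)
  rw [add_zero] at ht hb
  exact (eq_balAnti (hκ γ) ((Alg.kappa.mul hα).tameField.integrable (by norm_num) γ) ht hb s).symm

theorem phi_add (P Q : TangentField γ₀) : phi (P + Q) = phi P + phi Q := by
  ext γ s <;> exact inner_add_right _ _ _

theorem phi_sub (P Q : TangentField γ₀) : phi (P - Q) = phi P - phi Q := by
  ext γ s <;> exact inner_sub_right _ _ _

/-- Modulo `T`, the operator `J` inverts the vector product with `T`. -/
theorem opJ_phi_cross (S : TangentField γ₀) :
    opJ (phi fun γ s => cross (fieldT γ s) (S γ s)) = phi S := by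
  have h : (fun γ s => cross (fieldT γ s) (S γ s)) = frameField 0 (-(phi S).2) (phi S).1 := by
    funext γ s
    conv_lhs => rw [frameField_phi S]
    rw [fieldT_eq, cross_frameField]
    simp [frameField]
  rw [h, phi_frameField, opJ, neg_neg]

theorem recursionOperator_apply (hX : X ∈ vectorFields γ₀) :
    recursionOperator X = (coefB X, -coefN X) := by
  rw [recursionOperator_eq, nablaS_wp hX, phi_frameField, opJ]

theorem recursionOperator_mem (hX : X ∈ vectorFields γ₀) :
    recursionOperator X ∈ vectorFields γ₀ := by
  rw [recursionOperator_apply hX]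
  exact ⟨alg_coefB hX, (alg_coefN hX).neg⟩

/-- The equation `∂ₛ (℘ X) = T × ℘ (R X)`, through which all computations with `R` go. -/
theorem nablaS_wp_eq_cross (hX : X ∈ vectorFields γ₀) :
    nablaS (wp X) = fun γ s => cross (fieldT γ s) (wp (recursionOperator X) γ s) := by
  rw [nablaS_wp hX, recursionOperator_apply hX]
  funext γ s
  rw [fieldT_eq, wp_eq_frameField, cross_frameField]
  simp [frameField]

/-- If `∂ₛ P = T × S` for a balanced field `P`, then `R (φ P) = φ S`. -/
theorem BalancedField.recursionOperator_phi (hP : BalancedField P)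
    (h : nablaS P = fun γ s => cross (fieldT γ s) (S γ s)) :
    phi P ∈ vectorFields γ₀ ∧ recursionOperator (phi P) = phi S := by
  obtain ⟨h1, h2⟩ := hP.eq_wp fun γ s => by rw [h]; exact inner_cross_left _ _
  refine ⟨h1, ?_⟩
  rw [recursionOperator_eq, ← h2, h, opJ_phi_cross]

/-- The variational differential of `℘ Y` along `℘ X` exists and is a balanced field. -/
theorem varDiff_wp (he : HasDirection γ₀ e) (hX : X ∈ vectorFields γ₀)
    (hY : Y ∈ vectorFields γ₀) :
    VarDiff (wp X) 0 (wp Y) (variation (wp X) (wp Y)) ∧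
      BalancedField (variation (wp X) (wp Y)) := by
  obtain ⟨ρ, hρ, hf⟩ := (alg_kappa_mul hY).exists_varDiff he hX
  obtain ⟨g', hg', hg⟩ := hY.1.exists_varDiff he hX
  obtain ⟨h', hh', hh⟩ := hY.2.exists_varDiff he hX
  have h0 := VarDiff.frameField hX (hf.antiS (by norm_num)) (hg.mono zero_le_one)
    (hh.mono zero_le_one)
  have hv := h0.hasVariation.variation_eq he hX
  rw [wp_eq_frameField Y, hv]
  have hf0 := (alg_kappa_mul hY).antiS
  refine ⟨h0, ρ, -(coefN X * Y.1) - coefB X * Y.2, _, _, hρ,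
    ((alg_coefN hX).mul' hY.1 rfl).neg.sub ((alg_coefB hX).mul' hY.2 rfl),
    (hg'.add ((alg_coefN hX).mul' hf0 rfl)).sub ((alg_coefRot hX).mul' hY.2 rfl),
    (hh'.add ((alg_coefB hX).mul' hf0 rfl)).add ((alg_coefRot hX).mul' hY.1 rfl),
    frameField_congr ?_ rfl rfl⟩
  ring

/-- Varying the equation `∂ₛ (℘ Y) = T × ℘ (R Y)` along `℘ X`, where the variation of `T` is
`∂ₛ (℘ X) = T × ℘ (R X)`. -/
theorem nablaS_variation_wp (he : HasDirection γ₀ e) (hX : X ∈ vectorFields γ₀)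
    (hY : Y ∈ vectorFields γ₀) (γ : BAL γ₀) (s : ℝ) :
    nablaS (variation (wp X) (wp Y)) γ s =
      cross (cross (fieldT γ s) (wp (recursionOperator X) γ s)) (wp (recursionOperator Y) γ s)
        + cross (fieldT γ s) (variation (wp X) (wp (recursionOperator Y)) γ s) := by
  have h1 : HasVariation (wp X) (nablaS (wp Y)) (nablaS (variation (wp X) (wp Y))) :=
    (varDiff_wp he hX hY).1.deriv.hasVariation
  have h2 := ((varDiff_T (tameField_nablaS_wp hX)).cross
    (varDiff_wp he hX (recursionOperator_mem hY)).1).hasVariation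
  rw [← nablaS_wp_eq_cross hY] at h2
  rw [h1.unique he hX h2, nablaS_wp_eq_cross hX]

/-- The antisymmetrized variational differential `∇_{℘ X} (℘ Y) - ∇_{℘ Y} (℘ X)`. -/
noncomputable def wpBracket (X Y : NormalField γ₀) : TangentField γ₀ :=
  variation (wp X) (wp Y) - variation (wp Y) (wp X)

theorem phi_wpBracket (X Y : NormalField γ₀) : phi (wpBracket X Y) = bracket X Y :=
  phi_sub _ _

/-- The Jacobi identity turns `∂ₛ` of the antisymmetrized differential into a vector product with
`T`. -/
theorem recursionOperator_bracket (he : HasDirection γ₀ e) (hX : X ∈ vectorFields γ₀)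
    (hY : Y ∈ vectorFields γ₀) :
    bracket X Y ∈ vectorFields γ₀ ∧ recursionOperator (bracket X Y) =
      phi ((fun γ s => cross (wp (recursionOperator X) γ s) (wp (recursionOperator Y) γ s))
        + (variation (wp X) (wp (recursionOperator Y))
          - variation (wp Y) (wp (recursionOperator X)))) := by
  rw [← phi_wpBracket]
  have hP := (varDiff_wp he hX hY)
  have hQ := (varDiff_wp he hY hX)
  refine (hP.2.sub hQ.2).recursionOperator_phi ?_
  funext γ s
  have h1 : nablaS (variation (wp X) (wp Y) - variation (wp Y) (wp X)) γ s
      = nablaS (variation (wp X) (wp Y)) γ s - nablaS (variation (wp Y) (wp X)) γ s :=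
    ((hP.1.tame'.hasDerivAt γ s).sub (hQ.1.tame'.hasDerivAt γ s)).deriv
  rw [h1, nablaS_variation_wp he hX hY, nablaS_variation_wp he hY hX]
  simp only [Pi.add_apply, Pi.sub_apply]
  rw [cross_add_right, cross_sub_right, ← cross_cross_sub]
  abel

/-- The field representing `R [X, Y]` is balanced, and its `s`-derivative is again a vector product
with `T`. -/
theorem recursionOperator_recursionOperator_bracket (he : HasDirection γ₀ e)
    (hX : X ∈ vectorFields γ₀) (hY : Y ∈ vectorFields γ₀) :
    recursionOperator (recursionOperator (bracket X Y)) =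
      phi ((fun γ s => cross (wp (recursionOperator (recursionOperator X)) γ s)
          (wp (recursionOperator Y) γ s)
        + cross (wp (recursionOperator X) γ s) (wp (recursionOperator (recursionOperator Y)) γ s))
        + (variation (wp X) (wp (recursionOperator (recursionOperator Y)))
          - variation (wp Y) (wp (recursionOperator (recursionOperator X))))) := by
  rw [(recursionOperator_bracket he hX hY).2]
  have hX1 := recursionOperator_mem hX
  have hY1 := recursionOperator_mem hY
  have hP := varDiff_wp he hX hY1
  have hQ := varDiff_wp he hY hX1
  refine ((balancedField_cross_wp hX1 hY1).add (hP.2.sub hQ.2)).recursionOperator_phi ?_ |>.2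
  funext γ s
  have hc := (congrFun (deriv_bilin crossL ((tameField_wp hX1).contDiff γ)
    ((tameField_wp hY1).contDiff γ)) s)
  have hcd : HasDerivAt (fun s => crossL (wp (recursionOperator X) γ s)
      (wp (recursionOperator Y) γ s)) _ s := (contDiff_infty_differentiable
      (contDiff_bilin crossL ((tameField_wp hX1).contDiff γ)
        ((tameField_wp hY1).contDiff γ)) s).hasDerivAt
  have h1 := (hcd.add ((hP.1.tame'.hasDerivAt γ s).sub (hQ.1.tame'.hasDerivAt γ s))).deriv
  refine h1.trans ?_
  rw [hc]
  change cross _ (nablaS (wp (recursionOperator Y)) γ s)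
    + cross (nablaS (wp (recursionOperator X)) γ s) _
    + (nablaS (variation (wp X) (wp (recursionOperator Y))) γ s
      - nablaS (variation (wp Y) (wp (recursionOperator X))) γ s) = _
  rw [nablaS_variation_wp he hX hY1, nablaS_variation_wp he hY hX1, nablaS_wp_eq_cross hX1,
    nablaS_wp_eq_cross hY1]
  simp only [Pi.add_apply, Pi.sub_apply]
  rw [cross_anticomm (wp (recursionOperator X) γ s) (cross (fieldT γ s) _), cross_add_right,
    cross_add_right, cross_sub_right,
    ← cross_cross_sub (fieldT γ s) (wp (recursionOperator (recursionOperator X)) γ s),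
    ← cross_cross_sub (fieldT γ s) (wp (recursionOperator X) γ s)]
  abel

theorem nijenhuis_recursionOperator (he : HasDirection γ₀ e) (hX : X ∈ vectorFields γ₀)
    (hY : Y ∈ vectorFields γ₀) : nijenhuis recursionOperator X Y = 0 := by
  have hX1 := recursionOperator_mem hX
  have hY1 := recursionOperator_mem hY
  rw [nijenhuis, (recursionOperator_bracket he hX1 hY).2, (recursionOperator_bracket he hX hY1).2,
    recursionOperator_recursionOperator_bracket he hX hY, ← phi_wpBracket, ← phi_sub, ← phi_sub,
    ← phi_add, wpBracket]
  have h0 : (0 : NormalField γ₀) = phi 0 := by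
    ext γ s <;> simp [phi]
  rw [h0]
  congr 1
  funext γ s
  simp only [Pi.add_apply, Pi.sub_apply, Pi.zero_apply]
  abel

theorem wp_add (hX : X ∈ vectorFields γ₀) (hY : Y ∈ vectorFields γ₀) :
    wp (X + Y) = wp X + wp Y := by
  funext γ s
  rw [wp, Prod.fst_add, mul_add, antiS_add (alg_kappa_mul hX) (alg_kappa_mul hY)]
  simp only [wp, Prod.snd_add, Pi.add_apply]
  module

/-- Functionals do not depend on `s`. -/
theorem functionals_apply {F : ScalarField γ₀} (hF : F ∈ functionals γ₀) (γ : BAL γ₀) (s : ℝ) :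
    F γ s = F γ 0 := by
  induction hF using Algebra.adjoin_induction with
  | mem f hf =>
    rcases hf with (rfl | rfl) | ⟨g, -, rfl⟩ <;> rfl
  | algebraMap r => rfl
  | add f g _ _ hf hg => rw [Pi.add_apply, Pi.add_apply, hf, hg]; rfl
  | mul f g _ _ hf hg => rw [Pi.mul_apply, Pi.mul_apply, hf, hg]; rfl

theorem nablaS_wp_const_mul (F : BAL γ₀ → ℝ) (X : NormalField γ₀) :
    nablaS (wp (fun γ s => F γ * X.1 γ s, fun γ s => F γ * X.2 γ s))
      = fun γ s => F γ • nablaS (wp X) γ s := by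
  have h : wp (fun γ s => F γ * X.1 γ s, fun γ s => F γ * X.2 γ s)
      = fun γ s => F γ • wp X γ s := by
    have h1 : (kappa * fun γ s => F γ * X.1 γ s) = fun γ s => F γ * (kappa * X.1 : ScalarField γ₀) γ s := by
      funext γ s
      simp only [Pi.mul_apply]
      ring
    funext γ s
    simp only [wp]
    rw [h1, antiS_const_mul]
    module
  funext γ s
  simp only [nablaS, h]
  exact deriv_fun_const_smul_field _ _

theorem isHereditary_recursionOperator (he : HasDirection γ₀ e) :
    IsHereditary (recursionOperator : NormalField γ₀ → NormalField γ₀) where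
  mapsTo _ hX := recursionOperator_mem hX
  map_add X hX Y hY := by
    have h : nablaS (wp X + wp Y) = nablaS (wp X) + nablaS (wp Y) := by
      funext γ s
      exact (((tameField_wp hX).hasDerivAt γ s).add ((tameField_wp hY).hasDerivAt γ s)).deriv
    rw [recursionOperator_eq, recursionOperator_eq, recursionOperator_eq, wp_add hX hY, h, phi_add]
    simp only [opJ, Prod.mk_add_mk, Prod.fst_add, Prod.snd_add, neg_add]
  map_mul F hF X hX := by
    have h : ∀ f : ScalarField γ₀, F * f = fun γ s => F γ 0 * f γ s := fun f => by
      funext γ s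
      rw [Pi.mul_apply, Pi.mul_apply, functionals_apply hF]
    rw [h, h, h, h, recursionOperator_eq, recursionOperator_eq, nablaS_wp_const_mul]
    ext γ s <;> simp [opJ, phi, inner_smul_right]
  torsion_eq_zero _ hX _ hY := nijenhuis_recursionOperator he hX hY

end Recursion

end VortexFilament

theorem theorem4 (γ₀ : ℝ → VortexFilament.E3) (hγ₀ : VortexFilament.IsReferenceCurve γ₀) :
    (∀ X ∈ VortexFilament.vectorFields γ₀, ∀ Y ∈ VortexFilament.vectorFields γ₀,
      (∃! V : VortexFilament.TangentField γ₀,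
        VortexFilament.HasVariation (VortexFilament.wp X) (VortexFilament.wp Y) V) ∧
      VortexFilament.bracket X Y ∈ VortexFilament.vectorFields γ₀) ∧
    VortexFilament.IsHereditary
      (VortexFilament.recursionOperator :
        VortexFilament.NormalField γ₀ → VortexFilament.NormalField γ₀) := by
  obtain ⟨e, he⟩ := hγ₀.exists_hasDirection
  refine ⟨fun X hX Y hY => ⟨?_, (VortexFilament.recursionOperator_bracket he hX hY).1⟩,
    VortexFilament.isHereditary_recursionOperator he⟩
  exact (VortexFilament.varDiff_wp he hX hY).1.hasVariation.existsUnique he hX
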